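/- Let $K$ be a field of characteristic zero. All S-modules are functors from the category of finite sets and bijections to $K$-modules (concentrated in degree $0$), and operads are $K$-linear symmetric operads, with partial compositions $a\circ_i b\in P((I\setminus\{i\})\sqcup J)$ for $a\in P(I)$, $i\in I$, $b\in P(J)$. Let $\mathsf{Ass}^+$, $\mathsf{Ass}$ and $\mathsf{Lie}$ be the operads of unital associative algebras, of associative algebras, and of Lie algebras. Concretely, $\mathsf{Ass}^+(I)$ and $\mathsf{Lie}(I)$ are the multilinear parts of the free unital associative algebra and of the free Lie algebra on $I$ (the span of the words, respectively iterated brackets, in which every element of $I$ occurs exactly once), with composition given by substitution, and $\mathsf{Ass}\subset\mathsf{Ass}^+$ is the suboperad with $\mathsf{Ass}(\varnothing)=0$ and $\mathsf{Ass}(I)=\mathsf{Ass}^+(I)$ for $I\neq\varnothing$. Let $f\colon\mathsf{Lie}\to\mathsf{Ass}\subset\mathsf{Ass}^+$ be the natural morphism, sending the bracket to the commutator. An infinitesimal $\mathsf{Lie}$-bimodule is an S-module $M$ with partial compositions $p\circ_i m$ (linear in $p\in\mathsf{Lie}(I)$ and $m\in M(J)$) and $m\circ_i p$ (linear in $m\in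 M(I)$ and $p\in\mathsf{Lie}(J)$) that are equivariant and satisfy the unit, sequential and parallel associativity axioms of an operad for all composites in which exactly one element is from $M$. Thus $\mathsf{Lie}$ is an infinitesimal bimodule over itself, and $f$ makes $\mathsf{Ass}$ and $\mathsf{Ass}^+$ infinitesimal $\mathsf{Lie}$-bimodules. Equivalently, an infinitesimal $\mathsf{Lie}$-bimodule is a module over the Lie algebra $\mathsf{Lie}$ in the symmetric monoidal category of right $\mathsf{Lie}$-modules (with Day convolution $(M\otimes N)(I)=\bigoplus_{I=I_1\sqcup I_2}M(I_1)\otimes N(I_2)$). For such an $M$ and $k\geq 0$, the symmetric power $\mathrm{Sym}^k(M)$ is the S-module of coinvariants of the symmetric group $\mathfrak S_k$ acting on $M^{\otimes k}$. It is an infinitesimal $\mathsf{Lie}$-bimodule: $-\circ_i q$ acts on the factor of a product $m_1\cdots m_k$ that has $i$ among its inputs, and the Lie algebra $\mathsf{Lie}$ acts by derivations, $[x,m_1\cdots m_k]=\sum_c m_1\cdots[x,m_c]\cdots m_k$. Put $\mathrm{Sym}(\mathsf{Lie})=\bigoplus_{k\geq 0}\mathrm{Sym}^k(\mathsf{Lie})$.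 Then: 1. there is an isomorphism of infinitesimal $\mathsf{Lie}$-bimodules $\mathsf{Ass}^+\cong\mathrm{Sym}(\mathsf{Lie})$; 2. there is an isomorphism of infinitesimal $\mathsf{Lie}$-bimodules $\mathsf{Ass}\cong\bigoplus_{k\geq 1}\mathrm{Sym}^k(\mathsf{Lie})$; 3. there is a morphism of infinitesimal $\mathsf{Lie}$-bimodules $s\colon\mathsf{Ass}\to\mathsf{Lie}$ such that $s\circ f=\mathrm{id}_{\mathsf{Lie}}$. -/

import Mathlib

universe u

noncomputable section

namespace PBWOperad

/-! ### S-modules, operads and infinitesimal bimodules -/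

/-- An S-module over `K` in coordinate-free form: a functor from finite sets and bijections to
`K`-modules (all S-modules here are concentrated in homological degree `0`). -/
structure SModule (K : Type u) [Field K] where
  obj : (I : Type) → [Finite I] → Type u
  [addCommGroup : ∀ (I : Type) [Finite I], AddCommGroup (obj I)]
  [module : ∀ (I : Type) [Finite I], Module K (obj I)]
  map : ∀ {I J : Type} [Finite I] [Finite J], (I ≃ J) → obj I →ₗ[K] obj J
  map_refl : ∀ {I : Type} [Finite I] (a : obj I), map (Equiv.refl I) a = a
  map_trans : ∀ {I J L : Type} [Finite I] [Finite J] [Finite L] (σ : I ≃ J) (τ : J ≃ L)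
    (a : obj I), map (σ.trans τ) a = map τ (map σ a)

attribute [instance] SModule.addCommGroup SModule.module

/-- The input set of a partial composite `a ∘ᵢ b`, where `I` and `J` are the input sets of `a` and
`b`: the set `(I ∖ {i}) ⊔ J`. -/
abbrev Graft {I : Type} (i : I) (J : Type) : Type := {x : I // x ≠ i} ⊕ J

/-- Functoriality of `(I ∖ {i}) ⊔ J` in bijections of `I` and `J`. -/
def graftCongr {I I' J J' : Type} (σ : I ≃ I') (τ : J ≃ J') (i : I) :
    Graft i J ≃ Graft (σ i) J' :=
  Equiv.sumCongr (σ.subtypeEquiv fun x => by simp) τ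

/-- `(I ∖ {i}) ⊔ ((J ∖ {j}) ⊔ L) ≃ (((I ∖ {i}) ⊔ J) ∖ {j}) ⊔ L`. -/
def graftSeq {I J : Type} (i : I) (j : J) (L : Type) :
    Graft i (Graft j L) ≃ Graft (Sum.inr j : Graft i J) L where
  toFun
    | .inl x => .inl ⟨.inl x, by simp⟩
    | .inr (.inl y) => .inl ⟨.inr y.1, by simpa using y.2⟩
    | .inr (.inr z) => .inr z
  invFun
    | .inl ⟨.inl x, _⟩ => .inl x
    | .inl ⟨.inr y, h⟩ => .inr (.inl ⟨y, by simpa using h⟩)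
    | .inr z => .inr (.inr z)
  left_inv := by rintro (x | ⟨y, hy⟩ | z) <;> rfl
  right_inv := by rintro (⟨x | y, h⟩ | z) <;> rfl

/-- `(((I ∖ {k}) ⊔ L) ∖ {i}) ⊔ J ≃ (((I ∖ {i}) ⊔ J) ∖ {k}) ⊔ L` for `i ≠ k`. -/
def graftPar {I : Type} (i k : I) (h : i ≠ k) (J L : Type) :
    Graft (Sum.inl ⟨i, h⟩ : Graft k L) J ≃ Graft (Sum.inl ⟨k, h.symm⟩ : Graft i J) L where
  toFun
    | .inl ⟨.inl x, hx⟩ => .inl ⟨.inl ⟨x.1, fun e => hx (by simp [← e])⟩, fun e => x.2 (by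
        simpa using e)⟩
    | .inl ⟨.inr z, _⟩ => .inr z
    | .inr y => .inl ⟨.inr y, by simp⟩
  invFun
    | .inl ⟨.inl x, hx⟩ => .inl ⟨.inl ⟨x.1, fun e => hx (by simp [← e])⟩, fun e => x.2 (by
        simpa using e)⟩
    | .inl ⟨.inr y, _⟩ => .inr y
    | .inr z => .inl ⟨.inr z, by simp⟩
  left_inv := by rintro (⟨x | y, h⟩ | z) <;> rfl
  right_inv := by rintro (⟨x | y, h⟩ | z) <;> rfl

/-- `J ≃ ({∗} ∖ {∗}) ⊔ J`. -/
def graftUnitLeft (J : Type) : J ≃ Graft () J where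
  toFun y := .inr y
  invFun
    | .inl x => (x.2 rfl).elim
    | .inr y => y
  left_inv _ := rfl
  right_inv := by
    rintro (x | y)
    · exact (x.2 rfl).elim
    · rfl

open Classical in
/-- `I ≃ (I ∖ {i}) ⊔ {∗}`. -/
def graftUnitRight {I : Type} (i : I) : I ≃ Graft i Unit where
  toFun x := if h : x = i then .inr () else .inl ⟨x, h⟩
  invFun
    | .inl x => x.1
    | .inr _ => i
  left_inv x := by by_cases h : x = i <;> simp [h]
  right_inv := by
    rintro (⟨x, hx⟩ | y)
    · simp [hx]
    · simp

/-- A `K`-linear symmetric operad, presented by its unit and its partial compositions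
`comp i a b = a ∘ᵢ b`. -/
structure Operad (K : Type u) [Field K] extends SModule K where
  one : obj Unit
  comp : ∀ {I J : Type} [Finite I] [Finite J] (i : I), obj I →ₗ[K] obj J →ₗ[K] obj (Graft i J)
  comp_map : ∀ {I I' J J' : Type} [Finite I] [Finite I'] [Finite J] [Finite J'] (σ : I ≃ I')
    (τ : J ≃ J') (i : I) (a : obj I) (b : obj J),
    comp (σ i) (map σ a) (map τ b) = map (graftCongr σ τ i) (comp i a b)
  one_comp : ∀ {J : Type} [Finite J] (b : obj J), comp () one b = map (graftUnitLeft J) b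
  comp_one : ∀ {I : Type} [Finite I] (i : I) (a : obj I),
    comp i a one = map (graftUnitRight i) a
  comp_seq : ∀ {I J L : Type} [Finite I] [Finite J] [Finite L] (i : I) (j : J) (a : obj I)
    (b : obj J) (c : obj L),
    comp (Sum.inr j : Graft i J) (comp i a b) c = map (graftSeq i j L) (comp i a (comp j b c))
  comp_par : ∀ {I J L : Type} [Finite I] [Finite J] [Finite L] (i k : I) (h : i ≠ k) (a : obj I)
    (b : obj J) (c : obj L),
    comp (Sum.inl ⟨k, h.symm⟩ : Graft i J) (comp i a b) c =
      map (graftPar i k h J L) (comp (Sum.inl ⟨i, h⟩ : Graft k L) (comp k a c) b)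

/-- A morphism of operads. -/
structure Operad.Hom {K : Type u} [Field K] (P Q : Operad K) where
  app : ∀ (I : Type) [Finite I], P.obj I →ₗ[K] Q.obj I
  app_map : ∀ {I J : Type} [Finite I] [Finite J] (σ : I ≃ J) (a : P.obj I),
    app J (P.map σ a) = Q.map σ (app I a)
  app_one : app Unit P.one = Q.one
  app_comp : ∀ {I J : Type} [Finite I] [Finite J] (i : I) (a : P.obj I) (b : P.obj J),
    app (Graft i J) (P.comp i a b) = Q.comp i (app I a) (app J b)

/-- An infinitesimal bimodule over an operad `P`: an S-module `M` with partial compositions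
`lcomp i p m = p ∘ᵢ m` (a map `P ∘₍₁₎ M → M`) and `rcomp i m p = m ∘ᵢ p` (a map `M ∘₍₁₎ P → M`),
satisfying the unit axioms and the sequential and parallel associativity axioms for composites of
three operations exactly one of which is in `M`. -/
structure InfBimodule {K : Type u} [Field K] (P : Operad K) extends SModule K where
  lcomp : ∀ {I J : Type} [Finite I] [Finite J] (i : I),
    P.obj I →ₗ[K] obj J →ₗ[K] obj (Graft i J)
  rcomp : ∀ {I J : Type} [Finite I] [Finite J] (i : I),
    obj I →ₗ[K] P.obj J →ₗ[K] obj (Graft i J)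
  lcomp_map : ∀ {I I' J J' : Type} [Finite I] [Finite I'] [Finite J] [Finite J'] (σ : I ≃ I')
    (τ : J ≃ J') (i : I) (p : P.obj I) (m : obj J),
    lcomp (σ i) (P.map σ p) (map τ m) = map (graftCongr σ τ i) (lcomp i p m)
  rcomp_map : ∀ {I I' J J' : Type} [Finite I] [Finite I'] [Finite J] [Finite J'] (σ : I ≃ I')
    (τ : J ≃ J') (i : I) (m : obj I) (p : P.obj J),
    rcomp (σ i) (map σ m) (P.map τ p) = map (graftCongr σ τ i) (rcomp i m p)
  one_lcomp : ∀ {J : Type} [Finite J] (m : obj J), lcomp () P.one m = map (graftUnitLeft J) m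
  rcomp_one : ∀ {I : Type} [Finite I] (i : I) (m : obj I),
    rcomp i m P.one = map (graftUnitRight i) m
  lcomp_lcomp : ∀ {I J L : Type} [Finite I] [Finite J] [Finite L] (i : I) (j : J) (p : P.obj I)
    (q : P.obj J) (m : obj L),
    lcomp (Sum.inr j : Graft i J) (P.comp i p q) m =
      map (graftSeq i j L) (lcomp i p (lcomp j q m))
  lcomp_rcomp : ∀ {I J L : Type} [Finite I] [Finite J] [Finite L] (i : I) (j : J) (p : P.obj I)
    (m : obj J) (q : P.obj L),
    rcomp (Sum.inr j : Graft i J) (lcomp i p m) q =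
      map (graftSeq i j L) (lcomp i p (rcomp j m q))
  rcomp_rcomp : ∀ {I J L : Type} [Finite I] [Finite J] [Finite L] (i : I) (j : J) (m : obj I)
    (p : P.obj J) (q : P.obj L),
    rcomp (Sum.inr j : Graft i J) (rcomp i m p) q =
      map (graftSeq i j L) (rcomp i m (P.comp j p q))
  lcomp_par : ∀ {I J L : Type} [Finite I] [Finite J] [Finite L] (i k : I) (h : i ≠ k)
    (p : P.obj I) (q : P.obj J) (m : obj L),
    lcomp (Sum.inl ⟨k, h.symm⟩ : Graft i J) (P.comp i p q) m =
      map (graftPar i k h J L) (rcomp (Sum.inl ⟨i, h⟩ : Graft k L) (lcomp k p m) q)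
  rcomp_par : ∀ {I J L : Type} [Finite I] [Finite J] [Finite L] (i k : I) (h : i ≠ k)
    (m : obj I) (p : P.obj J) (q : P.obj L),
    rcomp (Sum.inl ⟨k, h.symm⟩ : Graft i J) (rcomp i m p) q =
      map (graftPar i k h J L) (rcomp (Sum.inl ⟨i, h⟩ : Graft k L) (rcomp k m q) p)

namespace InfBimodule

variable {K : Type u} [Field K] {P : Operad K}

/-- A morphism of infinitesimal bimodules. -/
structure Hom (M N : InfBimodule P) where
  app : ∀ (I : Type) [Finite I], M.obj I →ₗ[K] N.obj I
  app_map : ∀ {I J : Type} [Finite I] [Finite J] (σ : I ≃ J) (m : M.obj I),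
    app J (M.map σ m) = N.map σ (app I m)
  app_lcomp : ∀ {I J : Type} [Finite I] [Finite J] (i : I) (p : P.obj I) (m : M.obj J),
    app (Graft i J) (M.lcomp i p m) = N.lcomp i p (app J m)
  app_rcomp : ∀ {I J : Type} [Finite I] [Finite J] (i : I) (m : M.obj I) (p : P.obj J),
    app (Graft i J) (M.rcomp i m p) = N.rcomp i (app I m) p

/-- An isomorphism of infinitesimal bimodules. -/
structure Iso (M N : InfBimodule P) where
  hom : Hom M N
  inv : Hom N M
  hom_inv : ∀ (I : Type) [Finite I] (m : M.obj I), inv.app I (hom.app I m) = m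
  inv_hom : ∀ (I : Type) [Finite I] (n : N.obj I), hom.app I (inv.app I n) = n

/-- A morphism of operads `f : P → Q` makes `Q` an infinitesimal `P`-bimodule. -/
def ofHom {Q : Operad K} (f : P.Hom Q) : InfBimodule P where
  toSModule := Q.toSModule
  lcomp i := (Q.comp i).comp (f.app _)
  rcomp i := (Q.comp i).compl₂ (f.app _)
  lcomp_map σ τ i p m := by simp [f.app_map, Q.comp_map]
  rcomp_map σ τ i p m := by simp [f.app_map, Q.comp_map]
  one_lcomp m := by simp [f.app_one, Q.one_comp]
  rcomp_one i m := by simp [f.app_one, Q.comp_one]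
  lcomp_lcomp i j p q m := by simp [f.app_comp, Q.comp_seq]
  lcomp_rcomp i j p q m := by simp [Q.comp_seq]
  rcomp_rcomp i j p q m := by simp [f.app_comp, Q.comp_seq]
  lcomp_par i k h p q m := by simpa [f.app_comp] using Q.comp_par i k h _ _ _
  rcomp_par i k h p q m := by simpa using Q.comp_par i k h _ _ _

/-- An operad is an infinitesimal bimodule over itself. -/
def self (P : Operad K) : InfBimodule P :=
  ofHom (Q := P) ⟨fun _ _ => LinearMap.id, fun _ _ => rfl, rfl, fun _ _ _ => rfl⟩

open Classical DirectSum in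
/-- The direct sum of a family of infinitesimal bimodules. -/
def directSum {ι : Type} (M : ι → InfBimodule P) : InfBimodule P where
  obj I _ := ⨁ k, (M k).obj I
  map σ := DirectSum.lmap fun k => (M k).map σ
  map_refl a := by ext k; simp [DirectSum.lmap_apply, (M k).map_refl]
  map_trans σ τ a := by ext k; simp [DirectSum.lmap_apply, (M k).map_trans]
  lcomp i := LinearMap.mk₂ K (fun p m => DirectSum.lmap (fun k => (M k).lcomp i p) m)
    (fun p q m => by ext k; simp [DirectSum.lmap_apply])
    (fun c p m => by ext k; simp [DirectSum.lmap_apply, DirectSum.smul_apply])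
    (fun p m n => by simp) (fun c p m => by simp)
  rcomp i := LinearMap.mk₂ K (fun m p => DirectSum.lmap (fun k => ((M k).rcomp i).flip p) m)
    (fun m n p => by simp) (fun c m p => by simp)
    (fun m p q => by ext k; simp [DirectSum.lmap_apply])
    (fun c m p => by ext k; simp [DirectSum.lmap_apply, DirectSum.smul_apply])
  lcomp_map σ τ i p m := by ext k; simp [DirectSum.lmap_apply, (M k).lcomp_map]
  rcomp_map σ τ i p m := by ext k; simp [DirectSum.lmap_apply, (M k).rcomp_map]
  one_lcomp m := by ext k; simp [DirectSum.lmap_apply, (M k).one_lcomp]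
  rcomp_one i m := by ext k; simp [DirectSum.lmap_apply, (M k).rcomp_one]
  lcomp_lcomp i j p q m := by ext k; simp [DirectSum.lmap_apply, (M k).lcomp_lcomp]
  lcomp_rcomp i j p q m := by ext k; simp [DirectSum.lmap_apply, (M k).lcomp_rcomp]
  rcomp_rcomp i j p q m := by ext k; simp [DirectSum.lmap_apply, (M k).rcomp_rcomp]
  lcomp_par i l h p q m := by
    ext k; simpa [DirectSum.lmap_apply] using (M k).lcomp_par i l h _ _ _
  rcomp_par i l h p q m := by
    ext k; simpa [DirectSum.lmap_apply] using (M k).rcomp_par i l h _ _ _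

end InfBimodule
end PBWOperad

namespace PBWOperad

/-! ### The operads `Ass⁺`, `Ass` and `Lie` -/

/-- A word in which every letter of `I` occurs exactly once. -/
def IsMultilinear {I : Type} (s : Multiset I) : Prop := s.Nodup ∧ ∀ x, x ∈ s

theorem IsMultilinear.map {I J : Type} (σ : I ≃ J) {s : Multiset I} (hs : IsMultilinear s) :
    IsMultilinear (s.map σ) :=
  ⟨hs.1.map σ.injective, fun y => Multiset.mem_map.2 ⟨σ.symm y, hs.2 _, by simp⟩⟩

open Classical in
/-- The family on `I` with value `b` at `i` and `c x` at `x ≠ i`. -/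
def plug {I : Type} {A : Type u} (i : I) (c : {x : I // x ≠ i} → A) (b : A) (x : I) : A :=
  if h : x = i then b else c ⟨x, h⟩

@[simp] theorem plug_self {I : Type} {A : Type u} (i : I) (c : {x : I // x ≠ i} → A) (b : A) :
    plug i c b i = b := by simp [plug]

theorem plug_of_ne {I : Type} {A : Type u} {i x : I} (h : x ≠ i) (c : {x : I // x ≠ i} → A)
    (b : A) : plug i c b x = c ⟨x, h⟩ := by simp [plug, h]

/-- The effect of a partial composition on the letters of a word. -/
def graftLetters {I J : Type} (i : I) (t : Multiset J) : I → Multiset (Graft i J) :=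
  plug i (fun x => {Sum.inl x}) (t.map Sum.inr)

theorem IsMultilinear.bind {I J : Type} {i : I} {s : Multiset I} {t : Multiset J}
    (hs : IsMultilinear s) (ht : IsMultilinear t) :
    IsMultilinear (s.bind (graftLetters i t)) := by
  refine ⟨Multiset.nodup_bind.2 ⟨fun x _ => ?_, ?_⟩, ?_⟩
  · by_cases h : x = i
    · subst h
      simpa [graftLetters] using ht.1.map Sum.inr_injective
    · simp [graftLetters, plug_of_ne h]
  · refine hs.1.pairwise ?_
    intro x _ y _ hxy
    rw [Function.onFun]
    by_cases hx : x = i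
    · subst hx
      simp [graftLetters, plug_of_ne hxy.symm]
    · by_cases hy : y = i
      · subst hy
        simp [graftLetters, plug_of_ne hx]
      · simpa [graftLetters, plug_of_ne hx, plug_of_ne hy] using hxy.symm
  · rintro (⟨x, hx⟩ | y)
    · exact Multiset.mem_bind.2 ⟨x, hs.2 x, by simp [graftLetters, plug_of_ne hx]⟩
    · exact Multiset.mem_bind.2 ⟨i, hs.2 i, by simpa [graftLetters] using ht.2 y⟩

section Ass

variable (K : Type u) [Field K]

/-- The monomial `x₁ ⋯ xₙ` of the free associative algebra. -/
def assWord {I : Type} (w : List I) : FreeAlgebra K I := (w.map (FreeAlgebra.ι K)).prod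

/-- The span of the monomials with letters `s`. -/
def assPart {I : Type} (s : Multiset I) : Submodule K (FreeAlgebra K I) :=
  Submodule.span K {a | ∃ w : List I, (w : Multiset I) = s ∧ assWord K w = a}

/-- `Ass⁺(I)`: the multilinear part of the free unital associative algebra on `I`, i.e. the span
of the monomials in which every element of `I` occurs exactly once. -/
def assMultilinear (I : Type) : Submodule K (FreeAlgebra K I) :=
  Submodule.span K {a | ∃ w : List I, IsMultilinear (w : Multiset I) ∧ assWord K w = a}

/-- The substitution `x_i ↦ b` (with the letters of `b` renamed), underlying `a ∘ᵢ b`. -/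
def assSubst {I J : Type} (i : I) (b : FreeAlgebra K J) :
    FreeAlgebra K I →ₐ[K] FreeAlgebra K (Graft i J) :=
  FreeAlgebra.lift K (plug i (fun x => FreeAlgebra.ι K (Sum.inl x))
    (FreeAlgebra.lift K (fun y => FreeAlgebra.ι K (Sum.inr y)) b))

/-- Renaming of letters. -/
def assRename {I J : Type} (σ : I → J) : FreeAlgebra K I →ₐ[K] FreeAlgebra K J :=
  FreeAlgebra.lift K fun x => FreeAlgebra.ι K (σ x)

variable {K}

theorem assPart_le {I : Type} {s : Multiset I} (hs : IsMultilinear s) :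
    assPart K s ≤ assMultilinear K I :=
  Submodule.span_mono fun _ ⟨w, hw, h⟩ => ⟨w, hw ▸ hs, h⟩

theorem assPart_mul {I : Type} {s t : Multiset I} {a b : FreeAlgebra K I} (ha : a ∈ assPart K s)
    (hb : b ∈ assPart K t) : a * b ∈ assPart K (s + t) := by
  induction ha using Submodule.span_induction with
  | zero => simp
  | add x y _ _ hx hy => rw [add_mul]; exact add_mem hx hy
  | smul c x _ hx => rw [smul_mul_assoc]; exact Submodule.smul_mem _ _ hx
  | mem a ha =>
    induction hb using Submodule.span_induction with
    | zero => simp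
    | add x y _ _ hx hy => rw [mul_add]; exact add_mem hx hy
    | smul c x _ hx => rw [mul_smul_comm]; exact Submodule.smul_mem _ _ hx
    | mem b hb =>
      obtain ⟨v, rfl, rfl⟩ := ha
      obtain ⟨w, rfl, rfl⟩ := hb
      exact Submodule.subset_span ⟨v ++ w, by simp, by simp [assWord]⟩

theorem assLift_word_mem {I J : Type} (g : I → FreeAlgebra K J) (c : I → Multiset J)
    (hg : ∀ x, g x ∈ assPart K (c x)) (w : List I) :
    FreeAlgebra.lift K g (assWord K w) ∈ assPart K ((w : Multiset I).bind c) := by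
  induction w with
  | nil => exact Submodule.subset_span ⟨[], by simp, by simp [assWord]⟩
  | cons x w ih =>
    have := assPart_mul (hg x) ih
    rw [← Multiset.cons_coe, Multiset.cons_bind]
    simpa [assWord] using this

theorem assWord_mem {I : Type} (w : List I) : assWord K w ∈ assPart K (w : Multiset I) :=
  Submodule.subset_span ⟨w, rfl, rfl⟩

theorem ι_mem_assPart {I : Type} (x : I) : FreeAlgebra.ι K x ∈ assPart K {x} :=
  Submodule.subset_span ⟨[x], rfl, by simp [assWord]⟩

theorem assRename_word {I J : Type} (σ : I → J) (w : List I) :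
    assRename K σ (assWord K w) = assWord K (w.map σ) := by
  simp [assRename, assWord, map_list_prod, Function.comp_def]

theorem assRename_mem {I J : Type} (σ : I ≃ J) {a : FreeAlgebra K I}
    (ha : a ∈ assMultilinear K I) : assRename K σ a ∈ assMultilinear K J := by
  refine Submodule.span_induction (p := fun a _ => assRename K σ a ∈ assMultilinear K J)
    ?_ (by simp) (fun x y _ _ hx hy => by rw [map_add]; exact add_mem hx hy)
    (fun c x _ hx => by rw [map_smul]; exact Submodule.smul_mem _ _ hx) ha
  rintro _ ⟨w, hw, rfl⟩
  rw [assRename_word]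
  exact Submodule.subset_span ⟨_, by simpa using hw.map σ, rfl⟩

theorem exists_linear_list {I : Type} {A : Type u} [Ring A] [Algebra K A] (i : I)
    (c : {x : I // x ≠ i} → A) (w : List I) (hw : w.Nodup) (hi : i ∈ w) :
    ∃ T : A →ₗ[K] A, ∀ b, (w.map (plug i c b)).prod = T b := by
  induction w with
  | nil => simp at hi
  | cons x w ih =>
    obtain ⟨hx, hw⟩ := List.nodup_cons.1 hw
    by_cases h : x = i
    · subst h
      refine ⟨LinearMap.mulRight K (w.map (plug x c 0)).prod, fun b => ?_⟩
      have : w.map (plug x c b) = w.map (plug x c 0) := by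
        refine List.map_congr_left fun y hy => ?_
        have hne : y ≠ x := fun e => hx (e ▸ hy)
        simp [plug_of_ne hne]
      simp [this]
    · obtain ⟨T, hT⟩ := ih hw (by simpa [Ne.symm h] using hi)
      exact ⟨(LinearMap.mulLeft K (c ⟨x, h⟩)).comp T, fun b => by simp [hT, plug_of_ne h]⟩

theorem exists_linear_ass {I J : Type} (i : I) {a : FreeAlgebra K I}
    (ha : a ∈ assMultilinear K I) :
    ∃ T : FreeAlgebra K J →ₗ[K] FreeAlgebra K (Graft i J), ∀ b, assSubst K i b a = T b := by
  refine Submodule.span_induction (p := fun a _ => ∃ T : FreeAlgebra K J →ₗ[K]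
    FreeAlgebra K (Graft i J), ∀ b, assSubst K i b a = T b) ?_ ⟨0, by simp⟩ ?_ ?_ ha
  · rintro _ ⟨w, hw, rfl⟩
    obtain ⟨T, hT⟩ := exists_linear_list (K := K) i (fun x : {x : I // x ≠ i} =>
      FreeAlgebra.ι K (Sum.inl x : Graft i J)) w hw.1 (hw.2 i)
    refine ⟨T.comp (FreeAlgebra.lift K
      (fun y => FreeAlgebra.ι K (Sum.inr y : Graft i J))).toLinearMap, fun b => ?_⟩
    simp [← hT, assSubst, assWord, map_list_prod, Function.comp_def]
  · rintro x y _ _ ⟨T, hT⟩ ⟨T', hT'⟩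
    exact ⟨T + T', fun b => by simp [hT, hT']⟩
  · rintro r x _ ⟨T, hT⟩
    exact ⟨r • T, fun b => by simp [hT]⟩

theorem assSubst_mem {I J : Type} (i : I) {a : FreeAlgebra K I} {b : FreeAlgebra K J}
    (ha : a ∈ assMultilinear K I) (hb : b ∈ assMultilinear K J) :
    assSubst K i b a ∈ assMultilinear K (Graft i J) := by
  obtain ⟨T, hT⟩ := exists_linear_ass (J := J) i ha
  rw [hT]
  refine Submodule.span_induction (p := fun b _ => T b ∈ assMultilinear K (Graft i J)) ?_
    (by simp) (fun x y _ _ hx hy => by rw [map_add]; exact add_mem hx hy)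
    (fun c x _ hx => by rw [map_smul]; exact Submodule.smul_mem _ _ hx) hb
  rintro _ ⟨v, hv, rfl⟩
  rw [← hT]
  refine Submodule.span_induction
    (p := fun a _ => assSubst K i (assWord K v) a ∈ assMultilinear K (Graft i J)) ?_
    (by simp) (fun x y _ _ hx hy => by rw [map_add]; exact add_mem hx hy)
    (fun c x _ hx => by rw [map_smul]; exact Submodule.smul_mem _ _ hx) ha
  rintro _ ⟨w, hw, rfl⟩
  refine assPart_le (hw.bind hv) (assLift_word_mem _ (graftLetters i (v : Multiset J)) ?_ w)
  intro x
  by_cases h : x = i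
  · subst h
    have := assWord_mem (K := K) (v.map (Sum.inr : J → Graft x J))
    rw [← assRename_word] at this
    simpa [graftLetters, assRename] using this
  · simpa [graftLetters, plug_of_ne h] using ι_mem_assPart _

variable (K)

/-- The operad `Ass⁺` of unital associative algebras. -/
def assPlus : Operad K where
  obj I _ := assMultilinear K I
  map σ := (assRename K σ).toLinearMap.restrict fun _ h => assRename_mem σ h
  map_refl a := by
    refine Subtype.ext ?_
    change assRename K id a.1 = AlgHom.id K _ a.1
    congr 1; ext; simp [assRename]
  map_trans σ τ a := by
    refine Subtype.ext ?_
    change assRename K _ a.1 = ((assRename K τ).comp (assRename K σ)) a.1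
    congr 1; ext; simp [assRename]
  one := ⟨FreeAlgebra.ι K (), assPart_le ⟨by simp, by simp⟩ (ι_mem_assPart ())⟩
  comp {I J} _ _ i := LinearMap.mk₂ K (fun a b => ⟨assSubst K i b.1 a.1, assSubst_mem i a.2 b.2⟩)
    (fun a a' b => Subtype.ext (by simp)) (fun c a b => Subtype.ext (by simp))
    (fun a b b' => Subtype.ext (by
      obtain ⟨T, hT⟩ := exists_linear_ass (J := J) i a.2; simp [hT]))
    (fun c a b => Subtype.ext (by
      obtain ⟨T, hT⟩ := exists_linear_ass (J := J) i a.2; simp [hT]))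
  comp_map σ τ i a b := by
    refine Subtype.ext ?_
    change ((assSubst K (σ i) (assRename K τ b.1)).comp (assRename K σ)) a.1 =
      ((assRename K (graftCongr σ τ i)).comp (assSubst K i b.1)) a.1
    congr 1; ext x
    by_cases h : x = i
    · subst h
      simp only [assSubst, assRename, AlgHom.comp_apply, Function.comp_apply,
        FreeAlgebra.lift_ι_apply, plug_self]
      simp only [← AlgHom.comp_apply]
      congr 1; ext y; simp [graftCongr]
    · have h' : σ x ≠ σ i := fun e => h (σ.injective e)
      simp [assSubst, assRename, plug_of_ne h, plug_of_ne h', graftCongr]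
  one_comp b := by
    refine Subtype.ext ?_
    change assSubst K () b.1 (FreeAlgebra.ι K ()) = assRename K (graftUnitLeft _) b.1
    simp [assSubst, assRename, graftUnitLeft]
  comp_one i a := by
    refine Subtype.ext ?_
    change assSubst K i (FreeAlgebra.ι K ()) a.1 = assRename K (graftUnitRight i) a.1
    congr 1; ext x
    by_cases h : x = i
    · subst h; simp [assSubst, assRename, graftUnitRight]
    · simp [assSubst, assRename, graftUnitRight, h, plug_of_ne h]
  comp_seq {I J L} _ _ _ i j a b c := by
    refine Subtype.ext ?_
    change ((assSubst K (Sum.inr j : Graft i J) c.1).comp (assSubst K i b.1)) a.1 =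
      ((assRename K (graftSeq i j L)).comp (assSubst K i (assSubst K j c.1 b.1))) a.1
    congr 1; ext x
    by_cases h : x = i
    · subst h
      simp only [assSubst, assRename, AlgHom.comp_apply, Function.comp_apply,
        FreeAlgebra.lift_ι_apply, plug_self]
      simp only [← AlgHom.comp_apply]
      congr 1; ext y
      by_cases hy : y = j
      · subst hy
        simp only [AlgHom.comp_apply, Function.comp_apply,
          FreeAlgebra.lift_ι_apply, plug_self]
        simp only [← AlgHom.comp_apply]
        congr 1; ext z; simp [graftSeq]
      · have h' : (Sum.inr y : Graft x J) ≠ Sum.inr j := by simpa using hy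
        simp [plug_of_ne h', plug_of_ne hy, graftSeq]
    · have h' : (Sum.inl ⟨x, h⟩ : Graft i J) ≠ Sum.inr j := by simp
      simp [assSubst, assRename, plug_of_ne h, plug_of_ne h', graftSeq]
  comp_par {I J L} _ _ _ i k hik a b c := by
    refine Subtype.ext ?_
    change ((assSubst K (Sum.inl ⟨k, hik.symm⟩ : Graft i J) c.1).comp (assSubst K i b.1)) a.1 =
      ((assRename K (graftPar i k hik J L)).comp
        ((assSubst K (Sum.inl ⟨i, hik⟩ : Graft k L) b.1).comp (assSubst K k c.1))) a.1
    congr 1; ext x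
    by_cases h : x = i
    · subst h
      simp only [assSubst, assRename, AlgHom.comp_apply, Function.comp_apply,
        FreeAlgebra.lift_ι_apply, plug_self, plug_of_ne hik]
      simp only [← AlgHom.comp_apply]
      congr 1; ext y
      have h' : (Sum.inr y : Graft x J) ≠ Sum.inl ⟨k, hik.symm⟩ := by simp
      simp [plug_of_ne h', graftPar]
    · by_cases h2 : x = k
      · subst h2
        simp only [assSubst, assRename, AlgHom.comp_apply, Function.comp_apply,
          FreeAlgebra.lift_ι_apply, plug_self, plug_of_ne hik.symm]
        simp only [← AlgHom.comp_apply]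
        congr 1; ext y
        have h' : (Sum.inr y : Graft x L) ≠ Sum.inl ⟨i, hik⟩ := by simp
        simp [plug_of_ne h', graftPar]
      · have h3 : (Sum.inl ⟨x, h⟩ : Graft i J) ≠ Sum.inl ⟨k, hik.symm⟩ := by simpa using h2
        have h4 : (Sum.inl ⟨x, h2⟩ : Graft k L) ≠ Sum.inl ⟨i, hik⟩ := by simpa using h
        simp [assSubst, assRename, plug_of_ne h, plug_of_ne h2, plug_of_ne h3, plug_of_ne h4,
          graftPar]

end Ass
end PBWOperad

namespace PBWOperad

section Lie

variable (K : Type u) [Field K]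

/-- The letters of a nonassociative word. -/
def letters {I : Type} : FreeMagma I → Multiset I
  | .of x => {x}
  | .mul v w => letters v + letters w

/-- The iterated bracket prescribed by a nonassociative word. -/
def lieWord {I : Type} : FreeMagma I → FreeLieAlgebra K I
  | .of x => FreeLieAlgebra.of K x
  | .mul v w => ⁅lieWord v, lieWord w⁆

/-- The span of the iterated brackets with letters `s`. -/
def liePart {I : Type} (s : Multiset I) : Submodule K (FreeLieAlgebra K I) :=
  Submodule.span K {a | ∃ w : FreeMagma I, letters w = s ∧ lieWord K w = a}

/-- `Lie(I)`: the multilinear part of the free Lie algebra on `I`, i.e. the span of the iterated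
brackets in which every element of `I` occurs exactly once. -/
def lieMultilinear (I : Type) : Submodule K (FreeLieAlgebra K I) :=
  Submodule.span K {a | ∃ w : FreeMagma I, IsMultilinear (letters w) ∧ lieWord K w = a}

/-- The substitution `x_i ↦ b` (with the letters of `b` renamed), underlying `a ∘ᵢ b`. -/
def lieSubst {I J : Type} (i : I) (b : FreeLieAlgebra K J) :
    FreeLieAlgebra K I →ₗ⁅K⁆ FreeLieAlgebra K (Graft i J) :=
  FreeLieAlgebra.lift K (plug i (fun x => FreeLieAlgebra.of K (Sum.inl x))
    (FreeLieAlgebra.lift K (fun y => FreeLieAlgebra.of K (Sum.inr y)) b))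

/-- Renaming of letters. -/
def lieRename {I J : Type} (σ : I → J) : FreeLieAlgebra K I →ₗ⁅K⁆ FreeLieAlgebra K J :=
  FreeLieAlgebra.lift K fun x => FreeLieAlgebra.of K (σ x)

variable {K}

theorem liePart_le {I : Type} {s : Multiset I} (hs : IsMultilinear s) :
    liePart K s ≤ lieMultilinear K I :=
  Submodule.span_mono fun _ ⟨w, hw, h⟩ => ⟨w, hw ▸ hs, h⟩

theorem liePart_lie {I : Type} {s t : Multiset I} {a b : FreeLieAlgebra K I}
    (ha : a ∈ liePart K s) (hb : b ∈ liePart K t) : ⁅a, b⁆ ∈ liePart K (s + t) := by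
  induction ha using Submodule.span_induction with
  | zero => simp
  | add x y _ _ hx hy => rw [add_lie]; exact add_mem hx hy
  | smul c x _ hx => rw [smul_lie]; exact Submodule.smul_mem _ _ hx
  | mem a ha =>
    induction hb using Submodule.span_induction with
    | zero => simp
    | add x y _ _ hx hy => rw [lie_add]; exact add_mem hx hy
    | smul c x _ hx => rw [lie_smul]; exact Submodule.smul_mem _ _ hx
    | mem b hb =>
      obtain ⟨v, rfl, rfl⟩ := ha
      obtain ⟨w, rfl, rfl⟩ := hb
      exact Submodule.subset_span ⟨.mul v w, rfl, rfl⟩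

theorem lieLift_word_mem {I J : Type} (g : I → FreeLieAlgebra K J) (c : I → Multiset J)
    (hg : ∀ x, g x ∈ liePart K (c x)) (w : FreeMagma I) :
    FreeLieAlgebra.lift K g (lieWord K w) ∈ liePart K ((letters w).bind c) := by
  induction w with
  | ih1 x => simpa [lieWord, letters] using hg x
  | ih2 v w hv hw =>
    have := liePart_lie hv hw
    rw [← Multiset.add_bind, ← LieHom.map_lie] at this
    exact this

theorem lieWord_mem {I : Type} (w : FreeMagma I) : lieWord K w ∈ liePart K (letters w) :=
  Submodule.subset_span ⟨w, rfl, rfl⟩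

theorem of_mem_liePart {I : Type} (x : I) : FreeLieAlgebra.of K x ∈ liePart K {x} :=
  lieWord_mem (FreeMagma.of x)

theorem lieRename_word_mem {I J : Type} (σ : I → J) (w : FreeMagma I) :
    lieRename K σ (lieWord K w) ∈ liePart K ((letters w).map σ) := by
  have := lieLift_word_mem (K := K) (fun x => FreeLieAlgebra.of K (σ x)) (fun x => {σ x})
    (fun x => of_mem_liePart _) w
  rwa [Multiset.bind_singleton] at this

theorem lieRename_mem {I J : Type} (σ : I ≃ J) {a : FreeLieAlgebra K I}
    (ha : a ∈ lieMultilinear K I) : lieRename K σ a ∈ lieMultilinear K J := by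
  refine Submodule.span_induction (p := fun a _ => lieRename K σ a ∈ lieMultilinear K J)
    ?_ (by simp) (fun x y _ _ hx hy => by rw [map_add]; exact add_mem hx hy)
    (fun c x _ hx => by rw [map_smul]; exact Submodule.smul_mem _ _ hx) ha
  rintro _ ⟨w, hw, rfl⟩
  exact liePart_le (hw.map σ) (lieRename_word_mem σ w)

theorem lift_word_congr {I : Type} {A : Type u} [LieRing A] [LieAlgebra K A] (i : I)
    (c : {x : I // x ≠ i} → A) (b b' : A) (w : FreeMagma I) (hi : i ∉ letters w) :
    FreeLieAlgebra.lift K (plug i c b) (lieWord K w) =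
      FreeLieAlgebra.lift K (plug i c b') (lieWord K w) := by
  induction w with
  | ih1 x =>
    have h : x ≠ i := by simpa [letters, eq_comm] using hi
    simp [lieWord, plug_of_ne h]
  | ih2 v w hv hw =>
    have h : i ∉ letters v ∧ i ∉ letters w := by
      change i ∉ letters v + letters w at hi
      simpa using hi
    change FreeLieAlgebra.lift K _ ⁅_, _⁆ = FreeLieAlgebra.lift K _ ⁅_, _⁆
    rw [LieHom.map_lie, LieHom.map_lie, hv h.1, hw h.2]

theorem exists_linear_word {I : Type} {A : Type u} [LieRing A] [LieAlgebra K A] (i : I)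
    (c : {x : I // x ≠ i} → A) (w : FreeMagma I) (hw : (letters w).Nodup) (hi : i ∈ letters w) :
    ∃ T : A →ₗ[K] A, ∀ b, FreeLieAlgebra.lift K (plug i c b) (lieWord K w) = T b := by
  induction w with
  | ih1 x =>
    have h : x = i := by simpa [letters, eq_comm] using hi
    subst h
    exact ⟨LinearMap.id, fun b => by simp [lieWord]⟩
  | ih2 v w hv hw' =>
    change (letters v + letters w).Nodup at hw
    change i ∈ letters v + letters w at hi
    obtain ⟨n1, n2, n3⟩ := Multiset.nodup_add.1 hw
    rcases Multiset.mem_add.1 hi with h | h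
    · obtain ⟨T, hT⟩ := hv n1 h
      refine ⟨-(LieAlgebra.ad K A (FreeLieAlgebra.lift K (plug i c 0) (lieWord K w))).comp T,
        fun b => ?_⟩
      change FreeLieAlgebra.lift K _ ⁅_, _⁆ = _
      rw [LieHom.map_lie, hT, lift_word_congr i c b 0 w (Multiset.disjoint_left.1 n3 h)]
      simp
    · obtain ⟨T, hT⟩ := hw' n2 h
      refine ⟨(LieAlgebra.ad K A (FreeLieAlgebra.lift K (plug i c 0) (lieWord K v))).comp T,
        fun b => ?_⟩
      change FreeLieAlgebra.lift K _ ⁅_, _⁆ = _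
      rw [LieHom.map_lie, hT, lift_word_congr i c b 0 v (Multiset.disjoint_right.1 n3 h)]
      simp

theorem exists_linear_lie {I J : Type} (i : I) {a : FreeLieAlgebra K I}
    (ha : a ∈ lieMultilinear K I) :
    ∃ T : FreeLieAlgebra K J →ₗ[K] FreeLieAlgebra K (Graft i J), ∀ b,
      lieSubst K i b a = T b := by
  refine Submodule.span_induction (p := fun a _ => ∃ T : FreeLieAlgebra K J →ₗ[K]
    FreeLieAlgebra K (Graft i J), ∀ b, lieSubst K i b a = T b) ?_ ⟨0, by simp⟩ ?_ ?_ ha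
  · rintro _ ⟨w, hw, rfl⟩
    obtain ⟨T, hT⟩ := exists_linear_word (K := K) i (fun x : {x : I // x ≠ i} =>
      FreeLieAlgebra.of K (Sum.inl x : Graft i J)) w hw.1 (hw.2 i)
    exact ⟨T.comp (FreeLieAlgebra.lift K
      (fun y => FreeLieAlgebra.of K (Sum.inr y : Graft i J))).toLinearMap, fun b => hT _⟩
  · rintro x y _ _ ⟨T, hT⟩ ⟨T', hT'⟩
    exact ⟨T + T', fun b => by simp [hT, hT']⟩
  · rintro r x _ ⟨T, hT⟩
    exact ⟨r • T, fun b => by simp [hT]⟩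

theorem lieSubst_mem {I J : Type} (i : I) {a : FreeLieAlgebra K I} {b : FreeLieAlgebra K J}
    (ha : a ∈ lieMultilinear K I) (hb : b ∈ lieMultilinear K J) :
    lieSubst K i b a ∈ lieMultilinear K (Graft i J) := by
  obtain ⟨T, hT⟩ := exists_linear_lie (J := J) i ha
  rw [hT]
  refine Submodule.span_induction (p := fun b _ => T b ∈ lieMultilinear K (Graft i J)) ?_
    (by simp) (fun x y _ _ hx hy => by rw [map_add]; exact add_mem hx hy)
    (fun c x _ hx => by rw [map_smul]; exact Submodule.smul_mem _ _ hx) hb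
  rintro _ ⟨v, hv, rfl⟩
  rw [← hT]
  refine Submodule.span_induction
    (p := fun a _ => lieSubst K i (lieWord K v) a ∈ lieMultilinear K (Graft i J)) ?_
    (by simp) (fun x y _ _ hx hy => by rw [map_add]; exact add_mem hx hy)
    (fun c x _ hx => by rw [map_smul]; exact Submodule.smul_mem _ _ hx) ha
  rintro _ ⟨w, hw, rfl⟩
  refine liePart_le (hw.bind hv) (lieLift_word_mem _ (graftLetters i (letters v)) ?_ w)
  intro x
  by_cases h : x = i
  · subst h
    simpa [graftLetters, lieRename] using
      lieRename_word_mem (K := K) (Sum.inr : J → Graft x J) v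
  · simpa [graftLetters, plug_of_ne h] using of_mem_liePart _

variable (K)

/-- The operad `Lie` of Lie algebras. -/
def lie : Operad K where
  obj I _ := lieMultilinear K I
  map σ := (lieRename K σ).toLinearMap.restrict fun _ h => lieRename_mem σ h
  map_refl a := by
    refine Subtype.ext ?_
    change lieRename K id a.1 =
      (LieHom.id : FreeLieAlgebra K _ →ₗ⁅K⁆ FreeLieAlgebra K _) a.1
    congr 1; ext; simp [lieRename]
  map_trans σ τ a := by
    refine Subtype.ext ?_
    change lieRename K _ a.1 = ((lieRename K τ).comp (lieRename K σ)) a.1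
    congr 1; ext; simp [lieRename]
  one := ⟨FreeLieAlgebra.of K (), liePart_le ⟨by simp, by simp⟩ (of_mem_liePart ())⟩
  comp {I J} _ _ i := LinearMap.mk₂ K (fun a b => ⟨lieSubst K i b.1 a.1, lieSubst_mem i a.2 b.2⟩)
    (fun a a' b => Subtype.ext (by simp)) (fun c a b => Subtype.ext (by simp))
    (fun a b b' => Subtype.ext (by
      obtain ⟨T, hT⟩ := exists_linear_lie (J := J) i a.2; simp [hT]))
    (fun c a b => Subtype.ext (by
      obtain ⟨T, hT⟩ := exists_linear_lie (J := J) i a.2; simp [hT]))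
  comp_map σ τ i a b := by
    refine Subtype.ext ?_
    change ((lieSubst K (σ i) (lieRename K τ b.1)).comp (lieRename K σ)) a.1 =
      ((lieRename K (graftCongr σ τ i)).comp (lieSubst K i b.1)) a.1
    congr 1; ext x
    by_cases h : x = i
    · subst h
      simp only [lieSubst, lieRename, LieHom.comp_apply,
        FreeLieAlgebra.lift_of_apply, plug_self]
      simp only [← LieHom.comp_apply]
      congr 1; ext y; simp [graftCongr]
    · have h' : σ x ≠ σ i := fun e => h (σ.injective e)
      simp [lieSubst, lieRename, plug_of_ne h, plug_of_ne h', graftCongr]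
  one_comp b := by
    refine Subtype.ext ?_
    change lieSubst K () b.1 (FreeLieAlgebra.of K ()) = lieRename K (graftUnitLeft _) b.1
    simp [lieSubst, lieRename, graftUnitLeft]
  comp_one i a := by
    refine Subtype.ext ?_
    change lieSubst K i (FreeLieAlgebra.of K ()) a.1 = lieRename K (graftUnitRight i) a.1
    congr 1; ext x
    by_cases h : x = i
    · subst h; simp [lieSubst, lieRename, graftUnitRight]
    · simp [lieSubst, lieRename, graftUnitRight, h, plug_of_ne h]
  comp_seq {I J L} _ _ _ i j a b c := by
    refine Subtype.ext ?_
    change ((lieSubst K (Sum.inr j : Graft i J) c.1).comp (lieSubst K i b.1)) a.1 =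
      ((lieRename K (graftSeq i j L)).comp (lieSubst K i (lieSubst K j c.1 b.1))) a.1
    congr 1; ext x
    by_cases h : x = i
    · subst h
      simp only [lieSubst, lieRename, LieHom.comp_apply,
        FreeLieAlgebra.lift_of_apply, plug_self]
      simp only [← LieHom.comp_apply]
      congr 1; ext y
      by_cases hy : y = j
      · subst hy
        simp only [LieHom.comp_apply,
          FreeLieAlgebra.lift_of_apply, plug_self]
        simp only [← LieHom.comp_apply]
        congr 1; ext z; simp [graftSeq]
      · have h' : (Sum.inr y : Graft x J) ≠ Sum.inr j := by simpa using hy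
        simp [plug_of_ne h', plug_of_ne hy, graftSeq]
    · have h' : (Sum.inl ⟨x, h⟩ : Graft i J) ≠ Sum.inr j := by simp
      simp [lieSubst, lieRename, plug_of_ne h, plug_of_ne h', graftSeq]
  comp_par {I J L} _ _ _ i k hik a b c := by
    refine Subtype.ext ?_
    change ((lieSubst K (Sum.inl ⟨k, hik.symm⟩ : Graft i J) c.1).comp (lieSubst K i b.1)) a.1 =
      ((lieRename K (graftPar i k hik J L)).comp
        ((lieSubst K (Sum.inl ⟨i, hik⟩ : Graft k L) b.1).comp (lieSubst K k c.1))) a.1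
    congr 1; ext x
    by_cases h : x = i
    · subst h
      simp only [lieSubst, lieRename, LieHom.comp_apply,
        FreeLieAlgebra.lift_of_apply, plug_self, plug_of_ne hik]
      simp only [← LieHom.comp_apply]
      congr 1; ext y
      have h' : (Sum.inr y : Graft x J) ≠ Sum.inl ⟨k, hik.symm⟩ := by simp
      simp [plug_of_ne h', graftPar]
    · by_cases h2 : x = k
      · subst h2
        simp only [lieSubst, lieRename, LieHom.comp_apply,
          FreeLieAlgebra.lift_of_apply, plug_self, plug_of_ne hik.symm]
        simp only [← LieHom.comp_apply]
        congr 1; ext y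
        have h' : (Sum.inr y : Graft x L) ≠ Sum.inl ⟨i, hik⟩ := by simp
        simp [plug_of_ne h', graftPar]
      · have h3 : (Sum.inl ⟨x, h⟩ : Graft i J) ≠ Sum.inl ⟨k, hik.symm⟩ := by simpa using h2
        have h4 : (Sum.inl ⟨x, h2⟩ : Graft k L) ≠ Sum.inl ⟨i, hik⟩ := by simpa using h
        simp [lieSubst, lieRename, plug_of_ne h, plug_of_ne h2, plug_of_ne h3, plug_of_ne h4,
          graftPar]

end Lie

section Morphisms

variable {K : Type u} [Field K]

/-- The operad obtained from `P` by replacing `P(∅)` by `0`. -/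
def Operad.positive (P : Operad K) : Operad K where
  obj I _ := ({ carrier := {a | IsEmpty I → a = 0}
                add_mem' := fun ha hb h => by rw [ha h, hb h, add_zero]
                zero_mem' := fun _ => rfl
                smul_mem' := fun c a ha h => by rw [ha h, smul_zero] } : Submodule K (P.obj I))
  map σ := (P.map σ).restrict fun a ha h => by
    rw [ha (Equiv.isEmpty σ), map_zero]
  map_refl a := Subtype.ext (P.map_refl a.1)
  map_trans σ τ a := Subtype.ext (P.map_trans σ τ a.1)
  one := ⟨P.one, fun h => (h.false ()).elim⟩
  comp i := LinearMap.mk₂ K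
    (fun a b => ⟨P.comp i a.1 b.1, fun h => by
      rw [b.2 (Function.isEmpty (Sum.inr : _ → Graft i _)), map_zero]⟩)
    (fun a a' b => Subtype.ext (by simp)) (fun c a b => Subtype.ext (by simp))
    (fun a b b' => Subtype.ext (by simp)) (fun c a b => Subtype.ext (by simp))
  comp_map σ τ i a b := Subtype.ext (P.comp_map σ τ i a.1 b.1)
  one_comp b := Subtype.ext (P.one_comp b.1)
  comp_one i a := Subtype.ext (P.comp_one i a.1)
  comp_seq i j a b c := Subtype.ext (P.comp_seq i j a.1 b.1 c.1)
  comp_par i k h a b c := Subtype.ext (P.comp_par i k h a.1 b.1 c.1)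

variable (K)

/-- The operad `Ass` of nonunital associative algebras: `Ass(I) = Ass⁺(I)` for `I ≠ ∅` and
`Ass(∅) = 0`. -/
def ass : Operad K := (assPlus K).positive

attribute [local instance 100] LieRing.ofAssociativeRing

/-- The Lie algebra map from the free Lie algebra to the free associative algebra (with the
commutator bracket) that is the identity on generators. -/
def lieToFree (I : Type) : FreeLieAlgebra K I →ₗ⁅K⁆ FreeAlgebra K I :=
  FreeLieAlgebra.lift K (FreeAlgebra.ι K)

variable {K}

theorem lieToFree_word_mem {I : Type} (w : FreeMagma I) :
    lieToFree K I (lieWord K w) ∈ assPart K (letters w) := by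
  induction w with
  | ih1 x => simpa [lieToFree, lieWord, letters] using ι_mem_assPart x
  | ih2 v w hv hw =>
    change lieToFree K I ⁅_, _⁆ ∈ assPart K (letters v + letters w)
    rw [LieHom.map_lie, LieRing.of_associative_ring_bracket]
    refine sub_mem (assPart_mul hv hw) ?_
    rw [add_comm]
    exact assPart_mul hw hv

theorem lieToFree_mem {I : Type} {a : FreeLieAlgebra K I} (ha : a ∈ lieMultilinear K I) :
    lieToFree K I a ∈ assMultilinear K I := by
  refine Submodule.span_induction (p := fun a _ => lieToFree K I a ∈ assMultilinear K I)
    ?_ (by simp) (fun x y _ _ hx hy => by rw [map_add]; exact add_mem hx hy)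
    (fun c x _ hx => by rw [map_smul]; exact Submodule.smul_mem _ _ hx) ha
  rintro _ ⟨w, hw, rfl⟩
  exact assPart_le hw (lieToFree_word_mem w)

theorem lieToFree_lift {I J : Type} (g : I → FreeLieAlgebra K J) (a : FreeLieAlgebra K I) :
    lieToFree K J (FreeLieAlgebra.lift K g a) =
      FreeAlgebra.lift K (fun x => lieToFree K J (g x)) (lieToFree K I a) := by
  have : (lieToFree K J).comp (FreeLieAlgebra.lift K g) =
      (AlgHom.toLieHom (FreeAlgebra.lift K (fun x => lieToFree K J (g x)))).comp
        (lieToFree K I) := by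
    ext x; simp [lieToFree]
  exact LieHom.congr_fun this a

theorem lieToFree_lie {I : Type} (a b : FreeLieAlgebra K I) :
    lieToFree K I ⁅a, b⁆ = lieToFree K I a * lieToFree K I b - lieToFree K I b * lieToFree K I a :=
  LieHom.map_lie _ _ _

theorem lieToFree_of {I : Type} (x : I) :
    lieToFree K I (FreeLieAlgebra.of K x) = FreeAlgebra.ι K x := by
  simp [lieToFree]

theorem lieToFree_rename {I J : Type} (σ : I → J) (a : FreeLieAlgebra K I) :
    lieToFree K J (lieRename K σ a) = assRename K σ (lieToFree K I a) := by
  rw [lieRename, lieToFree_lift]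
  simp only [lieToFree_of]
  rfl

theorem lieMultilinear_of_isEmpty {I : Type} [IsEmpty I] {a : FreeLieAlgebra K I}
    (ha : a ∈ lieMultilinear K I) : a = 0 := by
  have h : ∀ w : FreeMagma I, False := fun w => by
    induction w with
    | ih1 x => exact isEmptyElim x
    | ih2 _ _ h _ => exact h
  have : lieMultilinear K I = ⊥ := Submodule.span_eq_bot.2 fun _ ⟨w, _⟩ => (h w).elim
  rw [this] at ha
  simpa using ha

variable (K)

/-- The morphism of operads `Lie → Ass⁺` corresponding to the commutator bracket. -/
def lieToAssPlus : (lie K).Hom (assPlus K) where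
  app I _ := (lieToFree K I).toLinearMap.restrict fun _ h => lieToFree_mem h
  app_map σ a := Subtype.ext (by
    change lieToFree K _ (lieRename K σ a.1) = assRename K σ (lieToFree K _ a.1)
    simp [lieRename, assRename, lieToFree_lift]; simp [lieToFree])
  app_one := Subtype.ext (by
    change lieToFree K _ (FreeLieAlgebra.of K ()) = FreeAlgebra.ι K ()
    simp [lieToFree])
  app_comp i a b := Subtype.ext (by
    change lieToFree K _ (lieSubst K i b.1 a.1) =
      assSubst K i (lieToFree K _ b.1) (lieToFree K _ a.1)
    rw [lieSubst, lieToFree_lift, assSubst]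
    congr 2; ext x
    by_cases h : x = i
    · subst h; simp [lieToFree_lift]; simp [lieToFree]
    · simp [plug_of_ne h]; simp [lieToFree])

/-- The natural morphism of operads `Lie → Ass`. -/
def lieToAss : (lie K).Hom (ass K) where
  app I _ := LinearMap.codRestrict _ ((lieToAssPlus K).app I) fun a h => by
    have : a = 0 := Subtype.ext (lieMultilinear_of_isEmpty a.2)
    rw [this, map_zero]
  app_map σ a := Subtype.ext ((lieToAssPlus K).app_map σ a)
  app_one := Subtype.ext (lieToAssPlus K).app_one
  app_comp i a b := Subtype.ext ((lieToAssPlus K).app_comp i a b)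

end Morphisms

end PBWOperad

namespace PBWOperad

theorem SModule.map_congr {K : Type u} [Field K] (M : SModule K) {I J : Type} [Finite I] [Finite J]
    {σ τ : I ≃ J} (h : ∀ x, σ x = τ x) (a : M.obj I) : M.map σ a = M.map τ a := by
  rw [Equiv.ext h]

theorem SModule.map_eq_id {K : Type u} [Field K] (M : SModule K) {I : Type} [Finite I]
    {σ : I ≃ I} (h : ∀ x, σ x = x) (a : M.obj I) : M.map σ a = a := by
  rw [Equiv.ext (g := Equiv.refl I) h, M.map_refl]

theorem SModule.map_map {K : Type u} [Field K] (M : SModule K) {I J L : Type} [Finite I]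
    [Finite J] [Finite L] (σ : I ≃ J) (τ : J ≃ L) (a : M.obj I) :
    M.map τ (M.map σ a) = M.map (σ.trans τ) a := (M.map_trans σ τ a).symm

/-- A variant of `graftCongr` with a propositional equality `σ i = i'`. -/
def graftMap {I I' J J' : Type} (σ : I ≃ I') (τ : J ≃ J') {i : I} {i' : I'} (h : σ i = i') :
    Graft i J ≃ Graft i' J' where
  toFun
    | .inl x => .inl ⟨σ x, fun e => x.2 (σ.injective (e.trans h.symm))⟩
    | .inr y => .inr (τ y)
  invFun
    | .inl x => .inl ⟨σ.symm x, fun e => x.2 ((σ.symm_apply_eq.1 e).trans h)⟩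
    | .inr y => .inr (τ.symm y)
  left_inv := by rintro (x | y) <;> simp
  right_inv := by rintro (x | y) <;> simp

section Bracket

variable (K : Type u) [Field K]

/-- The bracket `[x, y]`, as an operation with inputs `x = false` and `y = true`. -/
def bracket : (lie K).obj Bool :=
  ⟨⁅FreeLieAlgebra.of K false, FreeLieAlgebra.of K true⁆, Submodule.subset_span
    ⟨.mul (.of false) (.of true), ⟨by simp [letters], by simp [letters]⟩, rfl⟩⟩

variable {K}

theorem br_mem {A B : Type} {a : FreeLieAlgebra K A} {b : FreeLieAlgebra K B}
    (ha : a ∈ lieMultilinear K A) (hb : b ∈ lieMultilinear K B) :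
    ⁅lieRename K (Sum.inl : A → A ⊕ B) a, lieRename K (Sum.inr : B → A ⊕ B) b⁆ ∈
      lieMultilinear K (A ⊕ B) := by
  induction ha using Submodule.span_induction with
  | zero => simp
  | add x y _ _ hx hy => rw [map_add, add_lie]; exact add_mem hx hy
  | smul c x _ hx => rw [map_smul, smul_lie]; exact Submodule.smul_mem _ _ hx
  | mem a ha =>
    induction hb using Submodule.span_induction with
    | zero => simp
    | add x y _ _ hx hy => rw [map_add, lie_add]; exact add_mem hx hy
    | smul c x _ hx => rw [map_smul, lie_smul]; exact Submodule.smul_mem _ _ hx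
    | mem b hb =>
      obtain ⟨v, hv, rfl⟩ := ha
      obtain ⟨w, hw, rfl⟩ := hb
      refine liePart_le ⟨?_, ?_⟩
        (liePart_lie (lieRename_word_mem Sum.inl v) (lieRename_word_mem Sum.inr w))
      · refine Multiset.nodup_add.2 ⟨hv.1.map Sum.inl_injective, hw.1.map Sum.inr_injective, ?_⟩
        simp [Multiset.disjoint_left]
      · rintro (x | y)
        · simpa using hv.2 x
        · simpa using hw.2 y

/-- The bracket `[a, b]` of operations with disjoint inputs. -/
def br {A B : Type} [Finite A] [Finite B] :
    (lie K).obj A →ₗ[K] (lie K).obj B →ₗ[K] (lie K).obj (A ⊕ B) :=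
  LinearMap.mk₂ K (fun a b => ⟨_, br_mem a.2 b.2⟩)
    (fun a a' b => Subtype.ext (by
      change ⁅lieRename K _ (a.1 + a'.1), _⁆ = ⁅_, _⁆ + ⁅_, _⁆
      rw [map_add, add_lie]))
    (fun c a b => Subtype.ext (by
      change ⁅lieRename K _ (c • a.1), _⁆ = c • ⁅_, _⁆
      rw [map_smul, smul_lie]))
    (fun a b b' => Subtype.ext (by
      change ⁅_, lieRename K _ (b.1 + b'.1)⁆ = ⁅_, _⁆ + ⁅_, _⁆
      rw [map_add, lie_add]))
    (fun c a b => Subtype.ext (by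
      change ⁅_, lieRename K _ (c • b.1)⁆ = c • ⁅_, _⁆
      rw [map_smul, lie_smul]))

theorem br_coe {A B : Type} [Finite A] [Finite B] (a : (lie K).obj A) (b : (lie K).obj B) :
    (br a b).1 = ⁅lieRename K (Sum.inl : A → A ⊕ B) a.1, lieRename K (Sum.inr : B → A ⊕ B) b.1⁆ :=
  rfl

theorem lie_map_coe {I J : Type} [Finite I] [Finite J] (σ : I ≃ J) (a : (lie K).obj I) :
    ((lie K).map σ a).1 = lieRename K σ a.1 := rfl

theorem lie_comp_coe {I J : Type} [Finite I] [Finite J] (i : I) (a : (lie K).obj I)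
    (b : (lie K).obj J) : ((lie K).comp i a b).1 = lieSubst K i b.1 a.1 := rfl

theorem lieRename_rename {I J L : Type} (σ : I → J) (τ : J → L) (a : FreeLieAlgebra K I) :
    lieRename K τ (lieRename K σ a) = lieRename K (τ ∘ σ) a := by
  change ((lieRename K τ).comp (lieRename K σ)) a = _
  congr 1; ext; simp [lieRename]

theorem lieSubst_rename_of_ne {I I' J : Type} (i : I) (σ : I' → I) (h : ∀ x, σ x ≠ i)
    (b : FreeLieAlgebra K J) (a : FreeLieAlgebra K I') :
    lieSubst K i b (lieRename K σ a) =
      lieRename K (fun x => (Sum.inl ⟨σ x, h x⟩ : Graft i J)) a := by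
  change ((lieSubst K i b).comp (lieRename K σ)) a = _
  congr 1; ext x; simp [lieRename, lieSubst, plug_of_ne (h x)]

theorem lieSubst_rename_of_injective {I I' J : Type} (i' : I') (σ : I' → I)
    (hσ : Function.Injective σ) (b : FreeLieAlgebra K J) (a : FreeLieAlgebra K I') :
    lieSubst K (σ i') b (lieRename K σ a) =
      lieRename K (Sum.map (fun x => ⟨σ x.1, fun e => x.2 (hσ e)⟩) id :
        Graft i' J → Graft (σ i') J) (lieSubst K i' b a) := by
  change ((lieSubst K (σ i') b).comp (lieRename K σ)) a =
    ((lieRename K _).comp (lieSubst K i' b)) a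
  congr 1; ext x
  by_cases h : x = i'
  · subst h
    simp only [lieSubst, lieRename, LieHom.comp_apply, FreeLieAlgebra.lift_of_apply, plug_self]
    simp only [← LieHom.comp_apply]
    congr 1; ext y; simp
  · have h' : σ x ≠ σ i' := fun e => h (hσ e)
    simp [lieRename, lieSubst, plug_of_ne h, plug_of_ne h']

/-- `A ⊔ (B ∖ {i}) ⊔ J ≃ ((A ⊔ B) ∖ {i}) ⊔ J`. -/
def brEquivR (A : Type) {B : Type} (i : B) (J : Type) :
    A ⊕ Graft i J ≃ Graft (Sum.inr i : A ⊕ B) J where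
  toFun
    | .inl a => .inl ⟨.inl a, by simp⟩
    | .inr (.inl b) => .inl ⟨.inr b.1, by simpa using b.2⟩
    | .inr (.inr y) => .inr y
  invFun
    | .inl ⟨.inl a, _⟩ => .inl a
    | .inl ⟨.inr b, h⟩ => .inr (.inl ⟨b, by simpa using h⟩)
    | .inr y => .inr (.inr y)
  left_inv := by rintro (x | ⟨y, hy⟩ | z) <;> rfl
  right_inv := by rintro (⟨x | y, h⟩ | z) <;> rfl

/-- `((A ∖ {i}) ⊔ J) ⊔ B ≃ ((A ⊔ B) ∖ {i}) ⊔ J`. -/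
def brEquivL {A : Type} (B : Type) (i : A) (J : Type) :
    Graft i J ⊕ B ≃ Graft (Sum.inl i : A ⊕ B) J where
  toFun
    | .inl (.inl a) => .inl ⟨.inl a.1, by simpa using a.2⟩
    | .inl (.inr y) => .inr y
    | .inr b => .inl ⟨.inr b, by simp⟩
  invFun
    | .inl ⟨.inl a, h⟩ => .inl (.inl ⟨a, by simpa using h⟩)
    | .inl ⟨.inr b, _⟩ => .inr b
    | .inr y => .inl (.inr y)
  left_inv := by rintro ((⟨x, hx⟩ | y) | z) <;> rfl
  right_inv := by rintro (⟨x | y, h⟩ | z) <;> rfl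

theorem comp_br_inr {A B J : Type} [Finite A] [Finite B] [Finite J] (i : B) (a : (lie K).obj A)
    (b : (lie K).obj B) (c : (lie K).obj J) :
    (lie K).comp (Sum.inr i : A ⊕ B) (br a b) c =
      (lie K).map (brEquivR A i J) (br a ((lie K).comp i b c)) := by
  refine Subtype.ext ?_
  rw [lie_comp_coe, lie_map_coe, br_coe, br_coe, LieHom.map_lie, LieHom.map_lie,
    lieSubst_rename_of_ne _ _ (by simp), lieSubst_rename_of_injective _ _ Sum.inr_injective,
    lieRename_rename, lieRename_rename, lie_comp_coe]
  congr 2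
  congr 1; ext (x | y) <;> rfl

theorem comp_br_inl {A B J : Type} [Finite A] [Finite B] [Finite J] (i : A) (a : (lie K).obj A)
    (b : (lie K).obj B) (c : (lie K).obj J) :
    (lie K).comp (Sum.inl i : A ⊕ B) (br a b) c =
      (lie K).map (brEquivL B i J) (br ((lie K).comp i a c) b) := by
  refine Subtype.ext ?_
  rw [lie_comp_coe, lie_map_coe, br_coe, br_coe, LieHom.map_lie, LieHom.map_lie,
    lieSubst_rename_of_ne _ Sum.inr (by simp), lieSubst_rename_of_injective _ _ Sum.inl_injective,
    lieRename_rename, lieRename_rename, lie_comp_coe]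
  congr 2
  congr 1; ext (x | y) <;> rfl

/-- `A ⊔ B`, as the set of inputs of `[-, -]` with operations substituted in both slots. -/
def brEquiv (A B : Type) : Graft (Sum.inl ⟨false, by simp⟩ : Graft true B) A ≃ A ⊕ B where
  toFun
    | .inl ⟨.inl ⟨false, _⟩, h⟩ => (h rfl).elim
    | .inl ⟨.inl ⟨true, h⟩, _⟩ => (h rfl).elim
    | .inl ⟨.inr b, _⟩ => .inr b
    | .inr a => .inl a
  invFun
    | .inl a => .inr a
    | .inr b => .inl ⟨.inr b, by simp⟩
  left_inv := by
    rintro (⟨⟨_ | _, h⟩ | b, h'⟩ | a)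
    · exact (h' rfl).elim
    · exact (h rfl).elim
    · rfl
    · rfl
  right_inv := by rintro (a | b) <;> rfl

theorem br_eq_comp {A B : Type} [Finite A] [Finite B] (a : (lie K).obj A) (b : (lie K).obj B) :
    br a b = (lie K).map (brEquiv A B) ((lie K).comp (Sum.inl ⟨false, by simp⟩ : Graft true B)
      ((lie K).comp true (bracket K) b) a) := by
  refine Subtype.ext ?_
  have hne : ∀ y : B, (Sum.inr y : Graft true B) ≠ Sum.inl ⟨false, by simp⟩ := by simp
  have e1 : lieSubst K true b.1 (FreeLieAlgebra.of K false) =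
      FreeLieAlgebra.of K (Sum.inl ⟨false, by simp⟩ : Graft true B) := by
    simp [lieSubst, plug]
  have e2 : lieSubst K true b.1 (FreeLieAlgebra.of K true) = lieRename K Sum.inr b.1 := by
    simp [lieSubst, lieRename]
  have e3 : lieSubst K (Sum.inl ⟨false, by simp⟩ : Graft true B) a.1 (FreeLieAlgebra.of K
      (Sum.inl ⟨false, by simp⟩ : Graft true B)) = lieRename K Sum.inr a.1 := by
    simp [lieSubst, lieRename]
  rw [lie_map_coe, lie_comp_coe, lie_comp_coe, br_coe]
  change _ = lieRename K _ (lieSubst K _ _ (lieSubst K _ _ ⁅_, _⁆))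
  rw [LieHom.map_lie, LieHom.map_lie, LieHom.map_lie, e1, e2, e3, lieRename_rename,
    lieSubst_rename_of_ne _ _ hne, lieRename_rename]
  rfl

/-- Every iterated bracket without repeated letters is a renaming of an operation built from the
unit by bracketing. -/
theorem lie_induction_aux (C : ∀ (I : Type) [Finite I], (lie K).obj I → Prop)
    (one : C Unit (lie K).one)
    (brk : ∀ {A B : Type} [Finite A] [Finite B] (a : (lie K).obj A) (b : (lie K).obj B),
      C A a → C B b → C (A ⊕ B) (br a b)) {I : Type} (w : FreeMagma I) (hw : (letters w).Nodup) :
    ∃ (A : Type) (_ : Finite A) (φ : A → I) (a : (lie K).obj A), Function.Injective φ ∧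
      (∀ x, x ∈ letters w ↔ ∃ y, φ y = x) ∧ C A a ∧ lieRename K φ a.1 = lieWord K w := by
  induction w with
  | ih1 x =>
    refine ⟨Unit, inferInstance, fun _ => x, (lie K).one, fun _ _ _ => rfl, ?_, one, ?_⟩
    · intro y; simp [letters, eq_comm]
    · change lieRename K _ (FreeLieAlgebra.of K ()) = _
      simp [lieRename, lieWord]
  | ih2 v w hv hw' =>
    change (letters v + letters w).Nodup at hw
    obtain ⟨n1, n2, n3⟩ := Multiset.nodup_add.1 hw
    obtain ⟨A, _, φ, a, hφ, hA, ca, ea⟩ := hv n1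
    obtain ⟨B, _, ψ, b, hψ, hB, cb, eb⟩ := hw' n2
    refine ⟨A ⊕ B, inferInstance, Sum.elim φ ψ, br a b, ?_, ?_, brk a b ca cb, ?_⟩
    · refine hφ.sumElim hψ fun x y e => ?_
      exact Multiset.disjoint_left.1 n3 ((hA _).2 ⟨x, rfl⟩) ((hB _).2 ⟨y, e.symm⟩)
    · intro x
      change x ∈ letters v + letters w ↔ _
      simp [hA, hB]
    · rw [br_coe, LieHom.map_lie, lieRename_rename, lieRename_rename]
      change ⁅lieRename K φ a.1, lieRename K ψ b.1⁆ = ⁅lieWord K v, lieWord K w⁆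
      rw [ea, eb]

theorem lie_induction (C : ∀ (I : Type) [Finite I], (lie K).obj I → Prop)
    (zero : ∀ (I : Type) [Finite I], C I 0)
    (add : ∀ {I : Type} [Finite I] (a b : (lie K).obj I), C I a → C I b → C I (a + b))
    (smul : ∀ {I : Type} [Finite I] (c : K) (a : (lie K).obj I), C I a → C I (c • a))
    (map : ∀ {I J : Type} [Finite I] [Finite J] (σ : I ≃ J) (a : (lie K).obj I), C I a →
      C J ((lie K).map σ a))
    (one : C Unit (lie K).one)
    (brk : ∀ {A B : Type} [Finite A] [Finite B] (a : (lie K).obj A) (b : (lie K).obj B),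
      C A a → C B b → C (A ⊕ B) (br a b)) {I : Type} [Finite I] (a : (lie K).obj I) : C I a := by
  obtain ⟨a, ha⟩ := a
  refine Submodule.span_induction (p := fun a h => C I ⟨a, h⟩) ?_ (zero I)
    (fun x y hx hy => add ⟨x, hx⟩ ⟨y, hy⟩) (fun c x hx => smul c ⟨x, hx⟩) ha
  rintro _ ⟨w, hw, rfl⟩
  obtain ⟨A, _, φ, a, hφ, hA, ca, ea⟩ := lie_induction_aux C one brk w hw.1
  have := map (Equiv.ofBijective φ ⟨hφ, fun x => (hA x).1 (hw.2 x)⟩) a ca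
  rwa [show (lie K).map (Equiv.ofBijective φ ⟨hφ, fun x => (hA x).1 (hw.2 x)⟩) a =
    ⟨lieWord K w, Submodule.subset_span ⟨w, hw, rfl⟩⟩ from Subtype.ext ea] at this

/-- Induction on operations with a marked input: `Lie` is generated under bijections and linear
combinations by the unit and by brackets `[a, b]` with the marked input in `b`. -/
theorem lie_induction_marked (C : ∀ (I : Type) [Finite I], I → (lie K).obj I → Prop)
    (zero : ∀ {I : Type} [Finite I] (i : I), C I i 0)
    (add : ∀ {I : Type} [Finite I] (i : I) (a b : (lie K).obj I), C I i a → C I i b →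
      C I i (a + b))
    (smul : ∀ {I : Type} [Finite I] (i : I) (c : K) (a : (lie K).obj I), C I i a →
      C I i (c • a))
    (map : ∀ {I J : Type} [Finite I] [Finite J] (σ : I ≃ J) (i : I) (a : (lie K).obj I),
      C I i a → C J (σ i) ((lie K).map σ a))
    (one : C Unit () (lie K).one)
    (brk : ∀ {A B : Type} [Finite A] [Finite B] (i : B) (a : (lie K).obj A) (b : (lie K).obj B),
      C B i b → C (A ⊕ B) (Sum.inr i) (br a b)) {I : Type} [Finite I] (i : I)
    (a : (lie K).obj I) : C I i a := by
  refine lie_induction (fun I _ a => ∀ i, C I i a) (fun I _ i => zero i)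
    (fun a b ha hb i => add i a b (ha i) (hb i)) (fun c a ha i => smul i c a (ha i)) ?_ ?_ ?_ a i
  · intro I J _ _ σ a ha j
    simpa using map σ (σ.symm j) a (ha _)
  · exact fun _ => one
  · rintro A B _ _ a b ha hb (i | i)
    · have := smul _ (-1) _ (map (Equiv.sumComm B A) _ _ (brk i b a (ha i)))
      have e : br a b = (-1 : K) • (lie K).map (Equiv.sumComm B A) (br b a) := ?_
      · rw [e]; exact this
      refine Subtype.ext ?_
      change _ = (-1 : K) • ((lie K).map (Equiv.sumComm B A) (br b a)).1
      rw [lie_map_coe, br_coe, br_coe, LieHom.map_lie, lieRename_rename, lieRename_rename,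
        ← lie_skew, neg_one_smul]
      rfl
    · exact brk i a b (hb i)

end Bracket
end PBWOperad

namespace PBWOperad

/-! ### Modules over the Lie algebra `Lie` in right `Lie`-modules -/

/-- `((J ∖ {j}) ⊔ L) ⊔ {∗} ≃ ((J ⊔ {∗}) ∖ {j}) ⊔ L`. -/
def optGraft {J : Type} (j : J) (L : Type) : Option (Graft j L) ≃ Graft (some j) L where
  toFun
    | none => .inl ⟨none, by simp⟩
    | some (.inl x) => .inl ⟨some x.1, by simpa using x.2⟩
    | some (.inr y) => .inr y
  invFun
    | .inl ⟨none, _⟩ => none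
    | .inl ⟨some x, h⟩ => some (.inl ⟨x, by simpa using h⟩)
    | .inr y => some (.inr y)
  left_inv := by rintro (_ | x | y) <;> rfl
  right_inv := by rintro (⟨_ | x, h⟩ | y) <;> rfl

/-- The identification of the two new inputs of `J ⊔ {∗} ⊔ {∗}` with `Bool`, the outer one (`none`)
corresponding to `b`. -/
def twoEquiv (J : Type) (b : Bool) : Option (Option J) ≃ Graft (none : Option J) Bool where
  toFun
    | none => .inr b
    | some none => .inr !b
    | some (some j) => .inl ⟨some j, by simp⟩
  invFun
    | .inl ⟨none, h⟩ => (h rfl).elim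
    | .inl ⟨some j, _⟩ => some (some j)
    | .inr c => if c = b then none else some none
  left_inv := by rintro (_ | _ | j) <;> simp
  right_inv := by
    rintro (⟨_ | x, h⟩ | c)
    · exact (h rfl).elim
    · rfl
    · cases b <;> cases c <;> rfl

/-- A module over the Lie algebra `Lie` in the symmetric monoidal category of right `Lie`-modules.
As `Lie` is generated by its unit `x_∗` as a right module, the action `Lie ⊗ M → M` is given by
the map `ad m = [x_∗, m]`, natural in bijections, which has to commute with the right action on
`m`, and for which `[[x, y], m] = [x, [y, m]] - [y, [x, m]]`. -/
structure LieModule (K : Type u) [Field K] extends SModule K where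
  rcomp : ∀ {I J : Type} [Finite I] [Finite J] (i : I),
    obj I →ₗ[K] (lie K).obj J →ₗ[K] obj (Graft i J)
  ad : ∀ {J : Type} [Finite J], obj J →ₗ[K] obj (Option J)
  rcomp_map : ∀ {I I' J J' : Type} [Finite I] [Finite I'] [Finite J] [Finite J'] (σ : I ≃ I')
    (τ : J ≃ J') (i : I) (m : obj I) (p : (lie K).obj J),
    rcomp (σ i) (map σ m) ((lie K).map τ p) = map (graftCongr σ τ i) (rcomp i m p)
  rcomp_one : ∀ {I : Type} [Finite I] (i : I) (m : obj I),
    rcomp i m (lie K).one = map (graftUnitRight i) m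
  rcomp_rcomp : ∀ {I J L : Type} [Finite I] [Finite J] [Finite L] (i : I) (j : J) (m : obj I)
    (p : (lie K).obj J) (q : (lie K).obj L),
    rcomp (Sum.inr j : Graft i J) (rcomp i m p) q =
      map (graftSeq i j L) (rcomp i m ((lie K).comp j p q))
  rcomp_par : ∀ {I J L : Type} [Finite I] [Finite J] [Finite L] (i k : I) (h : i ≠ k)
    (m : obj I) (p : (lie K).obj J) (q : (lie K).obj L),
    rcomp (Sum.inl ⟨k, h.symm⟩ : Graft i J) (rcomp i m p) q =
      map (graftPar i k h J L) (rcomp (Sum.inl ⟨i, h⟩ : Graft k L) (rcomp k m q) p)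
  ad_map : ∀ {J J' : Type} [Finite J] [Finite J'] (τ : J ≃ J') (m : obj J),
    ad (map τ m) = map (Equiv.optionCongr τ) (ad m)
  rcomp_ad : ∀ {J L : Type} [Finite J] [Finite L] (j : J) (m : obj J) (q : (lie K).obj L),
    rcomp (some j) (ad m) q = map (optGraft j L) (ad (rcomp j m q))
  ad_bracket : ∀ {J : Type} [Finite J] (m : obj J),
    rcomp none (ad m) (bracket K) =
      map (twoEquiv J false) (ad (ad m)) - map (twoEquiv J true) (ad (ad m))

/-- The coefficient of a word in an element of the free associative algebra. -/
def wordCoeff {K : Type u} [Field K] {I : Type} (w : List I) : FreeAlgebra K I →ₗ[K] K where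
  toFun a := (FreeAlgebra.equivMonoidAlgebraFreeMonoid a).coeff (FreeMonoid.ofList w)
  map_add' a b := by simp
  map_smul' c a := by simp

/-- `(Fin r ⊔ J) ⊔ {∗} ≃ Fin (r + 1) ⊔ J`, with `∗` corresponding to `0`. -/
def finSuccSum (r : ℕ) (J : Type) : Option (Fin r ⊕ J) ≃ Fin (r + 1) ⊕ J where
  toFun
    | none => .inl 0
    | some (.inl x) => .inl x.succ
    | some (.inr y) => .inr y
  invFun
    | .inl x => Fin.cases none (fun k => some (.inl k)) x
    | .inr y => some (.inr y)
  left_inv := by rintro (_ | x | y) <;> simp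
  right_inv := by
    rintro (x | y)
    · induction x using Fin.cases <;> simp
    · rfl

namespace LieModule

variable {K : Type u} [Field K] (V : LieModule K)

/-- The iterated bracket `[x₀, [x₁, …, [x_{r-1}, m]]]`. -/
def iterAd {J : Type} [Finite J] : (r : ℕ) → V.obj J →ₗ[K] V.obj (Fin r ⊕ J)
  | 0 => V.map (Equiv.emptySum (Fin 0) J).symm
  | r + 1 => (V.map (finSuccSum r J)).comp (V.ad.comp (iterAd r))

/-- Reordering the new inputs of an iterated bracket. -/
def ordMap {r : ℕ} {Y J : Type} (e : Fin r ≃ Y) : Fin r ⊕ J ≃ Y ⊕ J :=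
  Equiv.sumCongr e (Equiv.refl J)

/-- The word `e₀ e₁ ⋯ e_{r-1} i`. -/
def ordWord {I : Type} {i : I} {r : ℕ} (e : Fin r ≃ {x : I // x ≠ i}) : List I :=
  List.ofFn (fun k => (e k).1) ++ [i]

open Classical in
/-- The left action: every `p` in `Lie(I)` is the sum of the `c_e [e₀, [e₁, …, [e_{r-1}, i]]]`,
where `e` runs through the orderings of `I ∖ {i}` and `c_e` is the coefficient of the word
`e₀ e₁ ⋯ e_{r-1} i` in (the associative polynomial) `p`. So `p ∘ᵢ m` is the sum of the
`c_e [e₀, [e₁, …, [e_{r-1}, m]]]`. -/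
def lcompAux (r : ℕ) {I J : Type} [Finite I] [Finite J] (i : I) :
    (lie K).obj I →ₗ[K] V.obj J →ₗ[K] V.obj (Graft i J) :=
  letI := Fintype.ofFinite (Fin r ≃ {x : I // x ≠ i})
  ∑ e : Fin r ≃ {x : I // x ≠ i},
    (LinearMap.toSpanSingleton K (V.obj J →ₗ[K] V.obj (Graft i J))
      ((V.map (ordMap e)).comp (V.iterAd r))).comp
        ((wordCoeff (ordWord e)).comp
          ((assMultilinear K I).subtype.comp ((lieToAssPlus K).app I)))

/-- The left action (`lcompAux` with `r` the number of elements of `I ∖ {i}`). -/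
def lcomp {I J : Type} [Finite I] [Finite J] (i : I) :
    (lie K).obj I →ₗ[K] V.obj J →ₗ[K] V.obj (Graft i J) :=
  V.lcompAux (Nat.card {x : I // x ≠ i}) i

end LieModule

theorem wordCoeff_word {K : Type u} [Field K] {I : Type} [DecidableEq I] (w w' : List I) :
    wordCoeff w (assWord K w') = if w' = w then 1 else 0 := by
  have : FreeAlgebra.equivMonoidAlgebraFreeMonoid (assWord K w') =
      MonoidAlgebra.single (FreeMonoid.ofList w') (1 : K) := by
    induction w' with
    | nil => simp [assWord]; rfl
    | cons x w' ih =>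
      have e : assWord K (x :: w') = FreeAlgebra.ι K x * assWord K w' := by simp [assWord]
      rw [e, map_mul, ih]
      simp [FreeAlgebra.equivMonoidAlgebraFreeMonoid, MonoidAlgebra.of, FreeMonoid.ofList_cons]
  change (FreeAlgebra.equivMonoidAlgebraFreeMonoid _).coeff _ = _
  classical
  rw [this, MonoidAlgebra.coeff_single, Finsupp.single_apply]
  exact if_congr Iff.rfl rfl rfl

theorem assWord_span {K : Type u} [Field K] {I : Type} :
    Submodule.span K (Set.range (assWord K : List I → _)) = ⊤ := by
  rw [eq_top_iff]
  rintro a -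
  induction a using FreeAlgebra.induction with
  | grade0 r =>
    rw [Algebra.algebraMap_eq_smul_one]
    exact Submodule.smul_mem _ _ (Submodule.subset_span ⟨[], by simp [assWord]⟩)
  | grade1 x => exact Submodule.subset_span ⟨[x], by simp [assWord]⟩
  | add a b ha hb => exact add_mem ha hb
  | mul a b ha hb =>
    have := Submodule.mul_mem_mul ha hb
    rw [Submodule.span_mul_span] at this
    refine Submodule.span_mono ?_ this
    rintro _ ⟨_, ⟨v, rfl⟩, _, ⟨w, rfl⟩, rfl⟩
    exact ⟨v ++ w, by simp [assWord]⟩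

theorem ass_ext {K : Type u} [Field K] {I : Type} {N : Type*} [AddCommGroup N] [Module K N]
    {f g : FreeAlgebra K I →ₗ[K] N} (h : ∀ w, f (assWord K w) = g (assWord K w)) : f = g :=
  LinearMap.ext_on_range assWord_span h

theorem wordCoeff_rename {K : Type u} [Field K] {I J : Type} {σ : I → J}
    (hσ : Function.Injective σ) (w : List I) (a : FreeAlgebra K I) :
    wordCoeff (w.map σ) (assRename K σ a) = wordCoeff w a := by
  classical
  have : (wordCoeff (w.map σ)).comp (assRename K σ).toLinearMap = wordCoeff (K := K) w := by
    refine ass_ext fun w' => ?_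
    simp [assRename_word, wordCoeff_word, (List.map_injective_iff.2 hσ).eq_iff]
  exact LinearMap.congr_fun this a

theorem wordCoeff_ι_mul {K : Type u} [Field K] {I : Type} [DecidableEq I] (x y : I) (w : List I)
    (a : FreeAlgebra K I) :
    wordCoeff (y :: w) (FreeAlgebra.ι K x * a) = if x = y then wordCoeff w a else 0 := by
  have : (wordCoeff (y :: w)).comp (LinearMap.mulLeft K (FreeAlgebra.ι K x)) =
      if x = y then wordCoeff (K := K) w else 0 := by
    refine ass_ext fun w' => ?_
    have e : FreeAlgebra.ι K x * assWord K w' = assWord K (x :: w') := by simp [assWord]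
    rw [LinearMap.comp_apply, LinearMap.mulLeft_apply, e, wordCoeff_word]
    by_cases h : x = y <;> simp [wordCoeff_word, h]
  have := LinearMap.congr_fun this a
  by_cases h : x = y <;> simpa [h] using this

theorem wordCoeff_mul_ι {K : Type u} [Field K] {I : Type} {x y : I} (h : x ≠ y) (w : List I)
    (a : FreeAlgebra K I) : wordCoeff (w ++ [y]) (a * FreeAlgebra.ι K x) = 0 := by
  classical
  have : (wordCoeff (w ++ [y])).comp (LinearMap.mulRight K (FreeAlgebra.ι K x)) =
      (0 : _ →ₗ[K] K) := by
    refine ass_ext fun w' => ?_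
    have e : assWord K w' * FreeAlgebra.ι K x = assWord K (w' ++ [x]) := by simp [assWord]
    have hne : w' ++ [x] ≠ w ++ [y] := by
      intro e'
      have := (List.append_inj' e' rfl).2
      simp [h] at this
    simp [e, wordCoeff_word, hne]
  exact LinearMap.congr_fun this a

end PBWOperad

namespace PBWOperad

namespace LieModule

variable {K : Type u} [Field K] (V : LieModule K)

theorem rcomp_map' {I I' J J' : Type} [Finite I] [Finite I'] [Finite J] [Finite J'] (σ : I ≃ I')
    (τ : J ≃ J') {i : I} {i' : I'} (h : σ i = i') (m : V.obj I) (p : (lie K).obj J) :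
    V.rcomp i' (V.map σ m) ((lie K).map τ p) = V.map (graftMap σ τ h) (V.rcomp i m p) := by
  subst h
  rw [V.rcomp_map]
  exact V.map_congr (by rintro (x | y) <;> rfl) _

theorem rcomp_mapl {I I' J : Type} [Finite I] [Finite I'] [Finite J] (σ : I ≃ I')
    {i : I} {i' : I'} (h : σ i = i') (m : V.obj I) (p : (lie K).obj J) :
    V.rcomp i' (V.map σ m) p = V.map (graftMap σ (Equiv.refl J) h) (V.rcomp i m p) := by
  rw [← V.rcomp_map' σ (Equiv.refl J) h, (lie K).map_refl]

theorem rcomp_mapr {I J J' : Type} [Finite I] [Finite J] [Finite J']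
    (τ : J ≃ J') (i : I) (m : V.obj I) (p : (lie K).obj J) :
    V.rcomp i m ((lie K).map τ p) =
      V.map (graftMap (Equiv.refl I) τ (Equiv.refl_apply i)) (V.rcomp i m p) := by
  rw [← V.rcomp_map' (Equiv.refl I) τ (Equiv.refl_apply i), V.map_refl]

theorem iterAd_map {J J' : Type} [Finite J] [Finite J'] (τ : J ≃ J') (r : ℕ) (m : V.obj J) :
    V.iterAd r (V.map τ m) = V.map (Equiv.sumCongr (Equiv.refl _) τ) (V.iterAd r m) := by
  induction r with
  | zero =>
    simp only [iterAd, SModule.map_map]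
    exact V.map_congr (by intro x; rfl) _
  | succ r ih =>
    simp only [iterAd, LinearMap.comp_apply, ih, V.ad_map, SModule.map_map]
    exact V.map_congr (by rintro (_ | x | y) <;> rfl) _

theorem lcompAux_apply (r : ℕ) {I J : Type} [Finite I] [Finite J] (i : I) (p : (lie K).obj I)
    (m : V.obj J) [Fintype (Fin r ≃ {x : I // x ≠ i})] :
    V.lcompAux r i p m = ∑ e : Fin r ≃ {x : I // x ≠ i},
      wordCoeff (ordWord e) ((lieToAssPlus K).app I p).1 • V.map (ordMap e) (V.iterAd r m) := by
  rw [lcompAux, LinearMap.sum_apply, LinearMap.sum_apply]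
  refine Finset.sum_congr ?_ fun e _ => rfl
  ext; simp

theorem lcomp_eq (r : ℕ) {I J : Type} [Finite I] [Finite J] (i : I)
    (h : Nat.card {x : I // x ≠ i} = r) : V.lcomp (J := J) i = V.lcompAux r i := by
  subst h; rfl

theorem lcomp_map' {I I' J J' : Type} [Finite I] [Finite I'] [Finite J] [Finite J'] (σ : I ≃ I')
    (τ : J ≃ J') {i : I} {i' : I'} (h : σ i = i') (p : (lie K).obj I) (m : V.obj J) :
    V.lcomp i' ((lie K).map σ p) (V.map τ m) = V.map (graftMap σ τ h) (V.lcomp i p m) := by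
  classical
  let y : {x : I // x ≠ i} ≃ {x : I' // x ≠ i'} := σ.subtypeEquiv fun x => by
    rw [← h]; simp
  rw [V.lcomp_eq _ i rfl, V.lcomp_eq (Nat.card {x : I // x ≠ i}) i' (Nat.card_congr y).symm]
  let _ := Fintype.ofFinite (Fin (Nat.card {x : I // x ≠ i}) ≃ {x : I // x ≠ i})
  let _ := Fintype.ofFinite (Fin (Nat.card {x : I // x ≠ i}) ≃ {x : I' // x ≠ i'})
  rw [lcompAux_apply, lcompAux_apply, map_sum]
  refine (Fintype.sum_equiv (Equiv.equivCongr (Equiv.refl _) y) _ _ fun e => ?_).symm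
  have hw : ordWord (Equiv.equivCongr (Equiv.refl _) y e) = (ordWord e).map σ := by
    simp only [ordWord, List.map_append, List.map_ofFn, List.map_cons, List.map_nil, h]
    rfl
  rw [hw, (lieToAssPlus K).app_map, map_smul, iterAd_map]
  congr 1
  · exact (wordCoeff_rename σ.injective _ _).symm
  · simp only [SModule.map_map]
    exact V.map_congr (by rintro (x | y) <;> rfl) _

theorem lcomp_mapl {I I' J : Type} [Finite I] [Finite I'] [Finite J] (σ : I ≃ I')
    {i : I} {i' : I'} (h : σ i = i') (p : (lie K).obj I) (m : V.obj J) :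
    V.lcomp i' ((lie K).map σ p) m = V.map (graftMap σ (Equiv.refl J) h) (V.lcomp i p m) := by
  rw [← V.lcomp_map' σ (Equiv.refl J) h, V.map_refl]

theorem lcomp_mapr {I J J' : Type} [Finite I] [Finite J] [Finite J']
    (τ : J ≃ J') (i : I) (p : (lie K).obj I) (m : V.obj J) :
    V.lcomp i p (V.map τ m) = V.map (graftMap (Equiv.refl I) τ (Equiv.refl_apply i)) (V.lcomp i p m) := by
  rw [← V.lcomp_map' (Equiv.refl I) τ (Equiv.refl_apply i), (lie K).map_refl]

theorem one_lcomp {J : Type} [Finite J] (m : V.obj J) :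
    V.lcomp () (lie K).one m = V.map (graftUnitLeft J) m := by
  classical
  have hE : IsEmpty {x : Unit // x ≠ ()} := ⟨fun x => x.2 rfl⟩
  rw [V.lcomp_eq 0 () (Nat.card_eq_zero.2 (Or.inl hE))]
  let _ := Fintype.ofFinite (Fin 0 ≃ {x : Unit // x ≠ ()})
  rw [lcompAux_apply, Fintype.sum_eq_single (Equiv.equivOfIsEmpty _ _)
    (fun e he => (he (Subsingleton.elim _ _)).elim)]
  have : ((lieToAssPlus K).app Unit (lie K).one).1 = assWord K [()] := by
    rw [(lieToAssPlus K).app_one]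
    change FreeAlgebra.ι K () = _
    simp [assWord]
  rw [this, wordCoeff_word]
  simp only [ordWord, List.ofFn_zero, List.nil_append, if_true, one_smul, iterAd,
    SModule.map_map]
  exact V.map_congr (by intro x; rfl) _

/-- `A ⊔ J`, as a graft at a new input. -/
def noneEquiv (A J : Type) : Graft (none : Option J) A ≃ A ⊕ J where
  toFun
    | .inl ⟨none, h⟩ => (h rfl).elim
    | .inl ⟨some j, _⟩ => .inr j
    | .inr a => .inl a
  invFun
    | .inl a => .inr a
    | .inr j => .inl ⟨some j, by simp⟩
  left_inv := by
    rintro (⟨_ | x, h⟩ | a)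
    · exact (h rfl).elim
    · rfl
    · rfl
  right_inv := by rintro (a | j) <;> rfl

/-- The action `[q, m]` of the Lie algebra `Lie` on `M`. -/
def act {A J : Type} [Finite A] [Finite J] :
    (lie K).obj A →ₗ[K] V.obj J →ₗ[K] V.obj (A ⊕ J) :=
  LinearMap.mk₂ K (fun q m => V.map (noneEquiv A J) (V.rcomp none (V.ad m) q))
    (by simp) (by simp) (by simp) (by simp)

theorem act_apply {A J : Type} [Finite A] [Finite J] (q : (lie K).obj A) (m : V.obj J) :
    V.act q m = V.map (noneEquiv A J) (V.rcomp none (V.ad m) q) := rfl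

theorem act_map {A A' J J' : Type} [Finite A] [Finite A'] [Finite J] [Finite J'] (σ : A ≃ A')
    (τ : J ≃ J') (q : (lie K).obj A) (m : V.obj J) :
    V.act ((lie K).map σ q) (V.map τ m) = V.map (Equiv.sumCongr σ τ) (V.act q m) := by
  rw [act_apply, V.ad_map, V.rcomp_map' (Equiv.optionCongr τ) σ (i := none) (i' := none) rfl, act_apply,
    SModule.map_map, SModule.map_map]
  refine V.map_congr ?_ _
  rintro (⟨_ | x, h⟩ | a)
  · exact (h rfl).elim
  · rfl
  · rfl

theorem act_mapr {A J J' : Type} [Finite A] [Finite J] [Finite J']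
    (τ : J ≃ J') (q : (lie K).obj A) (m : V.obj J) :
    V.act q (V.map τ m) = V.map (Equiv.sumCongr (Equiv.refl A) τ) (V.act q m) := by
  rw [← V.act_map (Equiv.refl A) τ, (lie K).map_refl]

theorem act_mapl {A A' J : Type} [Finite A] [Finite A'] [Finite J] (σ : A ≃ A')
    (q : (lie K).obj A) (m : V.obj J) :
    V.act ((lie K).map σ q) m = V.map (Equiv.sumCongr σ (Equiv.refl J)) (V.act q m) := by
  rw [← V.act_map σ (Equiv.refl J), V.map_refl]

/-- `J ⊔ {∗} ≃ {∗} ⊔ J`. -/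
def optUnit (J : Type) : Option J ≃ Unit ⊕ J where
  toFun
    | none => .inl ()
    | some j => .inr j
  invFun
    | .inl _ => none
    | .inr j => some j
  left_inv := by rintro (_ | j) <;> rfl
  right_inv := by rintro (_ | j) <;> rfl

theorem act_one {J : Type} [Finite J] (m : V.obj J) :
    V.act (lie K).one m = V.map (optUnit J) (V.ad m) := by
  rw [act_apply, V.rcomp_one, SModule.map_map]
  refine V.map_congr ?_ _
  rintro (_ | j) <;> simp [graftUnitRight, noneEquiv, optUnit]

/-- `A ⊔ (B ⊔ J) ≃ B ⊔ (A ⊔ J)`. -/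
def swapLeft (A B J : Type) : B ⊕ (A ⊕ J) ≃ (A ⊕ B) ⊕ J where
  toFun
    | .inl b => .inl (.inr b)
    | .inr (.inl a) => .inl (.inl a)
    | .inr (.inr j) => .inr j
  invFun
    | .inl (.inr b) => .inl b
    | .inl (.inl a) => .inr (.inl a)
    | .inr j => .inr (.inr j)
  left_inv := by rintro (b | a | j) <;> rfl
  right_inv := by rintro ((a | b) | j) <;> rfl

theorem rcomp_act {A J L : Type} [Finite A] [Finite J] [Finite L] (j : J) (q : (lie K).obj A)
    (m : V.obj J) (p : (lie K).obj L) :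
    V.rcomp (Sum.inr j : A ⊕ J) (V.act q m) p =
      V.map (brEquivR A j L) (V.act q (V.rcomp j m p)) := by
  have hne : (none : Option J) ≠ some j := by simp
  have h1 : noneEquiv A J (.inl ⟨some j, hne.symm⟩) = .inr j := rfl
  have h2 : optGraft j L none = .inl ⟨none, hne⟩ := rfl
  rw [act_apply, V.rcomp_mapl (noneEquiv A J) h1, V.rcomp_par none (some j) hne, V.rcomp_ad,
    V.rcomp_mapl (optGraft j L) h2, act_apply]
  simp only [SModule.map_map]
  refine V.map_congr ?_ _
  rintro (⟨_ | x | y, h⟩ | a)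
  · exact (h rfl).elim
  all_goals rfl

theorem rcomp_act_left {A J L : Type} [Finite A] [Finite J] [Finite L] (i : A) (q : (lie K).obj A)
    (m : V.obj J) (p : (lie K).obj L) :
    V.rcomp (Sum.inl i : A ⊕ J) (V.act q m) p =
      V.map (brEquivL J i L) (V.act ((lie K).comp i q p) m) := by
  have h1 : noneEquiv A J (.inr i) = .inl i := rfl
  rw [act_apply, V.rcomp_mapl (noneEquiv A J) h1, V.rcomp_rcomp, act_apply]
  simp only [SModule.map_map]
  refine V.map_congr ?_ _
  rintro (⟨_ | x, h⟩ | a | y)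
  · exact (h rfl).elim
  all_goals rfl

theorem rcomp_comp {I J L : Type} [Finite I] [Finite J] [Finite L] (i : I) (j : J) (m : V.obj I)
    (p : (lie K).obj J) (q : (lie K).obj L) :
    V.rcomp i m ((lie K).comp j p q) =
      V.map (graftSeq i j L).symm (V.rcomp (Sum.inr j : Graft i J) (V.rcomp i m p) q) := by
  rw [V.rcomp_rcomp, SModule.map_map, V.map_eq_id (by simp)]

theorem act_br {A B J : Type} [Finite A] [Finite B] [Finite J] (a : (lie K).obj A)
    (b : (lie K).obj B) (m : V.obj J) :
    V.act (br a b) m = V.map (Equiv.sumAssoc A B J).symm (V.act a (V.act b m)) -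
      V.map (swapLeft A B J) (V.act b (V.act a m)) := by
  have hft : false ≠ true := by simp
  have hne : (none : Option (Option J)) ≠ some none := by simp
  have h0 : (graftSeq (none : Option J) true B).symm (.inl ⟨.inr false, by simp⟩) =
      .inr (.inl ⟨false, hft⟩) := rfl
  have h1 : twoEquiv J false (some none) = .inr true := rfl
  have h2 : graftMap (twoEquiv J false) (Equiv.refl B) h1 (.inl ⟨none, hne⟩) =
      .inl ⟨.inr false, by simp⟩ := rfl
  have h8 : optGraft (none : Option J) B none = .inl ⟨none, hne⟩ := rfl
  have h3 : Equiv.optionCongr (noneEquiv B J) none = none := rfl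
  have h4 : Equiv.optionCongr (noneEquiv A J) none = none := rfl
  have h5 : twoEquiv J true none = .inr true := rfl
  have h6 : graftMap (twoEquiv J true) (Equiv.refl B) h5 (.inl ⟨some none, hne.symm⟩) =
      .inl ⟨.inr false, by simp⟩ := rfl
  have h7 : optGraft (none : Option J) A none = .inl ⟨none, hne⟩ := rfl
  rw [act_apply, br_eq_comp, V.rcomp_mapr, V.rcomp_comp, V.rcomp_comp, V.ad_bracket,
    V.rcomp_mapl _ h0]
  simp only [map_sub, LinearMap.sub_apply]
  congr 1
  · rw [V.rcomp_mapl _ h1, V.rcomp_ad, V.rcomp_mapl _ h2, V.rcomp_mapl _ h8,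
      act_apply, act_apply, V.ad_map, V.rcomp_mapl _ h3]
    simp only [SModule.map_map]
    refine V.map_congr ?_ _
    rintro (⟨_ | ⟨_ | x, h'⟩ | y, h⟩ | z)
    · exact (h rfl).elim
    · exact (h' rfl).elim
    all_goals rfl
  · rw [V.rcomp_mapl _ h5, V.rcomp_mapl _ h6,
      V.rcomp_par none (some none) hne, V.rcomp_ad, V.rcomp_mapl _ h7,
      act_apply, act_apply, V.ad_map, V.rcomp_mapl _ h4]
    simp only [SModule.map_map]
    refine V.map_congr ?_ _
    rintro (⟨_ | ⟨_ | x, h'⟩ | y, h⟩ | z)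
    · exact (h rfl).elim
    · exact (h' rfl).elim
    all_goals rfl

theorem br_br {A B C : Type} [Finite A] [Finite B] [Finite C] (a : (lie K).obj A)
    (b : (lie K).obj B) (c : (lie K).obj C) :
    br (br a b) c = (lie K).map (Equiv.sumAssoc A B C).symm (br a (br b c)) -
      (lie K).map (swapLeft A B C) (br b (br a c)) := by
  refine Subtype.ext ?_
  change _ = ((lie K).map (Equiv.sumAssoc A B C).symm (br a (br b c))).1 -
      ((lie K).map (swapLeft A B C) (br b (br a c))).1
  simp only [lie_map_coe, br_coe, LieHom.map_lie, lieRename_rename]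
  rw [lie_lie]
  rfl

/-- Adding a letter in front of an ordering. -/
def consOrd {r : ℕ} {B : Type} {i : B} (e : Fin r ≃ {x : B // x ≠ i}) :
    Fin (r + 1) ≃ {x : Unit ⊕ B // x ≠ Sum.inr i} :=
  (finSuccEquiv r).trans ((Equiv.optionCongr e).trans
    { toFun := fun
        | none => ⟨.inl (), by simp⟩
        | some x => ⟨.inr x.1, by simpa using x.2⟩
      invFun := fun
        | ⟨.inl _, _⟩ => none
        | ⟨.inr x, h⟩ => some ⟨x, by simpa using h⟩
      left_inv := by rintro (_ | x) <;> rfl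
      right_inv := by rintro ⟨_ | x, h⟩ <;> rfl })

theorem consOrd_zero {r : ℕ} {B : Type} {i : B} (e : Fin r ≃ {x : B // x ≠ i}) :
    (consOrd e 0).1 = Sum.inl () := by simp [consOrd]

theorem consOrd_succ {r : ℕ} {B : Type} {i : B} (e : Fin r ≃ {x : B // x ≠ i}) (k : Fin r) :
    (consOrd e k.succ).1 = Sum.inr (e k).1 := by simp [consOrd]

theorem consOrd_injective {r : ℕ} {B : Type} {i : B} :
    Function.Injective (consOrd (r := r) (i := i)) := by
  intro e e' h
  ext k
  have h1 := consOrd_succ e k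
  rw [h, consOrd_succ] at h1
  exact (Sum.inr_injective h1).symm

theorem exists_consOrd {r : ℕ} {B : Type} {i : B}
    (e : Fin (r + 1) ≃ {x : Unit ⊕ B // x ≠ Sum.inr i}) (h : (e 0).1 = Sum.inl ()) :
    ∃ e', consOrd e' = e := by
  have hs : ∀ k : Fin r, ∃ b : {x : B // x ≠ i}, (e k.succ).1 = Sum.inr b.1 := by
    intro k
    rcases hk : (e k.succ).1 with u | b
    · have : e k.succ = e 0 := Subtype.ext (by rw [hk, h])
      exact absurd (e.injective this) (Fin.succ_ne_zero k)
    · exact ⟨⟨b, fun hb => (e k.succ).2 (by rw [hk, hb])⟩, rfl⟩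
  choose g hg using hs
  have hbij : Function.Bijective g := by
    constructor
    · intro k l hkl
      have : e k.succ = e l.succ := Subtype.ext (by rw [hg, hg, hkl])
      exact Fin.succ_injective _ (e.injective this)
    · intro b
      obtain ⟨k, hk⟩ := e.surjective ⟨.inr b.1, by simpa using b.2⟩
      induction k using Fin.cases with
      | zero => rw [hk] at h; simp at h
      | succ k =>
        refine ⟨k, Subtype.ext ?_⟩
        have := hg k
        rw [hk] at this
        exact (Sum.inr_injective this).symm
  refine ⟨Equiv.ofBijective g hbij, ?_⟩
  ext k : 2
  induction k using Fin.cases with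
  | zero => rw [consOrd_zero, h]
  | succ k => rw [consOrd_succ, hg]; rfl

theorem lcomp_br_one {B J : Type} [Finite B] [Finite J] (i : B) (p : (lie K).obj B)
    (m : V.obj J) :
    V.lcomp (Sum.inr i : Unit ⊕ B) (br (lie K).one p) m =
      V.map (brEquivR Unit i J) (V.act (lie K).one (V.lcomp i p m)) := by
  classical
  set r := Nat.card {x : B // x ≠ i} with hr
  have hc : Nat.card {x : Unit ⊕ B // x ≠ Sum.inr i} = r + 1 := by
    have e : Fin r ≃ {x : B // x ≠ i} := (Finite.equivFin _).symm
    rw [← Nat.card_congr (consOrd e), Nat.card_fin]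
  rw [V.lcomp_eq (r + 1) _ hc, V.lcomp_eq r i rfl]
  let _ := Fintype.ofFinite (Fin r ≃ {x : B // x ≠ i})
  let _ := Fintype.ofFinite (Fin (r + 1) ≃ {x : Unit ⊕ B // x ≠ Sum.inr i})
  rw [lcompAux_apply, lcompAux_apply, map_sum, map_sum]
  set P := ((lieToAssPlus K).app B p).1 with hP
  have hbr : ((lieToAssPlus K).app (Unit ⊕ B) (br (lie K).one p)).1 =
      FreeAlgebra.ι K (Sum.inl ()) * assRename K Sum.inr P -
        assRename K Sum.inr P * FreeAlgebra.ι K (Sum.inl ()) := by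
    change lieToFree K (Unit ⊕ B) ⁅lieRename K (Sum.inl : Unit → Unit ⊕ B)
      (FreeLieAlgebra.of K ()), lieRename K (Sum.inr : B → Unit ⊕ B) p.1⁆ = _
    rw [lieToFree_lie, lieToFree_rename, lieToFree_rename, lieToFree_of]
    simp only [assRename, FreeAlgebra.lift_ι_apply]
    rfl
  symm
  refine Finset.sum_of_injOn consOrd consOrd_injective.injOn (by simp) ?_ ?_
  · intro e _ he
    have h0 : Sum.inl () ≠ (e 0).1 := by
      intro h
      obtain ⟨e', rfl⟩ := exists_consOrd e h.symm
      exact he ⟨e', by simp, rfl⟩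
    rw [hbr, map_sub, ordWord, List.ofFn_succ, wordCoeff_mul_ι (by simp), List.cons_append,
      wordCoeff_ι_mul, if_neg h0, sub_zero, zero_smul]
  · intro e _
    have hw : ordWord (consOrd e) = Sum.inl () :: (ordWord e).map Sum.inr := by
      rw [ordWord, List.ofFn_succ, consOrd_zero, List.cons_append, ordWord, List.map_append,
        List.map_ofFn]
      congr 2
    have hz : wordCoeff (ordWord (consOrd e))
        (assRename K Sum.inr P * FreeAlgebra.ι K (Sum.inl () : Unit ⊕ B)) = 0 := by
      rw [ordWord]
      exact wordCoeff_mul_ι (by simp) _ _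
    rw [hbr, map_sub, hz, hw, wordCoeff_ι_mul, if_pos rfl, sub_zero,
      wordCoeff_rename Sum.inr_injective, map_smul, map_smul, act_one, V.ad_map]
    congr 1
    simp only [iterAd, LinearMap.comp_apply, SModule.map_map]
    refine V.map_congr ?_ _
    rintro (_ | k | j)
    · exact congrArg Sum.inl (Subtype.ext (consOrd_zero e).symm)
    · exact congrArg Sum.inl (Subtype.ext (consOrd_succ e k).symm)
    · rfl

theorem lcomp_br {A B J : Type} [Finite A] [Finite B] [Finite J] (i : B) (q : (lie K).obj A)
    (p : (lie K).obj B) (m : V.obj J) :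
    V.lcomp (Sum.inr i : A ⊕ B) (br q p) m =
      V.map (brEquivR A i J) (V.act q (V.lcomp i p m)) := by
  revert B
  refine lie_induction (C := fun A _ q => ∀ {B : Type} [Finite B] (i : B) (p : (lie K).obj B),
    V.lcomp (Sum.inr i : A ⊕ B) (br q p) m =
      V.map (brEquivR A i J) (V.act q (V.lcomp i p m))) ?_ ?_ ?_ ?_ ?_ ?_ q
  · intro A _ B _ i p; simp
  · intro A _ a b ha hb B _ i p; simp [ha, hb]
  · intro A _ c a ha B _ i p; simp [ha]
  · intro A A' _ _ σ a ha B _ i p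
    have e : br ((lie K).map σ a) p =
        (lie K).map (Equiv.sumCongr σ (Equiv.refl B)) (br a p) := by
      refine Subtype.ext ?_
      simp only [lie_map_coe, br_coe, LieHom.map_lie, lieRename_rename]
      rfl
    have h1 : Equiv.sumCongr σ (Equiv.refl B) (.inr i) = .inr i := rfl
    rw [e, V.lcomp_mapl _ h1, ha, act_mapl]
    simp only [SModule.map_map]
    refine V.map_congr ?_ _
    rintro (x | x | x) <;> rfl
  · intro B _ i p; exact V.lcomp_br_one i p m
  · intro A A' _ _ a a' ha ha' B _ i p
    have h1 : (Equiv.sumAssoc A A' B).symm (.inr (.inr i)) = .inr i := rfl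
    have h2 : swapLeft A A' B (.inr (.inr i)) = .inr i := rfl
    rw [br_br, map_sub, LinearMap.sub_apply, V.lcomp_mapl _ h1, V.lcomp_mapl _ h2, ha, ha', ha',
      ha, act_mapr, act_mapr, act_br]
    simp only [SModule.map_map, map_sub]
    congr 1
    · refine V.map_congr ?_ _
      rintro (x | x | x | x) <;> rfl
    · refine V.map_congr ?_ _
      rintro (x | x | x | x) <;> rfl

end LieModule
end PBWOperad

namespace PBWOperad

namespace LieModule

variable {K : Type u} [Field K] (V : LieModule K)

theorem lie_comp_mapl {I I' J : Type} [Finite I] [Finite I'] [Finite J] (σ : I ≃ I')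
    (i : I) (p : (lie K).obj I) (q : (lie K).obj J) :
    (lie K).comp (σ i) ((lie K).map σ p) q =
      (lie K).map (graftCongr σ (Equiv.refl J) i) ((lie K).comp i p q) := by
  rw [← (lie K).comp_map, (lie K).map_refl]

theorem lcomp_lcomp {I J L : Type} [Finite I] [Finite J] [Finite L] (i : I) (j : J)
    (p : (lie K).obj I) (q : (lie K).obj J) (m : V.obj L) :
    V.lcomp (Sum.inr j : Graft i J) ((lie K).comp i p q) m =
      V.map (graftSeq i j L) (V.lcomp i p (V.lcomp j q m)) := by
  refine lie_induction_marked (C := fun I _ i p =>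
    V.lcomp (Sum.inr j : Graft i J) ((lie K).comp i p q) m =
      V.map (graftSeq i j L) (V.lcomp i p (V.lcomp j q m))) ?_ ?_ ?_ ?_ ?_ ?_ i p
  · intro I _ i; simp
  · intro I _ i a b ha hb; simp [ha, hb]
  · intro I _ i c a ha; simp [ha]
  · intro I I' _ _ σ i a ha
    have h1 : graftCongr σ (Equiv.refl J) i (.inr j) = .inr j := rfl
    rw [lie_comp_mapl, V.lcomp_mapl _ h1, ha, V.lcomp_mapl σ rfl]
    simp only [SModule.map_map]
    refine V.map_congr ?_ _
    rintro (x | x | x) <;> rfl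
  · have h1 : graftUnitLeft J j = .inr j := rfl
    rw [(lie K).one_comp, V.lcomp_mapl _ h1, V.one_lcomp]
    simp only [SModule.map_map]
    refine V.map_congr ?_ _
    rintro (x | x) <;> rfl
  · intro A B _ _ i a b hb
    have h1 : brEquivR A i J (.inr (.inr j)) = .inr j := rfl
    rw [comp_br_inr, V.lcomp_mapl _ h1, V.lcomp_br, hb, V.lcomp_br, V.act_mapr]
    simp only [SModule.map_map]
    refine V.map_congr ?_ _
    rintro (x | x | x | x) <;> rfl

theorem lcomp_rcomp {I J L : Type} [Finite I] [Finite J] [Finite L] (i : I) (j : J)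
    (p : (lie K).obj I) (m : V.obj J) (q : (lie K).obj L) :
    V.rcomp (Sum.inr j : Graft i J) (V.lcomp i p m) q =
      V.map (graftSeq i j L) (V.lcomp i p (V.rcomp j m q)) := by
  refine lie_induction_marked (C := fun I _ i p =>
    V.rcomp (Sum.inr j : Graft i J) (V.lcomp i p m) q =
      V.map (graftSeq i j L) (V.lcomp i p (V.rcomp j m q))) ?_ ?_ ?_ ?_ ?_ ?_ i p
  · intro I _ i; simp
  · intro I _ i a b ha hb; simp [ha, hb]
  · intro I _ i c a ha; simp [ha]
  · intro I I' _ _ σ i a ha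
    have h1 : graftMap σ (Equiv.refl J) (rfl : σ i = σ i) (.inr j) = .inr j := rfl
    rw [V.lcomp_mapl σ rfl, V.rcomp_mapl _ h1, ha, V.lcomp_mapl σ rfl]
    simp only [SModule.map_map]
    refine V.map_congr ?_ _
    rintro (x | x | x) <;> rfl
  · have h1 : graftUnitLeft J j = .inr j := rfl
    rw [V.one_lcomp, V.one_lcomp, V.rcomp_mapl _ h1]
    simp only [SModule.map_map]
    refine V.map_congr ?_ _
    rintro (x | x) <;> rfl
  · intro A B _ _ i a b hb
    have h1 : brEquivR A i J (.inr (.inr j)) = .inr j := rfl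
    rw [V.lcomp_br, V.lcomp_br, V.rcomp_mapl _ h1, V.rcomp_act, hb, V.act_mapr]
    simp only [SModule.map_map]
    refine V.map_congr ?_ _
    rintro (x | x | x | x) <;> rfl

theorem lcomp_par {I J L : Type} [Finite I] [Finite J] [Finite L] (i k : I) (h : i ≠ k)
    (p : (lie K).obj I) (q : (lie K).obj J) (m : V.obj L) :
    V.lcomp (Sum.inl ⟨k, h.symm⟩ : Graft i J) ((lie K).comp i p q) m =
      V.map (graftPar i k h J L)
        (V.rcomp (Sum.inl ⟨i, h⟩ : Graft k L) (V.lcomp k p m) q) := by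
  revert i
  refine lie_induction_marked (C := fun I _ k p => ∀ (i : I) (h : i ≠ k),
    V.lcomp (Sum.inl ⟨k, h.symm⟩ : Graft i J) ((lie K).comp i p q) m =
      V.map (graftPar i k h J L)
        (V.rcomp (Sum.inl ⟨i, h⟩ : Graft k L) (V.lcomp k p m) q)) ?_ ?_ ?_ ?_ ?_ ?_ k p
  · intro I _ k i h; simp
  · intro I _ k a b ha hb i h; simpa using congrArg₂ (· + ·) (ha i h) (hb i h)
  · intro I _ k c a ha i h; simpa using congrArg (c • ·) (ha i h)
  · intro I I' _ _ σ k a ha i' h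
    obtain ⟨i, rfl⟩ := σ.surjective i'
    have h' : i ≠ k := fun e => h (e ▸ rfl)
    have h1 : graftCongr σ (Equiv.refl J) i (.inl ⟨k, h'.symm⟩) = .inl ⟨σ k, h.symm⟩ := rfl
    have h2 : graftMap σ (Equiv.refl L) (rfl : σ k = σ k) (.inl ⟨i, h'⟩) = .inl ⟨σ i, h⟩ := rfl
    rw [lie_comp_mapl, V.lcomp_mapl _ h1, ha i h', V.lcomp_mapl σ rfl, V.rcomp_mapl _ h2]
    simp only [SModule.map_map]
    refine V.map_congr ?_ _
    rintro (⟨x | x, hx⟩ | x) <;> rfl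
  · intro i h; exact (h rfl).elim
  · rintro A B _ _ k a b hb (i | i) h
    · have h1 : brEquivL B i J (.inr k) = .inl ⟨.inr k, h.symm⟩ := rfl
      have h2 : brEquivR A k L (.inl i) = .inl ⟨.inl i, h⟩ := rfl
      rw [comp_br_inl, V.lcomp_mapl _ h1, V.lcomp_br, V.lcomp_br, V.rcomp_mapl _ h2,
        V.rcomp_act_left]
      simp only [SModule.map_map]
      refine V.map_congr ?_ _
      rintro ((x | x) | (x | x)) <;> rfl
    · have h' : i ≠ k := fun e => h (e ▸ rfl)
      have h1 : brEquivR A i J (.inr (.inl ⟨k, h'.symm⟩)) = .inl ⟨.inr k, h.symm⟩ := rfl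
      have h2 : brEquivR A k L (.inr (.inl ⟨i, h'⟩)) = .inl ⟨.inr i, h⟩ := rfl
      rw [comp_br_inr, V.lcomp_mapl _ h1, V.lcomp_br, hb i h', V.lcomp_br, V.rcomp_mapl _ h2,
        V.rcomp_act, V.act_mapr]
      simp only [SModule.map_map]
      refine V.map_congr ?_ _
      rintro (x | ⟨x | x, hx⟩ | x) <;> rfl

/-- A module over the Lie algebra `Lie` in right `Lie`-modules is an infinitesimal
`Lie`-bimodule. -/
def toInfBimodule : InfBimodule (lie K) where
  toSModule := V.toSModule
  lcomp := V.lcomp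
  rcomp := V.rcomp
  lcomp_map σ τ i p m := by
    rw [V.lcomp_map' σ τ rfl]
    exact V.map_congr (by rintro (x | x) <;> rfl) _
  rcomp_map := V.rcomp_map
  one_lcomp := V.one_lcomp
  rcomp_one := V.rcomp_one
  lcomp_lcomp := V.lcomp_lcomp
  lcomp_rcomp := V.lcomp_rcomp
  rcomp_rcomp := V.rcomp_rcomp
  lcomp_par := V.lcomp_par
  rcomp_par := V.rcomp_par

end LieModule
end PBWOperad

namespace PBWOperad

namespace InfBimodule

variable {K : Type u} [Field K] (M : InfBimodule (lie K))

theorem rcomp_mapl {I I' J : Type} [Finite I] [Finite I'] [Finite J] (σ : I ≃ I')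
    {i : I} {i' : I'} (h : σ i = i') (m : M.obj I) (p : (lie K).obj J) :
    M.rcomp i' (M.map σ m) p = M.map (graftMap σ (Equiv.refl J) h) (M.rcomp i m p) := by
  subst h
  have := M.rcomp_map σ (Equiv.refl J) i m p
  rw [(lie K).map_refl] at this
  rw [this]
  exact M.map_congr (by rintro (x | y) <;> rfl) _

theorem lcomp_mapl {I I' J : Type} [Finite I] [Finite I'] [Finite J] (σ : I ≃ I')
    {i : I} {i' : I'} (h : σ i = i') (p : (lie K).obj I) (m : M.obj J) :
    M.lcomp i' ((lie K).map σ p) m = M.map (graftMap σ (Equiv.refl J) h) (M.lcomp i p m) := by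
  subst h
  have := M.lcomp_map σ (Equiv.refl J) i p m
  rw [M.map_refl] at this
  rw [this]
  exact M.map_congr (by rintro (x | y) <;> rfl) _

theorem lcomp_mapr {I J J' : Type} [Finite I] [Finite J] [Finite J'] (τ : J ≃ J') (i : I)
    (p : (lie K).obj I) (m : M.obj J) :
    M.lcomp i p (M.map τ m) =
      M.map (graftMap (Equiv.refl I) τ (Equiv.refl_apply i)) (M.lcomp i p m) := by
  have := M.lcomp_map (Equiv.refl I) τ i p m
  rw [(lie K).map_refl] at this
  refine Eq.trans this ?_
  exact M.map_congr (by rintro (x | y) <;> rfl) _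

/-- `{false} ⊔ J ≃ J ⊔ {∗}`. -/
def boolNone (J : Type) : Graft true J ≃ Option J where
  toFun
    | .inl _ => none
    | .inr j => some j
  invFun
    | none => .inl ⟨false, by simp⟩
    | some j => .inr j
  left_inv := by
    rintro (⟨_ | _, h⟩ | j)
    · rfl
    · exact (h rfl).elim
    · rfl
  right_inv := by rintro (_ | j) <;> rfl

/-- The bijections between the inputs of `[x, [y, z]]` and `[[x', y'], z']` with `z ↦ z'` and
`x ↦ x'` (for `b = false`) or `x ↦ y'` (for `b = true`). -/
def jacobiEquiv (b : Bool) : Graft true Bool ≃ Graft false Bool where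
  toFun
    | .inl _ => .inr b
    | .inr false => .inr !b
    | .inr true => .inl ⟨true, by simp⟩
  invFun
    | .inl _ => .inr true
    | .inr c => if c = b then .inl ⟨false, by simp⟩ else .inr false
  left_inv := by
    rintro (⟨_ | _, h⟩ | _ | _)
    · simp
    · exact (h rfl).elim
    · simp
    · rfl
  right_inv := by
    rintro (⟨_ | _, h⟩ | c)
    · exact (h rfl).elim
    · rfl
    · cases b <;> cases c <;> rfl

theorem jacobi : (lie K).comp false (bracket K) (bracket K) =
    (lie K).map (jacobiEquiv false) ((lie K).comp true (bracket K) (bracket K)) -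
      (lie K).map (jacobiEquiv true) ((lie K).comp true (bracket K) (bracket K)) := by
  refine Subtype.ext ?_
  change _ = ((lie K).map (jacobiEquiv false) ((lie K).comp true (bracket K) (bracket K))).1 -
    ((lie K).map (jacobiEquiv true) ((lie K).comp true (bracket K) (bracket K))).1
  simp only [lie_map_coe, lie_comp_coe]
  simp only [bracket, lieSubst, lieRename, LieHom.map_lie, FreeLieAlgebra.lift_of_apply, plug_self,
    plug_of_ne (show false ≠ true by simp), plug_of_ne (show true ≠ false by simp)]
  rw [lie_lie]
  rfl

/-- An infinitesimal `Lie`-bimodule is a module over the Lie algebra `Lie` in right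
`Lie`-modules. -/
abbrev toLieModule : LieModule K where
  toSModule := M.toSModule
  rcomp := M.rcomp
  ad := (M.map (boolNone _)).comp (M.lcomp true (bracket K))
  rcomp_map := M.rcomp_map
  rcomp_one := M.rcomp_one
  rcomp_rcomp := M.rcomp_rcomp
  rcomp_par := M.rcomp_par
  ad_map τ m := by
    simp only [LinearMap.comp_apply, M.lcomp_mapr, SModule.map_map]
    refine M.map_congr ?_ _
    rintro (x | x) <;> rfl
  rcomp_ad {J L} _ _ j m q := by
    have h1 : boolNone J (.inr j) = some j := rfl
    rw [LinearMap.comp_apply, LinearMap.comp_apply, M.rcomp_mapl _ h1, M.lcomp_rcomp]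
    simp only [SModule.map_map]
    refine M.map_congr ?_ _
    rintro (x | x | x) <;> rfl
  ad_bracket {J} _ m := by
    have hft : false ≠ true := by simp
    have h1 : boolNone J (.inl ⟨false, hft⟩) = none := rfl
    have h2 : jacobiEquiv false (.inr true) = .inl ⟨true, hft.symm⟩ := rfl
    have h3 : jacobiEquiv true (.inr true) = .inl ⟨true, hft.symm⟩ := rfl
    have e := M.lcomp_par false true hft (bracket K) (bracket K) m
    have e' : M.rcomp (Sum.inl ⟨false, hft⟩) (M.lcomp true (bracket K) m) (bracket K) =
        M.map (graftPar false true hft Bool J).symm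
          (M.lcomp (Sum.inl ⟨true, hft.symm⟩) ((lie K).comp false (bracket K) (bracket K)) m) := by
      rw [e, SModule.map_map, M.map_eq_id (by simp)]
    simp only [LinearMap.comp_apply]
    rw [M.rcomp_mapl _ h1, e', jacobi, map_sub, LinearMap.sub_apply, M.lcomp_mapl _ h2,
      M.lcomp_mapl _ h3, M.lcomp_lcomp, M.lcomp_mapr]
    simp only [SModule.map_map, map_sub]
    congr 1
    · refine M.map_congr ?_ _
      rintro (⟨_ | _, h⟩ | ⟨_ | _, h'⟩ | x)
      · rfl
      · rfl
      all_goals first | exact (h rfl).elim | exact (h' rfl).elim | rfl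
    · refine M.map_congr ?_ _
      rintro (⟨_ | _, h⟩ | ⟨_ | _, h'⟩ | x)
      · rfl
      · rfl
      all_goals first | exact (h rfl).elim | exact (h' rfl).elim | rfl

end InfBimodule
end PBWOperad

namespace PBWOperad

variable {K : Type u} [Field K]


/-- An infinitesimal `Lie`-bimodule has the left action that is built from its underlying module
over the Lie algebra `Lie`. -/
theorem InfBimodule.lcomp_toLieModule (M : InfBimodule (lie K)) {I J : Type} [Finite I] [Finite J]
    (i : I) (p : (lie K).obj I) (m : M.obj J) : M.toLieModule.lcomp i p m = M.lcomp i p m := by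
  refine lie_induction_marked (C := fun I _ i p => M.toLieModule.lcomp i p m = M.lcomp i p m)
    ?_ ?_ ?_ ?_ ?_ ?_ i p
  · intro I _ i; simp
  · intro I _ i a b ha hb; simp [ha, hb]
  · intro I _ i c a ha; simp [ha]
  · intro I I' _ _ σ i a ha
    rw [M.toLieModule.lcomp_mapl σ rfl, ha, M.lcomp_mapl σ rfl]
  · rw [M.toLieModule.one_lcomp, M.one_lcomp]
  · intro A B _ _ i a b hb
    have hft : false ≠ true := by simp
    have hn : (Sum.inl ⟨false, hft⟩ : Graft true B) ≠ Sum.inr i := by simp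
    have h1 : brEquiv A B (.inl ⟨.inr i, hn.symm⟩) = .inr i := rfl
    have h2 : graftSeq true i J (.inl ⟨false, hft⟩) = .inl ⟨.inl ⟨false, hft⟩, hn⟩ := rfl
    have h3 : InfBimodule.boolNone (Graft i J) (.inl ⟨false, hft⟩) = none := rfl
    have e : M.toLieModule.act a (M.lcomp i b m) = M.map (LieModule.noneEquiv A (Graft i J))
      (M.rcomp none (M.map (InfBimodule.boolNone _) (M.lcomp true (bracket K) (M.lcomp i b m))) a) := rfl
    have e2 := M.lcomp_par (Sum.inl ⟨false, hft⟩ : Graft true B) (Sum.inr i) hn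
      ((lie K).comp true (bracket K) b) a m
    rw [M.toLieModule.lcomp_br, hb, br_eq_comp, M.lcomp_mapl _ h1,
      e2, M.lcomp_lcomp, M.rcomp_mapl _ h2, e,
      M.rcomp_mapl _ h3]
    refine Eq.trans (M.map_map _ _ _) ?_
    simp only [SModule.map_map]
    refine M.map_congr ?_ _
    rintro (⟨⟨_ | _, h⟩ | x, h'⟩ | x)
    · exact (h' rfl).elim
    · exact (h rfl).elim
    · rcases x with x | x <;> rfl
    · rfl

/-- A module over the Lie algebra `Lie` is recovered from its infinitesimal `Lie`-bimodule. -/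
theorem LieModule.ad_toInfBimodule (V : LieModule K) {J : Type} [Finite J] (m : V.obj J) :
    V.toInfBimodule.toLieModule.ad m = V.ad m := by
  let e : Unit ⊕ Unit ≃ Bool := (Equiv.boolEquivPUnitSumPUnit).symm
  have h1 : bracket K = (lie K).map e (br (lie K).one (lie K).one) := by
    refine Subtype.ext ?_
    rw [lie_map_coe, br_coe, LieHom.map_lie, lieRename_rename, lieRename_rename]
    change _ = ⁅lieRename K _ (FreeLieAlgebra.of K ()), lieRename K _ (FreeLieAlgebra.of K ())⁆
    simp [lieRename, bracket, e]; rfl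
  have h2 : e (.inr ()) = true := rfl
  change V.map (InfBimodule.boolNone J) (V.lcomp true (bracket K) m) = _
  rw [h1, V.lcomp_mapl _ h2, V.lcomp_br_one, V.one_lcomp, V.act_mapr, V.act_one]
  simp only [SModule.map_map]
  refine V.map_eq_id ?_ _
  rintro (_ | x) <;> rfl

end PBWOperad

namespace PBWOperad

/-! ### Symmetric powers -/

section SymPow

open scoped DirectSum TensorProduct

variable {K : Type u} [Field K]

/-- The fibre `f⁻¹(b)`. -/
abbrev Fib {I : Type} {k : ℕ} (f : I → Fin k) (b : Fin k) : Type := {x : I // f x = b}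

/-- The `k`-th tensor power of an S-module for Day convolution:
`M^{⊗k}(I) = ⨁_{I = I_1 ⊔ ⋯ ⊔ I_k} M(I_1) ⊗ ⋯ ⊗ M(I_k)`, a decomposition of `I` into `k` pieces
being given by the function `f : I → Fin k` with fibres the pieces. -/
abbrev TensorPow (M : SModule K) (k : ℕ) (I : Type) [Finite I] : Type u :=
  ⨁ f : I → Fin k, ⨂[K] b, M.obj (Fib f b)

open Classical in
/-- The pure tensor `⨂_b m_b`. -/
def tens (M : SModule K) {k : ℕ} {I : Type} [Finite I] (f : I → Fin k) :
    MultilinearMap K (fun b => M.obj (Fib f b)) (TensorPow M k I) :=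
  (DirectSum.lof K (I → Fin k) (fun f => ⨂[K] b, M.obj (Fib f b)) f).compMultilinearMap
    (PiTensorProduct.tprod K)

/-- The bijection induced on fibres by a permutation of the pieces. -/
def fibPerm {I : Type} {k : ℕ} {f g : I → Fin k} {σ : Equiv.Perm (Fin k)}
    (h : ∀ x, g x = σ (f x)) (b : Fin k) : Fib f b ≃ Fib g (σ b) :=
  Equiv.subtypeEquivRight fun x => by simp [h]

/-- The bijection induced on fibres by a bijection. -/
def fibMap {I J : Type} {k : ℕ} (e : I ≃ J) {f : I → Fin k} {g : J → Fin k}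
    (h : ∀ x, g (e x) = f x) (b : Fin k) : Fib f b ≃ Fib g b :=
  e.subtypeEquiv fun x => by rw [h]

/-- The relations identifying a pure tensor with its images under the permutations `σ` of the
`k` factors. -/
def symRel (M : SModule K) (k : ℕ) (I : Type) [Finite I] : Submodule K (TensorPow M k I) :=
  Submodule.span K {t | ∃ (f g : I → Fin k) (σ : Equiv.Perm (Fin k)) (h : ∀ x, g x = σ (f x))
    (m : ∀ b, M.obj (Fib f b)) (m' : ∀ b, M.obj (Fib g b)),
    (∀ b, m' (σ b) = M.map (fibPerm h b) (m b)) ∧ t = tens M f m - tens M g m'}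

/-- `Sym^k(M)(I)`, the coinvariants of the symmetric group on `M^{⊗k}(I)`. -/
abbrev SymPow (M : SModule K) (k : ℕ) (I : Type) [Finite I] : Type u :=
  TensorPow M k I ⧸ symRel M k I

/-- The product `∏_b m_b` in `Sym^k(M)(I)`. -/
def sprod (M : SModule K) {k : ℕ} {I : Type} [Finite I] (f : I → Fin k) :
    MultilinearMap K (fun b => M.obj (Fib f b)) (SymPow M k I) :=
  (symRel M k I).mkQ.compMultilinearMap (tens M f)

variable {M : SModule K} {k : ℕ}

theorem sprod_eq {I : Type} [Finite I] {f g : I → Fin k} {σ : Equiv.Perm (Fin k)}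
    (h : ∀ x, g x = σ (f x)) {m : ∀ b, M.obj (Fib f b)} {m' : ∀ b, M.obj (Fib g b)}
    (hm : ∀ b, m' (σ b) = M.map (fibPerm h b) (m b)) :
    sprod M f m = sprod M g m' :=
  (Submodule.Quotient.eq _).2 (Submodule.subset_span ⟨f, g, σ, h, m, m', hm, rfl⟩)

theorem symPow_hom_ext {I : Type} [Finite I] {N : Type*} [AddCommGroup N] [Module K N]
    {F G : SymPow M k I →ₗ[K] N} (h : ∀ f m, F (sprod M f m) = G (sprod M f m)) : F = G := by
  classical
  refine Submodule.linearMap_qext _ (DirectSum.linearMap_ext K fun f => ?_)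
  ext m
  exact h f m

/-- The linear map on `Sym^k(M)(I)` given on products by `φ`. -/
def symLift {I : Type} [Finite I] {N : Type u} [AddCommGroup N] [Module K N]
    (φ : ∀ f : I → Fin k, MultilinearMap K (fun b => M.obj (Fib f b)) N)
    (hφ : ∀ (f g : I → Fin k) (σ : Equiv.Perm (Fin k)) (h : ∀ x, g x = σ (f x))
      (m : ∀ b, M.obj (Fib f b)) (m' : ∀ b, M.obj (Fib g b)),
      (∀ b, m' (σ b) = M.map (fibPerm h b) (m b)) → φ f m = φ g m') :
    SymPow M k I →ₗ[K] N := by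
  classical
  refine (symRel M k I).liftQ
    (DirectSum.toModule K _ N fun f => PiTensorProduct.lift (φ f)) ?_
  rw [symRel, Submodule.span_le]
  rintro _ ⟨f, g, σ, h, m, m', hm, rfl⟩
  simp only [tens, SetLike.mem_coe, LinearMap.mem_ker, map_sub,
    LinearMap.compMultilinearMap_apply]
  erw [DirectSum.toModule_lof, DirectSum.toModule_lof]
  rw [PiTensorProduct.lift.tprod, PiTensorProduct.lift.tprod, hφ f g σ h m m' hm, sub_self]

theorem symLift_sprod {I : Type} [Finite I] {N : Type u} [AddCommGroup N] [Module K N]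
    (φ : ∀ f : I → Fin k, MultilinearMap K (fun b => M.obj (Fib f b)) N) (hφ)
    (f : I → Fin k) (m : ∀ b, M.obj (Fib f b)) : symLift φ hφ (sprod M f m) = φ f m := by
  classical
  change (DirectSum.toModule K _ N fun f => PiTensorProduct.lift (φ f)) (tens M f m) = _
  simp only [tens, LinearMap.compMultilinearMap_apply]
  erw [DirectSum.toModule_lof]
  rw [PiTensorProduct.lift.tprod]

theorem sprod_congr {I : Type} [Finite I] {f g : I → Fin k} (h : ∀ x, g x = f x)
    {m : ∀ b, M.obj (Fib f b)} {m' : ∀ b, M.obj (Fib g b)}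
    (hm : ∀ b, m' b = M.map (fibMap (Equiv.refl I) h b) (m b)) :
    sprod M f m = sprod M g m' :=
  sprod_eq (σ := Equiv.refl _) h fun b => (hm b).trans (M.map_congr (by rintro x; rfl) _)

/-- Functoriality of `Sym^k(M)` in bijections. -/
def symMap {I J : Type} [Finite I] [Finite J] (τ : I ≃ J) : SymPow M k I →ₗ[K] SymPow M k J :=
  symLift (fun f => (sprod M (fun y => f (τ.symm y))).compLinearMap fun b =>
      M.map (fibMap τ (fun x => congrArg f (τ.symm_apply_apply x)) b))
    (by
      intro f g σ h m m' hm
      rw [MultilinearMap.compLinearMap_apply, MultilinearMap.compLinearMap_apply]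
      refine sprod_eq (σ := σ) (fun x => h _) fun b => ?_
      rw [hm, SModule.map_map, SModule.map_map]
      exact M.map_congr (by rintro x; rfl) _)

theorem symMap_sprod {I J : Type} [Finite I] [Finite J] (τ : I ≃ J) {f : I → Fin k}
    {g : J → Fin k} (h : ∀ x, g (τ x) = f x)
    {m : ∀ b, M.obj (Fib f b)} {m' : ∀ b, M.obj (Fib g b)}
    (hm : ∀ b, m' b = M.map (fibMap τ h b) (m b)) :
    symMap τ (sprod M f m) = sprod M g m' := by
  rw [symMap, symLift_sprod, MultilinearMap.compLinearMap_apply]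
  refine sprod_congr (fun x => by simpa using h (τ.symm x)) fun b => ?_
  rw [hm, SModule.map_map]
  exact M.map_congr (by rintro x; rfl) _

theorem exists_symMap_sprod {I J : Type} [Finite I] [Finite J] (τ : I ≃ J) (f : I → Fin k)
    (m : ∀ b, M.obj (Fib f b)) : symMap τ (sprod M f m) = sprod M (fun y => f (τ.symm y))
      (fun b => M.map (fibMap τ (fun x => congrArg f (τ.symm_apply_apply x)) b) (m b)) :=
  symMap_sprod τ (fun x => congrArg f (τ.symm_apply_apply x)) fun _ => rfl

variable (M k)

/-- The `k`-th symmetric power of an S-module. -/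
def symPowSModule : SModule K where
  obj I _ := SymPow M k I
  map τ := symMap τ
  map_refl {I} _ a := by
    refine LinearMap.congr_fun (g := LinearMap.id) (symPow_hom_ext fun f m => ?_) a
    refine symMap_sprod _ (fun x => rfl) fun b => ?_
    exact (M.map_eq_id (by rintro x; rfl) (m b)).symm
  map_trans σ τ a := by
    refine LinearMap.congr_fun (g := (symMap τ).comp (symMap σ)) (symPow_hom_ext fun f m => ?_) a
    rw [LinearMap.comp_apply, exists_symMap_sprod (σ.trans τ), exists_symMap_sprod σ,
      exists_symMap_sprod τ]
    refine sprod_congr (fun x => rfl) fun b => ?_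
    rw [SModule.map_map, SModule.map_map]
    exact M.map_congr (by rintro x; rfl) _

end SymPow

section SymPowLie

variable {K : Type u} [Field K] {V : LieModule K} {k : ℕ}

/-- The decomposition of `(I ∖ {i}) ⊔ L` induced by a decomposition of `I`, with `L` put in the
piece of `i`. -/
def graftFun {I : Type} (f : I → Fin k) (i : I) (L : Type) : Graft i L → Fin k
  | .inl x => f x
  | .inr _ => f i

/-- The piece of `i`. -/
def graftFibPos {I : Type} (f : I → Fin k) (i : I) (L : Type) {b : Fin k} (h : f i = b) :
    Graft (⟨i, h⟩ : Fib f b) L ≃ Fib (graftFun f i L) b where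
  toFun
    | .inl x => ⟨.inl ⟨x.1.1, fun e => x.2 (Subtype.ext e)⟩, x.1.2⟩
    | .inr y => ⟨.inr y, h⟩
  invFun
    | ⟨.inl x, hx⟩ => .inl ⟨⟨x.1, hx⟩, fun e => x.2 (congrArg Subtype.val e)⟩
    | ⟨.inr y, _⟩ => .inr y
  left_inv := by rintro (x | y) <;> rfl
  right_inv := by rintro ⟨x | y, h⟩ <;> rfl

/-- The other pieces. -/
def graftFibNeg {I : Type} (f : I → Fin k) (i : I) (L : Type) {b : Fin k} (h : f i ≠ b) :
    Fib f b ≃ Fib (graftFun f i L) b where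
  toFun x := ⟨.inl ⟨x.1, fun e => h (e ▸ x.2)⟩, x.2⟩
  invFun
    | ⟨.inl x, hx⟩ => ⟨x.1, hx⟩
    | ⟨.inr _, hx⟩ => (h hx).elim
  left_inv _ := rfl
  right_inv := by
    rintro ⟨x | y, hx⟩
    · rfl
    · exact (h hx).elim

/-- The factorwise effect of `- ∘ᵢ q`: it acts on the factor containing `i`. -/
def rcompFib (V : LieModule K) {I L : Type} [Finite I] [Finite L] (f : I → Fin k) (i : I)
    (q : (lie K).obj L) (b : Fin k) : V.obj (Fib f b) →ₗ[K] V.obj (Fib (graftFun f i L) b) :=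
  if h : f i = b then (V.map (graftFibPos f i L h)).comp ((V.rcomp (⟨i, h⟩ : Fib f b)).flip q)
  else V.map (graftFibNeg f i L h)

theorem rcompFib_pos {I L : Type} [Finite I] [Finite L] (f : I → Fin k) (i : I)
    (q : (lie K).obj L) {b : Fin k} (h : f i = b) (m : V.obj (Fib f b)) :
    rcompFib V f i q b m = V.map (graftFibPos f i L h) (V.rcomp ⟨i, h⟩ m q) := by
  simp [rcompFib, h]

theorem rcompFib_neg {I L : Type} [Finite I] [Finite L] (f : I → Fin k) (i : I)
    (q : (lie K).obj L) {b : Fin k} (h : f i ≠ b) (m : V.obj (Fib f b)) :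
    rcompFib V f i q b m = V.map (graftFibNeg f i L h) m := by
  simp [rcompFib, h]

/-- `(∏_b m_b) ∘ᵢ q`. -/
def symRcompAux {I L : Type} [Finite I] [Finite L] (i : I) (q : (lie K).obj L) :
    SymPow V.toSModule k I →ₗ[K] SymPow V.toSModule k (Graft i L) :=
  symLift (fun f => (sprod V.toSModule (graftFun f i L)).compLinearMap (rcompFib V f i q))
    (by
      intro f g σ h m m' hm
      rw [MultilinearMap.compLinearMap_apply, MultilinearMap.compLinearMap_apply]
      refine sprod_eq (σ := σ) (by rintro (x | x) <;> exact h _) fun b => ?_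
      by_cases hb : f i = b
      · have hb' : g i = σ b := by rw [h, hb]
        have h1 : fibPerm h b ⟨i, hb⟩ = (⟨i, hb'⟩ : Fib g (σ b)) := rfl
        rw [rcompFib_pos f i q hb, rcompFib_pos g i q hb', hm, V.rcomp_mapl _ h1]
        simp only [SModule.map_map]
        refine V.map_congr ?_ _
        rintro (x | x) <;> rfl
      · have hb' : g i ≠ σ b := by rw [h]; exact fun e => hb (σ.injective e)
        rw [rcompFib_neg f i q hb, rcompFib_neg g i q hb', hm]
        simp only [SModule.map_map]
        refine V.map_congr ?_ _
        rintro x; rfl)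

theorem symRcompAux_sprod {I L : Type} [Finite I] [Finite L] (i : I) (q : (lie K).obj L)
    (f : I → Fin k) (m : ∀ b, V.obj (Fib f b)) :
    symRcompAux i q (sprod V.toSModule f m) =
      sprod V.toSModule (graftFun f i L) fun b => rcompFib V f i q b (m b) := by
  rw [symRcompAux, symLift_sprod, MultilinearMap.compLinearMap_apply]

theorem rcompFib_update {I L : Type} [Finite I] [Finite L] (i : I) (q : (lie K).obj L)
    (f : I → Fin k) (m : ∀ b, V.obj (Fib f b)) :
    (fun b => rcompFib V f i q b (m b)) =
      Function.update (fun b => rcompFib V f i 0 b (m b)) (f i)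
        (V.map (graftFibPos f i L rfl) (V.rcomp ⟨i, rfl⟩ (m (f i)) q)) := by
  funext b
  by_cases h : f i = b
  · subst h
    rw [Function.update_self, rcompFib_pos f i q rfl]
  · rw [Function.update_of_ne (Ne.symm h), rcompFib_neg f i q h, rcompFib_neg f i 0 h]

/-- The right action of `Lie` on the symmetric power:
`(∏_b m_b) ∘ᵢ q = (∏_{b ≠ f i} m_b) · (m_{f i} ∘ᵢ q)`. -/
def symRcomp {I L : Type} [Finite I] [Finite L] (i : I) :
    SymPow V.toSModule k I →ₗ[K] (lie K).obj L →ₗ[K] SymPow V.toSModule k (Graft i L) :=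
  LinearMap.flip
    { toFun := symRcompAux i
      map_add' := fun q q' => symPow_hom_ext fun f m => by
        rw [LinearMap.add_apply]
        simp only [symRcompAux_sprod]
        rw [rcompFib_update i (q + q'), rcompFib_update i q, rcompFib_update i q', map_add,
          map_add, MultilinearMap.map_update_add]
      map_smul' := fun c q => symPow_hom_ext fun f m => by
        rw [RingHom.id_apply, LinearMap.smul_apply]
        simp only [symRcompAux_sprod]
        rw [rcompFib_update i (c • q), rcompFib_update i q, map_smul,
          map_smul, MultilinearMap.map_update_smul] }

theorem symRcomp_sprod {I L : Type} [Finite I] [Finite L] (i : I) (q : (lie K).obj L)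
    (f : I → Fin k) (m : ∀ b, V.obj (Fib f b)) :
    symRcomp i (sprod V.toSModule f m) q =
      sprod V.toSModule (graftFun f i L) fun b => rcompFib V f i q b (m b) :=
  symRcompAux_sprod i q f m

/-- The decomposition of `I ⊔ {∗}` with `∗` added to the piece `c`. -/
def optFun {I : Type} (f : I → Fin k) (c : Fin k) : Option I → Fin k
  | none => c
  | some x => f x

/-- The piece with the new element. -/
def optFibPos {I : Type} (f : I → Fin k) (c : Fin k) {b : Fin k} (h : c = b) :
    Option (Fib f b) ≃ Fib (optFun f c) b where
  toFun
    | none => ⟨none, h⟩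
    | some x => ⟨some x.1, x.2⟩
  invFun
    | ⟨none, _⟩ => none
    | ⟨some x, hx⟩ => some ⟨x, hx⟩
  left_inv := by rintro (_ | x) <;> rfl
  right_inv := by rintro ⟨_ | x, h⟩ <;> rfl

/-- The other pieces. -/
def optFibNeg {I : Type} (f : I → Fin k) (c : Fin k) {b : Fin k} (h : c ≠ b) :
    Fib f b ≃ Fib (optFun f c) b where
  toFun x := ⟨some x.1, x.2⟩
  invFun
    | ⟨none, hx⟩ => (h hx).elim
    | ⟨some x, hx⟩ => ⟨x, hx⟩
  left_inv _ := rfl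
  right_inv := by
    rintro ⟨_ | x, hx⟩
    · exact (h hx).elim
    · rfl

/-- The operation `ad` on the factor `c`. -/
def adFib (V : LieModule K) {I : Type} [Finite I] (f : I → Fin k) (c b : Fin k) :
    V.obj (Fib f b) →ₗ[K] V.obj (Fib (optFun f c) b) :=
  if h : c = b then (V.map (optFibPos f c h)).comp V.ad else V.map (optFibNeg f c h)

theorem adFib_pos {I : Type} [Finite I] (f : I → Fin k) {c b : Fin k} (h : c = b)
    (m : V.obj (Fib f b)) : adFib V f c b m = V.map (optFibPos f c h) (V.ad m) := by
  simp [adFib, h]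

theorem adFib_neg {I : Type} [Finite I] (f : I → Fin k) {c b : Fin k} (h : c ≠ b)
    (m : V.obj (Fib f b)) : adFib V f c b m = V.map (optFibNeg f c h) m := by
  simp [adFib, h]

/-- The action of the Lie algebra `Lie` on the symmetric power, by derivations:
`ad (∏_b m_b) = ∑_c (∏_{b ≠ c} m_b) · ad m_c`. -/
def symAd {I : Type} [Finite I] :
    SymPow V.toSModule k I →ₗ[K] SymPow V.toSModule k (Option I) :=
  symLift (fun f => ∑ c, (sprod V.toSModule (optFun f c)).compLinearMap (adFib V f c))
    (by
      intro f g σ h m m' hm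
      rw [sum_apply, sum_apply]
      refine Fintype.sum_equiv σ _ _ fun c => ?_
      rw [MultilinearMap.compLinearMap_apply, MultilinearMap.compLinearMap_apply]
      refine sprod_eq (σ := σ) (by rintro (_ | x); exacts [rfl, h _]) fun b => ?_
      by_cases hb : c = b
      · rw [adFib_pos f hb, adFib_pos g (congrArg σ hb), hm, V.ad_map]
        simp only [SModule.map_map]
        refine V.map_congr ?_ _
        rintro (_ | x) <;> rfl
      · rw [adFib_neg f hb, adFib_neg g (fun e => hb (σ.injective e)), hm]
        simp only [SModule.map_map]
        refine V.map_congr ?_ _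
        rintro x; rfl)

theorem symAd_sprod {I : Type} [Finite I] (f : I → Fin k) (m : ∀ b, V.obj (Fib f b)) :
    symAd (sprod V.toSModule f m) =
      ∑ c, sprod V.toSModule (optFun f c) fun b => adFib V f c b (m b) := by
  rw [symAd, symLift_sprod, sum_apply]
  rfl

end SymPowLie
end PBWOperad

namespace PBWOperad

section SymPowLaws

variable {K : Type u} [Field K] {V : LieModule K} {k : ℕ}

theorem symPow_eq {M : SModule K} {I : Type} [Finite I] {N : Type*} [AddCommGroup N] [Module K N]
    (F G : SymPow M k I →ₗ[K] N) (h : ∀ f m, F (sprod M f m) = G (sprod M f m))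
    (a : SymPow M k I) : F a = G a :=
  LinearMap.congr_fun (symPow_hom_ext h) a

theorem symRcomp_map {I I' J J' : Type} [Finite I] [Finite I'] [Finite J] [Finite J']
    (σ : I ≃ I') (τ : J ≃ J') (i : I) (a : SymPow V.toSModule k I) (p : (lie K).obj J) :
    symRcomp (σ i) (symMap σ a) ((lie K).map τ p) =
      symMap (graftCongr σ τ i) (symRcomp i a p) := by
  refine symPow_eq (((symRcomp (σ i)).flip ((lie K).map τ p)).comp (symMap σ))
    ((symMap (graftCongr σ τ i)).comp ((symRcomp i).flip p)) (fun f m => ?_) a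
  simp only [LinearMap.comp_apply, LinearMap.flip_apply]
  rw [exists_symMap_sprod, symRcomp_sprod, symRcomp_sprod]
  symm
  have hg : ∀ x, graftFun (fun y => f (σ.symm y)) (σ i) J' (graftCongr σ τ i x) =
      graftFun f i J x := by
    rintro (x | x)
    · exact congrArg f (σ.symm_apply_apply _)
    · exact congrArg f (σ.symm_apply_apply _)
  refine symMap_sprod _ hg fun b => ?_
  by_cases hb : f i = b
  · have hb' : (fun y => f (σ.symm y)) (σ i) = b := (congrArg f (σ.symm_apply_apply i)).trans hb
    have h1 : fibMap σ (fun x => congrArg f (σ.symm_apply_apply x)) b ⟨i, hb⟩ =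
      (⟨σ i, hb'⟩ : Fib (fun y => f (σ.symm y)) b) := rfl
    rw [rcompFib_pos f i p hb, rcompFib_pos (fun y => f (σ.symm y)) (σ i) _ hb',
      V.rcomp_map' _ τ h1]
    simp only [SModule.map_map]
    refine V.map_congr ?_ _
    rintro (x | x) <;> rfl
  · have hb' : (fun y => f (σ.symm y)) (σ i) ≠ b := by simpa using hb
    rw [rcompFib_neg f i p hb, rcompFib_neg (fun y => f (σ.symm y)) (σ i) _ hb']
    simp only [SModule.map_map]
    refine V.map_congr ?_ _
    rintro x; rfl

theorem symRcomp_one {I : Type} [Finite I] (i : I) (a : SymPow V.toSModule k I) :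
    symRcomp i a (lie K).one = symMap (graftUnitRight i) a := by
  refine symPow_eq ((symRcomp i).flip (lie K).one) (symMap (graftUnitRight i)) (fun f m => ?_) a
  rw [LinearMap.flip_apply, symRcomp_sprod]
  symm
  refine symMap_sprod _ (fun x => ?_) fun b => ?_
  · by_cases h : x = i <;> simp [graftUnitRight, graftFun, h]
  by_cases hb : f i = b
  · rw [rcompFib_pos _ _ _ hb, V.rcomp_one]
    simp only [SModule.map_map]
    refine V.map_congr ?_ _
    rintro ⟨x, hx⟩
    by_cases h : x = i
    · subst h; simp [graftUnitRight, graftFibPos, fibMap]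
    · simp [graftUnitRight, graftFibPos, fibMap, h]
  · rw [rcompFib_neg _ _ _ hb]
    refine V.map_congr ?_ _
    rintro ⟨x, hx⟩
    have h : x ≠ i := by rintro rfl; exact hb hx
    simp [graftUnitRight, graftFibNeg, fibMap, h]

theorem symRcomp_symRcomp {I J L : Type} [Finite I] [Finite J] [Finite L] (i : I) (j : J)
    (a : SymPow V.toSModule k I) (p : (lie K).obj J) (q : (lie K).obj L) :
    symRcomp (Sum.inr j : Graft i J) (symRcomp i a p) q =
      symMap (graftSeq i j L) (symRcomp i a ((lie K).comp j p q)) := by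
  refine symPow_eq (((symRcomp (Sum.inr j : Graft i J)).flip q).comp ((symRcomp i).flip p))
    ((symMap (graftSeq i j L)).comp ((symRcomp i).flip ((lie K).comp j p q))) (fun f m => ?_) a
  simp only [LinearMap.comp_apply, LinearMap.flip_apply]
  rw [symRcomp_sprod, symRcomp_sprod, symRcomp_sprod]
  symm
  refine symMap_sprod _ (by rintro (x | x | x) <;> rfl) fun b => ?_
  by_cases hb : f i = b
  · have hb' : graftFun f i J (Sum.inr j) = b := hb
    have h1 : graftFibPos f i J hb (Sum.inr j) =
      (⟨Sum.inr j, hb'⟩ : Fib (graftFun f i J) b) := rfl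
    rw [rcompFib_pos _ _ _ hb, rcompFib_pos _ _ _ hb, rcompFib_pos _ _ _ hb',
      V.rcomp_mapl _ h1, V.rcomp_rcomp]
    simp only [SModule.map_map]
    refine V.map_congr ?_ _
    rintro (x | x | x) <;> rfl
  · have hb' : graftFun f i J (Sum.inr j) ≠ b := hb
    rw [rcompFib_neg _ _ _ hb, rcompFib_neg _ _ _ hb, rcompFib_neg _ _ _ hb']
    simp only [SModule.map_map]
    refine V.map_congr ?_ _
    rintro x; rfl

theorem symRcomp_par {I J L : Type} [Finite I] [Finite J] [Finite L] (i l : I) (h : i ≠ l)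
    (a : SymPow V.toSModule k I) (p : (lie K).obj J) (q : (lie K).obj L) :
    symRcomp (Sum.inl ⟨l, h.symm⟩ : Graft i J) (symRcomp i a p) q =
      symMap (graftPar i l h J L)
        (symRcomp (Sum.inl ⟨i, h⟩ : Graft l L) (symRcomp l a q) p) := by
  refine symPow_eq (((symRcomp (Sum.inl ⟨l, h.symm⟩ : Graft i J)).flip q).comp
      ((symRcomp i).flip p))
    ((symMap (graftPar i l h J L)).comp
      (((symRcomp (Sum.inl ⟨i, h⟩ : Graft l L)).flip p).comp ((symRcomp l).flip q)))
    (fun f m => ?_) a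
  simp only [LinearMap.comp_apply, LinearMap.flip_apply]
  rw [symRcomp_sprod, symRcomp_sprod, symRcomp_sprod, symRcomp_sprod]
  symm
  refine symMap_sprod _ (by rintro (⟨x | x, hx⟩ | x) <;> rfl) fun b => ?_
  by_cases hi : f i = b <;> by_cases hl : f l = b
  · have hl' : graftFun f i J (Sum.inl ⟨l, h.symm⟩) = b := hl
    have hi' : graftFun f l L (Sum.inl ⟨i, h⟩) = b := hi
    have hil : (⟨i, hi⟩ : Fib f b) ≠ ⟨l, hl⟩ := fun e => h (congrArg Subtype.val e)
    have h1 : graftFibPos f i J hi (Sum.inl ⟨⟨l, hl⟩, hil.symm⟩) =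
      (⟨Sum.inl ⟨l, h.symm⟩, hl'⟩ : Fib (graftFun f i J) b) := rfl
    have h2 : graftFibPos f l L hl (Sum.inl ⟨⟨i, hi⟩, hil⟩) =
      (⟨Sum.inl ⟨i, h⟩, hi'⟩ : Fib (graftFun f l L) b) := rfl
    rw [rcompFib_pos _ _ _ hi, rcompFib_pos _ _ _ hl, rcompFib_pos _ _ _ hl',
      rcompFib_pos _ _ _ hi', V.rcomp_mapl _ h1, V.rcomp_mapl _ h2, V.rcomp_par _ _ hil]
    simp only [SModule.map_map]
    refine V.map_congr ?_ _
    rintro (⟨x | x, hx⟩ | x) <;> rfl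
  · have hl' : graftFun f i J (Sum.inl ⟨l, h.symm⟩) ≠ b := hl
    have hi' : graftFun f l L (Sum.inl ⟨i, h⟩) = b := hi
    have h2 : graftFibNeg f l L hl ⟨i, hi⟩ =
      (⟨Sum.inl ⟨i, h⟩, hi'⟩ : Fib (graftFun f l L) b) := rfl
    rw [rcompFib_pos _ _ _ hi, rcompFib_neg _ _ _ hl, rcompFib_neg _ _ _ hl',
      rcompFib_pos _ _ _ hi', V.rcomp_mapl _ h2]
    simp only [SModule.map_map]
    refine V.map_congr ?_ _
    rintro (x | x) <;> rfl
  · have hl' : graftFun f i J (Sum.inl ⟨l, h.symm⟩) = b := hl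
    have hi' : graftFun f l L (Sum.inl ⟨i, h⟩) ≠ b := hi
    have h1 : graftFibNeg f i J hi ⟨l, hl⟩ =
      (⟨Sum.inl ⟨l, h.symm⟩, hl'⟩ : Fib (graftFun f i J) b) := rfl
    rw [rcompFib_neg _ _ _ hi, rcompFib_pos _ _ _ hl, rcompFib_pos _ _ _ hl',
      rcompFib_neg _ _ _ hi', V.rcomp_mapl _ h1]
    simp only [SModule.map_map]
    refine V.map_congr ?_ _
    rintro (x | x) <;> rfl
  · have hl' : graftFun f i J (Sum.inl ⟨l, h.symm⟩) ≠ b := hl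
    have hi' : graftFun f l L (Sum.inl ⟨i, h⟩) ≠ b := hi
    rw [rcompFib_neg _ _ _ hi, rcompFib_neg _ _ _ hl, rcompFib_neg _ _ _ hl',
      rcompFib_neg _ _ _ hi']
    simp only [SModule.map_map]
    refine V.map_congr ?_ _
    rintro x; rfl

theorem symAd_map {J J' : Type} [Finite J] [Finite J'] (τ : J ≃ J')
    (a : SymPow V.toSModule k J) :
    symAd (symMap τ a) = symMap (Equiv.optionCongr τ) (symAd a) := by
  refine symPow_eq (symAd.comp (symMap τ)) ((symMap (Equiv.optionCongr τ)).comp symAd)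
    (fun f m => ?_) a
  simp only [LinearMap.comp_apply]
  rw [exists_symMap_sprod, symAd_sprod, symAd_sprod, map_sum]
  refine Finset.sum_congr rfl fun c _ => ?_
  symm
  refine symMap_sprod _ ?_ fun b => ?_
  · rintro (_ | x)
    · rfl
    · exact congrArg f (τ.symm_apply_apply _)
  by_cases hb : c = b
  · rw [adFib_pos _ hb, adFib_pos _ hb, V.ad_map]
    simp only [SModule.map_map]
    refine V.map_congr ?_ _
    rintro (_ | x) <;> rfl
  · rw [adFib_neg _ hb, adFib_neg _ hb]
    simp only [SModule.map_map]
    refine V.map_congr ?_ _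
    rintro x; rfl

theorem symRcomp_ad {J L : Type} [Finite J] [Finite L] (j : J) (a : SymPow V.toSModule k J)
    (q : (lie K).obj L) :
    symRcomp (some j) (symAd a) q = symMap (optGraft j L) (symAd (symRcomp j a q)) := by
  refine symPow_eq (((symRcomp (some j)).flip q).comp symAd)
    ((symMap (optGraft j L)).comp (symAd.comp ((symRcomp j).flip q))) (fun f m => ?_) a
  simp only [LinearMap.comp_apply, LinearMap.flip_apply]
  rw [symRcomp_sprod, symAd_sprod, symAd_sprod, map_sum, map_sum, LinearMap.sum_apply]
  refine Finset.sum_congr rfl fun c _ => ?_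
  rw [symRcomp_sprod]
  symm
  refine symMap_sprod _ (by rintro (_ | x | x) <;> rfl) fun b => ?_
  by_cases hc : c = b <;> by_cases hj : f j = b
  · have hj' : optFun f c (some j) = b := hj
    have h1 : optFibPos f c hc (some ⟨j, hj⟩) = (⟨some j, hj'⟩ : Fib (optFun f c) b) := rfl
    rw [adFib_pos _ hc, adFib_pos _ hc, rcompFib_pos _ _ _ hj, rcompFib_pos _ _ _ hj',
      V.rcomp_mapl _ h1, V.rcomp_ad, V.ad_map]
    simp only [SModule.map_map]
    refine V.map_congr ?_ _
    rintro (_ | x | x) <;> rfl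
  · have hj' : optFun f c (some j) ≠ b := hj
    rw [adFib_pos _ hc, adFib_pos _ hc, rcompFib_neg _ _ _ hj, rcompFib_neg _ _ _ hj', V.ad_map]
    simp only [SModule.map_map]
    refine V.map_congr ?_ _
    rintro (_ | x) <;> rfl
  · have hj' : optFun f c (some j) = b := hj
    have h1 : optFibNeg f c hc ⟨j, hj⟩ = (⟨some j, hj'⟩ : Fib (optFun f c) b) := rfl
    rw [adFib_neg _ hc, adFib_neg _ hc, rcompFib_pos _ _ _ hj, rcompFib_pos _ _ _ hj',
      V.rcomp_mapl _ h1]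
    simp only [SModule.map_map]
    refine V.map_congr ?_ _
    rintro (x | x) <;> rfl
  · have hj' : optFun f c (some j) ≠ b := hj
    rw [adFib_neg _ hc, adFib_neg _ hc, rcompFib_neg _ _ _ hj, rcompFib_neg _ _ _ hj']
    simp only [SModule.map_map]
    refine V.map_congr ?_ _
    rintro x; rfl

theorem symAd_symAd_cross {J : Type} [Finite J] (f : J → Fin k) (m : ∀ b, V.obj (Fib f b))
    {c d : Fin k} (h : c ≠ d) :
    symMap (twoEquiv J false) (sprod V.toSModule (optFun (optFun f c) d) fun b =>
        adFib V (optFun f c) d b (adFib V f c b (m b))) =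
      symMap (twoEquiv J true) (sprod V.toSModule (optFun (optFun f d) c) fun b =>
        adFib V (optFun f d) c b (adFib V f d b (m b))) := by
  rw [exists_symMap_sprod (twoEquiv J true)]
  refine symMap_sprod _ (by rintro (_ | _ | x) <;> rfl) fun b => ?_
  by_cases hc : c = b
  · have hd : d ≠ b := fun e => h (hc.trans e.symm)
    rw [adFib_pos _ hc, adFib_pos _ hc, adFib_neg _ hd, adFib_neg _ hd, V.ad_map]
    simp only [SModule.map_map]
    refine V.map_congr ?_ _
    rintro (_ | x) <;> rfl
  by_cases hd : d = b
  · rw [adFib_neg _ hc, adFib_neg _ hc, adFib_pos _ hd, adFib_pos _ hd, V.ad_map]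
    simp only [SModule.map_map]
    refine V.map_congr ?_ _
    rintro (_ | x) <;> rfl
  · rw [adFib_neg _ hc, adFib_neg _ hc, adFib_neg _ hd, adFib_neg _ hd]
    simp only [SModule.map_map]
    refine V.map_congr ?_ _
    rintro x; rfl

theorem symAd_symAd_diag {J : Type} [Finite J] (f : J → Fin k) (m : ∀ b, V.obj (Fib f b))
    (c : Fin k) (β : Bool) (q : (lie K).obj Bool) (h : optFun f c none = c)
    (h1 : optFibPos f c rfl none = (⟨none, h⟩ : Fib (optFun f c) c)) :
    symMap (twoEquiv J β) (sprod V.toSModule (optFun (optFun f c) c) fun b =>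
        adFib V (optFun f c) c b (adFib V f c b (m b))) =
      sprod V.toSModule (graftFun (optFun f c) none Bool) (Function.update (fun b =>
        rcompFib V (optFun f c) none q b (adFib V f c b (m b))) c
          (V.map (graftFibPos (optFun f c) none Bool h) (V.map
            (graftMap (optFibPos f c rfl) (Equiv.refl Bool) h1)
              (V.map (twoEquiv (Fib f c) β) (V.ad (V.ad (m c))))))) := by
  refine symMap_sprod _ (by rintro (_ | _ | x) <;> rfl) fun b => ?_
  by_cases hc : c = b
  · subst hc
    rw [Function.update_self, adFib_pos _ rfl, adFib_pos _ rfl, V.ad_map]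
    simp only [SModule.map_map]
    refine V.map_congr ?_ _
    rintro (_ | _ | x)
    · rfl
    · rfl
    · rfl
  · have h' : optFun f c none ≠ b := hc
    rw [Function.update_of_ne (Ne.symm hc), adFib_neg _ hc, adFib_neg _ hc,
      rcompFib_neg _ _ _ h']
    simp only [SModule.map_map]
    refine V.map_congr ?_ _
    rintro x; rfl

theorem symRcomp_bracket {J : Type} [Finite J] (f : J → Fin k) (m : ∀ b, V.obj (Fib f b))
    (c : Fin k) :
    symRcomp none (sprod V.toSModule (optFun f c) fun b => adFib V f c b (m b)) (bracket K) =
      symMap (twoEquiv J false) (sprod V.toSModule (optFun (optFun f c) c) fun b =>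
        adFib V (optFun f c) c b (adFib V f c b (m b))) -
      symMap (twoEquiv J true) (sprod V.toSModule (optFun (optFun f c) c) fun b =>
        adFib V (optFun f c) c b (adFib V f c b (m b))) := by
  have h' : optFun f c none = c := rfl
  have h1 : optFibPos f c rfl none = (⟨none, h'⟩ : Fib (optFun f c) c) := rfl
  rw [symAd_symAd_diag f m c false (bracket K) h' h1,
    symAd_symAd_diag f m c true (bracket K) h' h1,
    ← MultilinearMap.map_update_sub, ← map_sub, ← map_sub, ← V.ad_bracket, symRcomp_sprod]
  congr 1
  funext b
  by_cases hc : c = b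
  · subst hc
    rw [Function.update_self, adFib_pos _ rfl, rcompFib_pos _ _ _ h', V.rcomp_mapl _ h1]
  · rw [Function.update_of_ne (Ne.symm hc)]

theorem symAd_bracket {J : Type} [Finite J] (a : SymPow V.toSModule k J) :
    symRcomp none (symAd a) (bracket K) =
      symMap (twoEquiv J false) (symAd (symAd a)) - symMap (twoEquiv J true) (symAd (symAd a)) := by
  refine symPow_eq (((symRcomp none).flip (bracket K)).comp symAd)
    ((symMap (twoEquiv J false)).comp (symAd.comp symAd) -
      (symMap (twoEquiv J true)).comp (symAd.comp symAd)) (fun f m => ?_) a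
  simp only [LinearMap.comp_apply, LinearMap.flip_apply, LinearMap.sub_apply]
  rw [symAd_sprod]
  simp only [map_sum, LinearMap.sum_apply, symAd_sprod]
  rw [Finset.sum_comm (f := fun c d => symMap (twoEquiv J true)
    (sprod V.toSModule (optFun (optFun f c) d) fun b =>
      adFib V (optFun f c) d b (adFib V f c b (m b)))), ← Finset.sum_sub_distrib]
  refine Finset.sum_congr rfl fun c _ => ?_
  rw [← Finset.sum_sub_distrib, Finset.sum_eq_single c, symRcomp_bracket]
  · intro d _ hd
    rw [symAd_symAd_cross f m (Ne.symm hd), sub_self]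
  · simp

/-- The `k`-th symmetric power of a module over the Lie algebra `Lie`. -/
def LieModule.symPow (V : LieModule K) (k : ℕ) : LieModule K where
  toSModule := symPowSModule V.toSModule k
  rcomp i := symRcomp i
  ad := symAd
  rcomp_map := symRcomp_map
  rcomp_one := symRcomp_one
  rcomp_rcomp := symRcomp_symRcomp
  rcomp_par := symRcomp_par
  ad_map := symAd_map
  rcomp_ad := symRcomp_ad
  ad_bracket := symAd_bracket

/-- The `k`-th symmetric power of an infinitesimal `Lie`-bimodule, i.e. of a module over the Lie
algebra `Lie` in right `Lie`-modules. -/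
def InfBimodule.symPow (M : InfBimodule (lie K)) (k : ℕ) : InfBimodule (lie K) :=
  (M.toLieModule.symPow k).toInfBimodule

end SymPowLaws
end PBWOperad

end

noncomputable section

/-! ### Symmetrized products in associative algebras -/

namespace PBWOperad

/-! The isomorphism is the symmetrization map of the Poincaré–Birkhoff–Witt theorem, carried out on
multilinear parts: a product `m_1 ⋯ m_k` of Lie operations with disjoint inputs goes to `(k!)⁻¹ ∑_σ
m_{σ(1)} ⋯ m_{σ(k)}` in the free associative algebra. It respects the right action because
substituting a Lie polynomial for a letter is an algebra map, hence passes through symmetrized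
products (`symmetrization_rcomp`). It respects `ad = [x_∗, -]` because a commutator is a derivation,
and the Lie algebra acts on symmetric powers by derivations (`symmetrization_ad`). Nothing more has
to be checked on the left: the whole left action is a combination of iterated `ad`s whose
coefficients depend only on the operation of `Lie` (`app_lcomp`). The same formula, applied to the
unit of `Lie`, shows that a Lie operation is determined by its associative polynomial
(`lieToFree_injOn`), so `Lie → Ass` is injective.

Injectivity of symmetrization is a triangularity argument. For a decomposition `g : I → Fin k`, let
`deshuffle` send each letter `x` to the tensor factor `g x` of the `k`-th tensor power of the free
algebra. Different tensor factors commute, so a Lie polynomial dies unless all of its letters lie in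
one piece of `g`, in which case it lands in that factor. A symmetrized product of Lie polynomials
with pieces given by `f` therefore survives only if `g` is coarser than `f`. Summing over surjective
`g` gives a map `symProjection` that kills the symmetrizations of degree `l < k`
(`symProjection_symmetrization_of_lt`) and is `k!` on those of degree `k`
(`symProjection_symmetrization`). Nothing is claimed about `l > k`, so in a vanishing sum the
component of highest degree vanishes, a contradiction unless all components do
(`symmetrizationSum_eq_zero`).

Surjectivity is straightening: interchanging two adjacent factors of a product of brackets changes
it by a product with one factor fewer, so by induction on the number of factors every product of
brackets agrees with its symmetrization modulo what has already been reached (`bracketProd_mem`). A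
word is a product of one-letter brackets. Characteristic zero enters through division by `k!`, here
and in the triangularity argument.

For `Ass` only degree `0` is dropped: `Sym^0(Lie)` vanishes on nonempty sets, and the powers with `k
≥ 1` vanish on the empty set because `Lie(∅) = 0`. Symmetrization in degree `1` is the inclusion of
`Lie`, so the projection to the summand `Sym^1(Lie)` is the desired retraction. -/

open Equiv in
/-- The symmetrized product `∑_σ v_{σ(0)} ⋯ v_{σ(k-1)}`. -/
def symProd (K A : Type u) [Field K] [Ring A] [Algebra K A] (k : ℕ) :
    MultilinearMap K (fun _ : Fin k => A) A :=
  ∑ σ : Perm (Fin k), (MultilinearMap.mkPiAlgebraFin K k A).domDomCongr σ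

section SymProd

variable {K A B : Type u} [Field K] [Ring A] [Algebra K A] [Ring B] [Algebra K B] {k : ℕ}

theorem symProd_apply (v : Fin k → A) :
    symProd K A k v = ∑ σ : Equiv.Perm (Fin k), (List.ofFn fun j => v (σ j)).prod := by
  simp [symProd]

/-- Reindexing the sum by `σ ↦ τσ`. This invariance makes symmetrization well defined on
coinvariants. -/
theorem symProd_comp_perm (τ : Equiv.Perm (Fin k)) (v : Fin k → A) :
    symProd K A k (fun j => v (τ j)) = symProd K A k v := by
  rw [symProd_apply, symProd_apply]
  exact Fintype.sum_equiv (Equiv.mulLeft τ) _ _ fun σ => rfl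

theorem map_symProd (F : A →ₐ[K] B) (v : Fin k → A) :
    F (symProd K A k v) = symProd K B k fun j => F (v j) := by
  simp only [symProd_apply, map_sum, map_list_prod, List.map_ofFn]
  rfl

/-- A derivation, relative to an algebra map `R`, of a product. -/
theorem derivation_ofFn_prod (R : A →ₐ[K] B) (D : A →ₗ[K] B)
    (hD : ∀ a b, D (a * b) = D a * R b + R a * D b) (v : Fin k → A) :
    D (List.ofFn v).prod =
      ∑ c, (List.ofFn (Function.update (fun j => R (v j)) c (D (v c)))).prod := by
  -- The Leibniz rule for `1 * 1`; it is the case of the empty product.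
  have h1 : D 1 = 0 := by simpa using hD 1 1
  induction k with
  | zero => simp [h1]
  | succ k ih =>
    rw [List.ofFn_succ, List.prod_cons, hD, ih, Fin.sum_univ_succ, map_list_prod, List.map_ofFn,
      Finset.mul_sum]
    congr 1
    · simp [List.ofFn_succ, Function.comp_def]
    · refine Finset.sum_congr rfl fun c _ => ?_
      rw [List.ofFn_succ, List.prod_cons, Function.update_of_ne (Fin.succ_ne_zero c).symm]
      congr 3
      funext j
      by_cases h : j = c
      · subst h; simp
      · rw [Function.update_of_ne h, Function.update_of_ne (by simpa using h)]

/-- Applied below with `D = [x_∗, -]` and `R` the inclusion of the old letters, where the right side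
matches the derivation action on a symmetric power. -/
theorem derivation_symProd (R : A →ₐ[K] B) (D : A →ₗ[K] B)
    (hD : ∀ a b, D (a * b) = D a * R b + R a * D b) (v : Fin k → A) :
    D (symProd K A k v) = ∑ c, symProd K B k (Function.update (fun j => R (v j)) c (D (v c))) := by
  simp only [symProd_apply, map_sum]
  rw [Finset.sum_comm]
  refine Finset.sum_congr rfl fun σ _ => ?_
  rw [derivation_ofFn_prod R D hD]
  -- In the word belonging to `σ`, the position `c` is occupied by the factor `σ c`, so summing over
  -- positions is summing over factors.
  refine Fintype.sum_equiv σ _ _ fun c => ?_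
  congr 2
  funext j
  by_cases h : j = c
  · subst h; simp
  · rw [Function.update_of_ne h, Function.update_of_ne (by simpa using h)]

end SymProd

variable {K : Type u} [Field K]

/-! ### Maps commuting with the left action, and faithfulness of associative polynomials -/

namespace LieModule

variable {V : LieModule K} {N : InfBimodule (lie K)}

theorem app_iterAd (F : ∀ (I : Type) [Finite I], V.obj I →ₗ[K] N.obj I)
    (hmap : ∀ {I J : Type} [Finite I] [Finite J] (σ : I ≃ J) (m : V.obj I),
      F J (V.map σ m) = N.map σ (F I m))
    (had : ∀ {J : Type} [Finite J] (m : V.obj J),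
      F (Option J) (V.ad m) = N.toLieModule.ad (F J m))
    {J : Type} [Finite J] (r : ℕ) (m : V.obj J) :
    F _ (V.iterAd r m) = N.toLieModule.iterAd r (F J m) := by
  induction r with
  | zero => exact hmap _ _
  | succ r ih =>
    refine (hmap _ _).trans ?_
    rw [LinearMap.comp_apply, had, ih]
    rfl

/-- Both left actions are given by one formula: a sum over orderings of relabelled iterated `ad`s,
with word coefficients of `p` as scalars. For `V` this is the definition; for `N` it is
`InfBimodule.lcomp_toLieModule`. Naturality and compatibility with `ad` thus suffice. -/
theorem app_lcomp (F : ∀ (I : Type) [Finite I], V.obj I →ₗ[K] N.obj I)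
    (hmap : ∀ {I J : Type} [Finite I] [Finite J] (σ : I ≃ J) (m : V.obj I),
      F J (V.map σ m) = N.map σ (F I m))
    (had : ∀ {J : Type} [Finite J] (m : V.obj J),
      F (Option J) (V.ad m) = N.toLieModule.ad (F J m))
    {I J : Type} [Finite I] [Finite J] (i : I) (p : (lie K).obj I) (m : V.obj J) :
    F (Graft i J) (V.lcomp i p m) = N.lcomp i p (F J m) := by
  classical
  rw [← N.lcomp_toLieModule, V.lcomp_eq _ i rfl, N.toLieModule.lcomp_eq _ i rfl]
  let _ := Fintype.ofFinite (Fin (Nat.card {x : I // x ≠ i}) ≃ {x : I // x ≠ i})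
  rw [lcompAux_apply, lcompAux_apply, map_sum]
  refine Finset.sum_congr rfl fun e _ => ?_
  rw [map_smul, hmap, app_iterAd F hmap had]

/-- A natural map that is compatible with the right actions and with `ad` is a morphism of
infinitesimal bimodules. -/
def bimoduleHom (F : ∀ (I : Type) [Finite I], V.obj I →ₗ[K] N.obj I)
    (hmap : ∀ {I J : Type} [Finite I] [Finite J] (σ : I ≃ J) (m : V.obj I),
      F J (V.map σ m) = N.map σ (F I m))
    (hrcomp : ∀ {I J : Type} [Finite I] [Finite J] (i : I) (m : V.obj I) (p : (lie K).obj J),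
      F (Graft i J) (V.rcomp i m p) = N.rcomp i (F I m) p)
    (had : ∀ {J : Type} [Finite J] (m : V.obj J),
      F (Option J) (V.ad m) = N.toLieModule.ad (F J m)) :
    InfBimodule.Hom V.toInfBimodule N where
  app := F
  app_map := hmap
  app_rcomp := hrcomp
  app_lcomp := app_lcomp F hmap had

/-- The formula for the left action sees `p` only through the word coefficients of its associative
polynomial. -/
theorem lcomp_eq_zero {V : LieModule K} {I J : Type} [Finite I] [Finite J] (i : I)
    {p : (lie K).obj I} (h : lieToFree K I p.1 = 0) (m : V.obj J) : V.lcomp i p m = 0 := by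
  let _ := Fintype.ofFinite (Fin (Nat.card {x : I // x ≠ i}) ≃ {x : I // x ≠ i})
  rw [lcomp_eq _ _ i rfl, lcompAux_apply]
  refine Finset.sum_eq_zero fun e _ => ?_
  have : ((lieToAssPlus K).app I p).1 = 0 := h
  rw [this, map_zero, zero_smul]

end LieModule

/-- Operations of `Lie` are determined by their associative polynomials. -/
theorem lieToFree_injOn {I : Type} [Finite I] (p : (lie K).obj I) (h : lieToFree K I p.1 = 0) :
    p = 0 := by
  classical
  cases isEmpty_or_nonempty I with
  | inl hI => exact Subtype.ext (lieMultilinear_of_isEmpty p.2)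
  | inr hI =>
    obtain ⟨i⟩ := hI
    -- The composite `p ∘ᵢ 1` is `p` up to relabelling. Regarded as the left action of `Lie` on
    -- itself it is also given by the word coefficients of `p`, which are all zero. This needs an
    -- input `i`, whence the separate case of the empty set.
    have e : (lie K).map (graftUnitRight i) p = 0 := ((lie K).comp_one i p).symm.trans
      (((InfBimodule.self (lie K)).lcomp_toLieModule i p (lie K).one).symm.trans
        (LieModule.lcomp_eq_zero i h _))
    rw [← (lie K).map_refl p, ← Equiv.self_trans_symm (graftUnitRight i), (lie K).map_trans, e,
      map_zero]

theorem assRename_rename {I J L : Type} (σ : I → J) (τ : J → L) (a : FreeAlgebra K I) :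
    assRename K τ (assRename K σ a) = assRename K (τ ∘ σ) a := by
  change ((assRename K τ).comp (assRename K σ)) a = _
  congr 1; ext; simp [assRename]

end PBWOperad

/-! ### Symmetrization as a morphism of infinitesimal bimodules -/

namespace PBWOperad

variable {K : Type u} [Field K]

variable (K) in
/-- `Lie` as a module over itself. -/
abbrev lieSelf : LieModule K := (InfBimodule.self (lie K)).toLieModule

/-- The associative polynomial of an operation of `Lie`, with inputs renamed. -/
def lieEval {A I : Type} [Finite A] (σ : A → I) : (lieSelf K).obj A →ₗ[K] FreeAlgebra K I :=
  (assRename K σ).toLinearMap.comp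
    ((assMultilinear K A).subtype.comp ((lieToAssPlus K).app A))

theorem lieEval_apply {A I : Type} [Finite A] (σ : A → I) (p : (lieSelf K).obj A) :
    lieEval σ p = lieToFree K I (lieRename K σ p.1) := (lieToFree_rename σ _).symm

theorem lieEval_map {A B I : Type} [Finite A] [Finite B] (e : A ≃ B) (σ : B → I)
    (p : (lieSelf K).obj A) : lieEval σ ((lieSelf K).map e p) = lieEval (σ ∘ e) p := by
  rw [lieEval_apply, lieEval_apply, ← lieRename_rename]
  rfl

theorem assRename_lieEval {A I J : Type} [Finite A] (σ : A → I) (τ : I → J)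
    (p : (lieSelf K).obj A) : assRename K τ (lieEval σ p) = lieEval (τ ∘ σ) p := by
  rw [lieEval_apply, lieEval_apply, ← lieToFree_rename, lieRename_rename]

/-- Stated for arbitrary elements, not only multilinear ones, so that it can be used after the
inputs of a piece have been included into all of `I`. -/
theorem lieToFree_subst {I J : Type} (i : I) (q : FreeLieAlgebra K J) (a : FreeLieAlgebra K I) :
    lieToFree K (Graft i J) (lieSubst K i q a) =
      assSubst K i (lieToFree K J q) (lieToFree K I a) := by
  rw [lieSubst, lieToFree_lift, assSubst]
  congr 2
  ext x
  by_cases h : x = i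
  · subst h
    rw [plug_self, plug_self, lieToFree_lift]
    simp only [lieToFree_of]
  · rw [plug_of_ne h, plug_of_ne h, lieToFree_of]

section

variable {V : LieModule K} {k : ℕ}

/-- The map from the symmetric power of `Lie` to the free associative algebra given by
`∏_b m_b ↦ (k!)⁻¹ ∑_σ m_{σ(0)} ⋯ m_{σ(k-1)}`. -/
def symmetrization (k : ℕ) (I : Type) [Finite I] :
    SymPow (lieSelf K).toSModule k I →ₗ[K] FreeAlgebra K I :=
  (k.factorial : K)⁻¹ •
    symLift (fun f => (symProd K (FreeAlgebra K I) k).compLinearMap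
      fun b => lieEval (Subtype.val : Fib f b → I)) (by
        intro f g σ h m m' hm
        rw [MultilinearMap.compLinearMap_apply, MultilinearMap.compLinearMap_apply,
          ← symProd_comp_perm σ fun b => lieEval (Subtype.val : Fib g b → I) (m' b)]
        congr 1
        funext b
        rw [hm, lieEval_map]
        rfl)

theorem symmetrization_sprod {I : Type} [Finite I] (f : I → Fin k)
    (m : ∀ b, (lieSelf K).obj (Fib f b)) :
    symmetrization k I (sprod (lieSelf K).toSModule f m) = (k.factorial : K)⁻¹ •
      symProd K (FreeAlgebra K I) k fun b => lieEval (Subtype.val : Fib f b → I) (m b) := by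
  rw [symmetrization, LinearMap.smul_apply, symLift_sprod, MultilinearMap.compLinearMap_apply]

theorem symmetrization_map {I J : Type} [Finite I] [Finite J] (τ : I ≃ J)
    (a : SymPow (lieSelf K).toSModule k I) :
    symmetrization k J (symMap τ a) = assRename K τ (symmetrization k I a) := by
  refine symPow_eq ((symmetrization k J).comp (symMap τ))
    ((assRename K τ).toLinearMap.comp (symmetrization k I)) (fun f m => ?_) a
  rw [LinearMap.comp_apply, LinearMap.comp_apply, exists_symMap_sprod, symmetrization_sprod,
    symmetrization_sprod, AlgHom.toLinearMap_apply, map_smul, map_symProd]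
  congr 2
  funext b
  rw [assRename_lieEval]
  exact lieEval_map _ _ _

/-- If `i` lies in the piece `b`, both sides substitute `q` for the letter `i`. Otherwise that
letter does not occur in the polynomial of `m`, and substitution only renames, as `rcompFib` does.
-/
theorem lieEval_rcompFib {I J : Type} [Finite I] [Finite J] (f : I → Fin k) (i : I)
    (q : (lie K).obj J) (b : Fin k) (m : (lieSelf K).obj (Fib f b)) :
    lieEval (Subtype.val : Fib (graftFun f i J) b → Graft i J) (rcompFib (lieSelf K) f i q b m) =
      assSubst K i (lieToFree K J q.1) (lieEval (Subtype.val : Fib f b → I) m) := by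
  by_cases hb : f i = b
  · rw [rcompFib_pos _ _ _ hb, lieEval_map, lieEval_apply, lieEval_apply, ← lieToFree_subst]
    change lieToFree K _ (lieRename K _ (lieSubst K (⟨i, hb⟩ : Fib f b) q.1 m.1)) = _
    have := lieSubst_rename_of_injective (⟨i, hb⟩ : Fib f b) Subtype.val Subtype.val_injective
      q.1 m.1
    refine congrArg _ (Eq.trans ?_ this.symm)
    congr 1
    congr 1
    ext (x | x) <;> rfl
  · have hne : ∀ x : Fib f b, x.1 ≠ i := fun x e => hb (e ▸ x.2)
    rw [rcompFib_neg _ _ _ hb, lieEval_map, lieEval_apply, lieEval_apply, ← lieToFree_subst,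
      lieSubst_rename_of_ne _ _ hne]
    rfl

/-- Substitution is an algebra map, so it may be applied to each factor of a symmetrized product
separately, where `lieEval_rcompFib` identifies it with the factorwise right action. -/
theorem symmetrization_rcomp {I J : Type} [Finite I] [Finite J] (i : I)
    (a : SymPow (lieSelf K).toSModule k I) (q : (lie K).obj J) :
    symmetrization k (Graft i J) (symRcomp i a q) =
      assSubst K i (lieToFree K J q.1) (symmetrization k I a) := by
  refine symPow_eq ((symmetrization k (Graft i J)).comp ((symRcomp i).flip q))
    ((assSubst K i (lieToFree K J q.1)).toLinearMap.comp (symmetrization k I)) (fun f m => ?_) a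
  rw [LinearMap.comp_apply, LinearMap.comp_apply, LinearMap.flip_apply, symRcomp_sprod,
    symmetrization_sprod, symmetrization_sprod, AlgHom.toLinearMap_apply, map_smul, map_symProd]
  congr 2
  funext b
  exact lieEval_rcompFib _ _ _ _ _

/-- `a ↦ [x_∗, a]`. -/
def freeAd (K : Type u) [Field K] (I : Type) : FreeAlgebra K I →ₗ[K] FreeAlgebra K (Option I) :=
  (LinearMap.mulLeft K (FreeAlgebra.ι K none) - LinearMap.mulRight K (FreeAlgebra.ι K none)).comp
    (assRename K some).toLinearMap

theorem freeAd_apply {I : Type} (a : FreeAlgebra K I) :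
    freeAd K I a = FreeAlgebra.ι K none * assRename K some a -
      assRename K some a * FreeAlgebra.ι K none := rfl

theorem lieSelf_ad_coe {I : Type} [Finite I] (p : (lieSelf K).obj I) :
    ((lieSelf K).ad p).1 =
      ⁅FreeLieAlgebra.of K (none : Option I), lieRename K (some : I → Option I) p.1⁆ := by
  change lieRename K (InfBimodule.boolNone I) (lieSubst K true p.1
    ⁅FreeLieAlgebra.of K false, FreeLieAlgebra.of K true⁆) = _
  rw [LieHom.map_lie, LieHom.map_lie]
  congr 1
  · simp [lieSubst, lieRename, plug, InfBimodule.boolNone]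
  · rw [lieSubst, FreeLieAlgebra.lift_of_apply, plug_self]
    exact lieRename_rename _ _ _

theorem assRename_ι {I J : Type} (σ : I → J) (x : I) :
    assRename K σ (FreeAlgebra.ι K x) = FreeAlgebra.ι K (σ x) := by
  simp [assRename]

/-- The map `Lie → Ass` turns the bracket with the new letter into the commutator with it. The
renaming `τ` is left general because on a piece of a decomposition it factors through `optFibPos`.
-/
theorem lieEval_ad {A I : Type} [Finite A] (σ : A → I) (τ : Option A → Option I)
    (h0 : τ none = none) (h1 : ∀ x, τ (some x) = some (σ x)) (p : (lieSelf K).obj A) :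
    lieEval τ ((lieSelf K).ad p) = freeAd K I (lieEval σ p) := by
  have e : lieRename K τ (FreeLieAlgebra.of K none) = FreeLieAlgebra.of K none := by
    simp [lieRename, h0]
  have e' : τ ∘ some = some ∘ σ := funext h1
  rw [lieEval_apply, lieSelf_ad_coe, LieHom.map_lie, lieToFree_lie, e, lieToFree_of,
    lieRename_rename, e', freeAd_apply, assRename_lieEval, lieEval_apply]

theorem lieEval_adFib {I : Type} [Finite I] (f : I → Fin k) (c b : Fin k)
    (m : (lieSelf K).obj (Fib f b)) :
    lieEval (Subtype.val : Fib (optFun f c) b → Option I) (adFib (lieSelf K) f c b m) =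
      if c = b then freeAd K I (lieEval (Subtype.val : Fib f b → I) m)
      else assRename K some (lieEval (Subtype.val : Fib f b → I) m) := by
  by_cases hb : c = b
  · rw [adFib_pos _ hb, lieEval_map, if_pos hb]
    exact lieEval_ad (Subtype.val : Fib f b → I) _ rfl (fun x => rfl) m
  · rw [adFib_neg _ hb, lieEval_map, if_neg hb, assRename_lieEval]
    rfl

/-- The commutator with the new letter is a derivation relative to the inclusion of the old letters.
By `derivation_symProd` it hits one factor at a time, just as `symAd` does. -/
theorem symmetrization_ad {I : Type} [Finite I] (a : SymPow (lieSelf K).toSModule k I) :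
    symmetrization k (Option I) (symAd a) = freeAd K I (symmetrization k I a) := by
  refine symPow_eq ((symmetrization k (Option I)).comp symAd)
    ((freeAd K I).comp (symmetrization k I)) (fun f m => ?_) a
  rw [LinearMap.comp_apply, LinearMap.comp_apply, symAd_sprod, map_sum, symmetrization_sprod,
    map_smul, derivation_symProd (assRename K some), Finset.smul_sum]
  · refine Finset.sum_congr rfl fun c _ => ?_
    rw [symmetrization_sprod]
    congr 2
    funext b
    rw [lieEval_adFib]
    by_cases hb : c = b
    · subst hb; simp
    · rw [if_neg hb, Function.update_of_ne (Ne.symm hb)]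
  -- The Leibniz rule for the commutator: the two middle terms cancel.
  · intro x y
    simp only [freeAd_apply, map_mul]
    noncomm_ring

theorem list_prod_mem_assPart {I : Type} {n : ℕ} (v : Fin n → FreeAlgebra K I)
    (s : Fin n → Multiset I) (h : ∀ b, v b ∈ assPart K (s b)) :
    (List.ofFn v).prod ∈ assPart K (∑ b, s b) := by
  induction n with
  | zero => simpa [assWord] using assWord_mem (K := K) ([] : List I)
  | succ n ih =>
    rw [List.ofFn_succ, List.prod_cons, Fin.sum_univ_succ]
    exact assPart_mul (h 0) (ih _ _ fun b => h _)

theorem lieToFree_mem_assPart {I : Type} {s : Multiset I} {a : FreeLieAlgebra K I}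
    (ha : a ∈ liePart K s) : lieToFree K I a ∈ assPart K s := by
  refine Submodule.span_induction (p := fun a _ => lieToFree K I a ∈ assPart K s)
    ?_ (by simp) (fun x y _ _ hx hy => by rw [map_add]; exact add_mem hx hy)
    (fun c x _ hx => by rw [map_smul]; exact Submodule.smul_mem _ _ hx) ha
  rintro _ ⟨w, rfl, rfl⟩
  exact lieToFree_word_mem w

theorem IsMultilinear.eq {I : Type} {s t : Multiset I} (hs : IsMultilinear s)
    (ht : IsMultilinear t) : s = t :=
  (Multiset.Nodup.ext hs.1 ht.1).2 fun x => ⟨fun _ => ht.2 x, fun _ => hs.2 x⟩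

theorem isMultilinear_univ (I : Type) [Fintype I] :
    IsMultilinear (Finset.univ : Finset I).val :=
  ⟨Finset.univ.nodup, fun x => Finset.mem_univ_val x⟩

/-- Keeps track of the exact multiset of letters, since these multisets add up when the factors of
different pieces are multiplied. -/
theorem lieEval_mem_assPart {A I : Type} [Fintype A] (σ : A → I) (p : (lieSelf K).obj A) :
    lieEval σ p ∈ assPart K ((Finset.univ : Finset A).val.map σ) := by
  rw [lieEval_apply]
  refine Submodule.span_induction
    (p := fun a _ => lieToFree K I (lieRename K σ a) ∈
      assPart K ((Finset.univ : Finset A).val.map σ))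
    ?_ (by simp) (fun x y _ _ hx hy => by rw [map_add, map_add]; exact add_mem hx hy)
    (fun c x _ hx => by rw [map_smul, map_smul]; exact Submodule.smul_mem _ _ hx) p.2
  rintro _ ⟨w, hw, rfl⟩
  rw [← hw.eq (isMultilinear_univ A)]
  exact lieToFree_mem_assPart (lieRename_word_mem σ w)

/-- The fibres partition `I`: an element `x` is counted once, namely at the position `σ⁻¹ (f x)`. -/
theorem isMultilinear_fibers {I : Type} [Fintype I] [DecidableEq I] (f : I → Fin k)
    (σ : Equiv.Perm (Fin k)) : IsMultilinear
      (∑ b, (Finset.univ : Finset (Fib f (σ b))).val.map (Subtype.val : Fib f (σ b) → I)) := by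
  have h : ∀ x, (∑ b, (Finset.univ : Finset (Fib f (σ b))).val.map
      (Subtype.val : Fib f (σ b) → I)).count x = 1 := by
    intro x
    rw [Multiset.count_sum', Finset.sum_eq_single (σ.symm (f x))]
    · exact Multiset.count_eq_one_of_mem
        ((Finset.univ.nodup).map Subtype.val_injective) (by simp)
    · intro b _ hb
      refine Multiset.count_eq_zero_of_notMem ?_
      simp only [Multiset.mem_map, not_exists, not_and]
      rintro ⟨y, hy⟩ _ rfl
      exact hb (by simp [hy])
    · simp
  exact ⟨Multiset.nodup_iff_count_le_one.2 fun x => (h x).le,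
    fun x => Multiset.count_pos.1 (by rw [h]; exact one_pos)⟩

theorem symmetrization_mem {I : Type} [Finite I] (a : SymPow (lieSelf K).toSModule k I) :
    symmetrization k I a ∈ assMultilinear K I := by
  classical
  have := Fintype.ofFinite I
  -- Membership becomes the vanishing of a linear map to the quotient, which can be tested on
  -- products.
  rw [← Submodule.Quotient.mk_eq_zero]
  refine symPow_eq ((assMultilinear K I).mkQ.comp (symmetrization k I)) 0 (fun f m => ?_) a
  rw [LinearMap.comp_apply, LinearMap.zero_apply, Submodule.mkQ_apply,
    Submodule.Quotient.mk_eq_zero, symmetrization_sprod, symProd_apply]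
  refine Submodule.smul_mem _ _ (sum_mem fun σ _ => ?_)
  exact assPart_le (isMultilinear_fibers f σ)
    (list_prod_mem_assPart _ _ fun b => lieEval_mem_assPart _ _)

variable (K) in
/-- Symmetrization is a morphism of infinitesimal bimodules from `Sym^k(Lie)` to `Ass⁺`. -/
def symmetrizationHom (k : ℕ) : InfBimodule.Hom ((InfBimodule.self (lie K)).symPow k)
    (InfBimodule.ofHom (lieToAssPlus K)) :=
  LieModule.bimoduleHom (V := (lieSelf K).symPow k)
    (fun I _ => (symmetrization k I).codRestrict (assMultilinear K I) symmetrization_mem)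
    (fun σ m => Subtype.ext (symmetrization_map σ m))
    (fun i m p => Subtype.ext (symmetrization_rcomp i m p))
    (fun {J} _ m => Subtype.ext (by
      refine (symmetrization_ad m).trans ?_
      -- In `Ass⁺` the operation `ad` is the commutator of the letters `false` and `true` with the
      -- given element substituted for `true`; `boolNone` then renames the remaining letter `false`
      -- to the new letter `none`.
      change _ = assRename K (InfBimodule.boolNone J) (assSubst K true (symmetrization k J m)
        (lieToFree K Bool ⁅FreeLieAlgebra.of K false, FreeLieAlgebra.of K true⁆))
      have h : assRename K (InfBimodule.boolNone J) (assSubst K true (symmetrization k J m)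
          (FreeAlgebra.ι K true)) = assRename K some (symmetrization k J m) := by
        rw [assSubst, FreeAlgebra.lift_ι_apply, plug_self]
        exact assRename_rename _ _ _
      have h' : assRename K (InfBimodule.boolNone J) (assSubst K true (symmetrization k J m)
          (FreeAlgebra.ι K false)) = FreeAlgebra.ι K none := by
        simp [assSubst, plug, assRename, InfBimodule.boolNone]
      rw [lieToFree_lie, lieToFree_of, lieToFree_of, map_sub, map_sub, map_mul, map_mul, map_mul,
        map_mul, h, h', freeAd_apply]))

end

end PBWOperad

/-! ### Injectivity: distributing the letters over tensor factors -/

namespace PBWOperad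

variable {K : Type u} [Field K]

section

open scoped TensorProduct DirectSum

variable {k : ℕ}

theorem list_prod_ofFn_eq_single {M : Type*} [Monoid M] {n : ℕ} (v : Fin n → M) (i : Fin n)
    (h : ∀ j, j ≠ i → v j = 1) : (List.ofFn v).prod = v i := by
  induction n with
  | zero => exact i.elim0
  | succ n ih =>
    rw [List.ofFn_succ, List.prod_cons]
    induction i using Fin.cases with
    | zero =>
      rw [List.prod_eq_one, mul_one]
      intro x hx
      obtain ⟨j, rfl⟩ := List.mem_ofFn.1 hx
      exact h _ (Fin.succ_ne_zero j)
    | succ i =>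
      rw [h 0 (Fin.succ_ne_zero i).symm, one_mul,
        ih (fun j => v j.succ) i fun j hj => h _ (by simpa using hj)]

variable (K) in
/-- The element `1 ⊗ ⋯ ⊗ a ⊗ ⋯ ⊗ 1`. -/
abbrev tensorSingle (I : Type) (b : Fin k) :
    FreeAlgebra K I →ₐ[K] ⨂[K] _ : Fin k, FreeAlgebra K I :=
  PiTensorProduct.singleAlgHom (R := K) (A := fun _ : Fin k => FreeAlgebra K I) b

/-- This commutation is what kills brackets between Lie polynomials placed in different tensor
factors. -/
theorem tensorSingle_comm {I : Type} {b c : Fin k} (h : b ≠ c) (x y : FreeAlgebra K I) :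
    tensorSingle K I b x * tensorSingle K I c y = tensorSingle K I c y * tensorSingle K I b x :=
  _root_.Commute.tprod
    (Pi.mulSingle_commute (f := fun _ : Fin k => FreeAlgebra K I) h x y)

/-- The factors occupy pairwise different tensor positions, so the order `ρ` of multiplication is
irrelevant. Hence all words of a symmetrized product acquire the same image. -/
theorem tensorSingle_prod {I : Type} (a : Fin k → FreeAlgebra K I) (ρ : Equiv.Perm (Fin k)) :
    (List.ofFn fun j => tensorSingle K I (ρ j) (a (ρ j))).prod = PiTensorProduct.tprod K a := by
  have h : (List.ofFn fun j => (Pi.mulSingle (ρ j) (a (ρ j)) : Fin k → FreeAlgebra K I)).prod =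
      a := by
    funext b
    refine (map_list_prod (Pi.evalMonoidHom (fun _ : Fin k => FreeAlgebra K I) b) _).trans ?_
    -- In the coordinate `b` only the entry at position `ρ⁻¹ b` differs from `1`.
    rw [List.map_ofFn, list_prod_ofFn_eq_single _ (ρ.symm b)]
    · simp
    · intro j hj
      have : b ≠ ρ j := fun e => hj (by simp [e])
      simp [Pi.mulSingle_eq_of_ne this]
  conv_rhs => rw [← h]
  refine Eq.trans ?_ (map_list_prod (PiTensorProduct.tprodMonoidHom K
    (A := fun _ : Fin k => FreeAlgebra K I)) _).symm
  rw [List.map_ofFn]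
  rfl

variable (K) in
/-- The algebra map sending the letter `x` to `σ x` in the tensor factor `h x`. -/
def deshuffle {A I : Type} (σ : A → I) (h : A → Fin k) :
    FreeAlgebra K A →ₐ[K] ⨂[K] _ : Fin k, FreeAlgebra K I :=
  FreeAlgebra.lift K fun x => tensorSingle K I (h x) (FreeAlgebra.ι K (σ x))

theorem deshuffle_rename {A I : Type} (σ : A → I) (g : I → Fin k) (a : FreeAlgebra K A) :
    deshuffle K id g (assRename K σ a) = deshuffle K σ (g ∘ σ) a := by
  change ((deshuffle K id g).comp (assRename K σ)) a = _
  congr 1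
  ext x
  simp [deshuffle, assRename]

theorem deshuffle_const {A I : Type} (σ : A → I) {h : A → Fin k} {b : Fin k} (hb : ∀ x, h x = b)
    (a : FreeAlgebra K A) : deshuffle K σ h a = tensorSingle K I b (assRename K σ a) := by
  change _ = ((tensorSingle K I b).comp (assRename K σ)) a
  congr 1
  ext x
  simp only [deshuffle, assRename, Function.comp_apply, AlgHom.comp_apply,
    FreeAlgebra.lift_ι_apply, hb]

/-- Unlike `deshuffle_const`, this constrains `h` only on the letters that occur in `w`, as the
induction on subwords in `deshuffle_lieWord_eq_zero` requires. -/
theorem deshuffle_lieWord_const {A I : Type} (σ : A → I) (h : A → Fin k) {b : Fin k}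
    (w : FreeMagma A) (hw : ∀ x ∈ letters w, h x = b) :
    deshuffle K σ h (lieToFree K A (lieWord K w)) =
      tensorSingle K I b (assRename K σ (lieToFree K A (lieWord K w))) := by
  induction w with
  | ih1 x =>
    have := hw x (by simp [letters])
    rw [lieWord, lieToFree_of, deshuffle, FreeAlgebra.lift_ι_apply, this, assRename_ι]
  | ih2 v w hv hw' =>
    change ∀ x ∈ letters v + letters w, h x = b at hw
    change deshuffle K σ h (lieToFree K A ⁅lieWord K v, lieWord K w⁆) =
      tensorSingle K I b (assRename K σ (lieToFree K A ⁅lieWord K v, lieWord K w⁆))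
    rw [lieToFree_lie]
    simp only [map_sub, map_mul]
    rw [hv fun x hx => hw x (Multiset.mem_add.2 (.inl hx)),
      hw' fun x hx => hw x (Multiset.mem_add.2 (.inr hx))]

/-- In a bracket `[v, w]`, either one half already has letters in several pieces and vanishes by
induction, or each half lies in a single tensor factor. These two factors differ, since the whole
word is not in one piece; hence the halves commute and their commutator is zero. -/
theorem deshuffle_lieWord_eq_zero {A I : Type} (σ : A → I) (h : A → Fin k) (w : FreeMagma A)
    (hw : ∀ b, ∃ x ∈ letters w, h x ≠ b) :
    deshuffle K σ h (lieToFree K A (lieWord K w)) = 0 := by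
  induction w with
  | ih1 x =>
    obtain ⟨y, hy, hne⟩ := hw (h x)
    simp only [letters, Multiset.mem_singleton] at hy
    exact (hne (hy ▸ rfl)).elim
  | ih2 v w hv hw' =>
    change deshuffle K σ h (lieToFree K A ⁅lieWord K v, lieWord K w⁆) = 0
    rw [lieToFree_lie, map_sub, map_mul, map_mul]
    by_cases h1 : ∀ b, ∃ x ∈ letters v, h x ≠ b
    · rw [hv h1, zero_mul, mul_zero, sub_zero]
    by_cases h2 : ∀ b, ∃ x ∈ letters w, h x ≠ b
    · rw [hw' h2, zero_mul, mul_zero, sub_zero]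
    push Not at h1 h2
    obtain ⟨b, hb⟩ := h1
    obtain ⟨c, hc⟩ := h2
    have hbc : b ≠ c := by
      rintro rfl
      obtain ⟨x, hx, hne⟩ := hw b
      rcases Multiset.mem_add.1 (show x ∈ letters v + letters w from hx) with hx | hx
      · exact hne (hb x hx)
      · exact hne (hc x hx)
    rw [deshuffle_lieWord_const σ h v hb, deshuffle_lieWord_const σ h w hc,
      tensorSingle_comm hbc, sub_self]

theorem deshuffle_lieEval_const {A I : Type} [Finite A] (σ : A → I) (g : I → Fin k) {b : Fin k}
    (hb : ∀ x, g (σ x) = b) (p : (lieSelf K).obj A) :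
    deshuffle K id g (lieEval σ p) = tensorSingle K I b (lieEval σ p) :=
  (deshuffle_rename σ g _).trans (deshuffle_const σ hb _)

theorem deshuffle_lieEval_eq_zero {A I : Type} [Finite A] (σ : A → I) (g : I → Fin k)
    (hg : ∀ b, ∃ x, g (σ x) ≠ b) (p : (lieSelf K).obj A) :
    deshuffle K id g (lieEval σ p) = 0 := by
  refine (deshuffle_rename σ g _).trans ?_
  change deshuffle K σ (g ∘ σ) (lieToFree K A p.1) = 0
  refine Submodule.span_induction
    (p := fun a _ => deshuffle K σ (g ∘ σ) (lieToFree K A a) = 0) ?_ (by simp)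
    (fun x y _ _ hx hy => by rw [map_add, map_add, hx, hy, add_zero])
    (fun c x _ hx => by rw [map_smul, map_smul, hx, smul_zero]) p.2
  rintro _ ⟨w, hw, rfl⟩
  refine deshuffle_lieWord_eq_zero σ _ w fun b => ?_
  obtain ⟨x, hx⟩ := hg b
  exact ⟨x, hw.2 x, hx⟩

theorem lieEval_injective {A I : Type} [Finite A] {σ : A → I} (hσ : Function.Injective σ) :
    Function.Injective (lieEval σ : (lieSelf K).obj A →ₗ[K] FreeAlgebra K I) := by
  rw [← LinearMap.ker_eq_bot, LinearMap.ker_eq_bot']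
  intro p hp
  refine lieToFree_injOn p ?_
  -- The left inverse `Function.invFun` of the renaming requires a nonempty source; the empty case
  -- is `Lie(∅) = 0`.
  cases isEmpty_or_nonempty A with
  | inl hA => rw [lieMultilinear_of_isEmpty p.2, map_zero]
  | inr hA =>
    have h := assRename_lieEval σ (Function.invFun σ) p
    have hid : lieEval id p = lieToFree K A p.1 := by
      rw [lieEval_apply]
      have : lieRename K id = (LieHom.id : FreeLieAlgebra K A →ₗ⁅K⁆ FreeLieAlgebra K A) := by
        ext x; simp [lieRename]
      rw [this]
      rfl
    rw [hp, map_zero, Function.invFun_comp hσ, hid] at h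
    exact h.symm

/-- Over a field every injective linear map splits. The splitting is an arbitrary choice with no
naturality, which is harmless: in the computations below its values matter only on polynomials of
Lie operations and on zero. -/
theorem exists_lieRetract {A I : Type} [Finite A] {σ : A → I} (hσ : Function.Injective σ) :
    ∃ R : FreeAlgebra K I →ₗ[K] (lieSelf K).obj A, ∀ p, R (lieEval σ p) = p := by
  obtain ⟨R, hR⟩ := LinearMap.exists_leftInverse_of_injective
    (lieEval σ : (lieSelf K).obj A →ₗ[K] FreeAlgebra K I)
    (LinearMap.ker_eq_bot.2 (lieEval_injective hσ))
  exact ⟨R, fun p => LinearMap.congr_fun hR p⟩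

/-- A linear retraction of the free associative algebra onto the Lie operations with inputs in a
fibre. -/
def lieRetract {I : Type} [Finite I] (g : I → Fin k) (b : Fin k) :
    FreeAlgebra K I →ₗ[K] (lieSelf K).obj (Fib g b) :=
  (exists_lieRetract (K := K) (σ := (Subtype.val : Fib g b → I)) Subtype.val_injective).choose

theorem lieRetract_lieEval {I : Type} [Finite I] (g : I → Fin k) (b : Fin k)
    (p : (lieSelf K).obj (Fib g b)) :
    lieRetract g b (lieEval (Subtype.val : Fib g b → I) p) = p :=
  (exists_lieRetract (K := K) (σ := (Subtype.val : Fib g b → I))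
    Subtype.val_injective).choose_spec p

/-- The component in `Sym^k(Lie)` belonging to a decomposition `g`. -/
def symComponent {I : Type} [Finite I] (g : I → Fin k) :
    FreeAlgebra K I →ₗ[K] SymPow (lieSelf K).toSModule k I :=
  (PiTensorProduct.lift ((sprod (lieSelf K).toSModule g).compLinearMap (lieRetract g))).comp
    (deshuffle K id g).toLinearMap

/-- When `g` is `f` with its pieces renumbered by `τ`, the factor `b` lands entirely in the tensor
position `τ b`. All `k!` words become the same pure tensor, and its product over `g` equals the
original product over `f` in the coinvariants. -/
theorem symComponent_of_perm {I : Type} [Finite I] {f g : I → Fin k} (τ : Equiv.Perm (Fin k))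
    (h : ∀ x, g x = τ (f x)) (m : ∀ b, (lieSelf K).obj (Fib f b)) :
    symComponent g (symProd K (FreeAlgebra K I) k
      fun b => lieEval (Subtype.val : Fib f b → I) (m b)) =
      (k.factorial : K) • sprod (lieSelf K).toSModule f m := by
  set a : Fin k → FreeAlgebra K I := fun b => lieEval (Subtype.val : Fib f b → I) (m b) with ha
  have h1 : deshuffle K id g (symProd K (FreeAlgebra K I) k a) =
      (k.factorial : K) • PiTensorProduct.tprod K fun b => a (τ.symm b) := by
    have h2 : ∀ b, deshuffle K id g (a b) = tensorSingle K I (τ b) (a b) := fun b =>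
      deshuffle_lieEval_const _ _ (fun x => by rw [h, x.2]) _
    rw [map_symProd, symProd_apply]
    simp only [h2]
    -- The word belonging to `σ` multiplies the tensor factors in the order `τ ∘ σ`, which
    -- `tensorSingle_prod` ignores.
    rw [Finset.sum_congr rfl fun σ _ =>
      show _ = PiTensorProduct.tprod K fun b => a (τ.symm b) from ?_]
    · rw [Finset.sum_const, Finset.card_univ, Fintype.card_perm, Fintype.card_fin,
        Nat.cast_smul_eq_nsmul]
    · rw [← tensorSingle_prod (fun b => a (τ.symm b)) (σ.trans τ)]
      simp
  rw [symComponent, LinearMap.comp_apply, AlgHom.toLinearMap_apply, h1, map_smul,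
    PiTensorProduct.lift.tprod, MultilinearMap.compLinearMap_apply]
  congr 1
  symm
  refine sprod_eq (σ := τ) h fun b => ?_
  rw [τ.symm_apply_apply]
  have : a b = lieEval (Subtype.val : Fib g (τ b) → I)
      ((lieSelf K).map (fibPerm h b) (m b)) := by
    rw [lieEval_map]
    rfl
  rw [this]
  exact lieRetract_lieEval _ _ _

/-- If `g` does not factor through `f`, some piece of `f` meets several pieces of `g`. The Lie
polynomial on that piece is killed by `deshuffle`, and with it the whole symmetrized product. -/
theorem symComponent_eq_zero {l : ℕ} {I : Type} [Finite I] {f : I → Fin l} {g : I → Fin k}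
    (h : ¬∃ τ : Fin l → Fin k, ∀ x, g x = τ (f x)) (m : ∀ b, (lieSelf K).obj (Fib f b)) :
    symComponent g (symProd K (FreeAlgebra K I) l
      fun b => lieEval (Subtype.val : Fib f b → I) (m b)) = 0 := by
  -- Otherwise `g` is constant on every fibre of `f`, and choosing its values on the fibres gives a
  -- factorization.
  obtain ⟨b, hb⟩ : ∃ b, ∀ c, ∃ x : Fib f b, g x.1 ≠ c := by
    by_contra! h'
    choose τ hτ using h'
    exact h ⟨τ, fun x => hτ (f x) ⟨x, rfl⟩⟩
  rw [symComponent, LinearMap.comp_apply, AlgHom.toLinearMap_apply, map_symProd,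
    MultilinearMap.map_coord_zero _ b, map_zero]
  exact deshuffle_lieEval_eq_zero _ _ hb _

variable (K) in
/-- The sum of the components belonging to the decompositions into nonempty pieces. -/
def symProjection (k : ℕ) (I : Type) [Finite I] :
    FreeAlgebra K I →ₗ[K] SymPow (lieSelf K).toSModule k I :=
  letI := Fintype.ofFinite {g : I → Fin k // Function.Surjective g}
  ∑ g : {g : I → Fin k // Function.Surjective g}, symComponent g.1

/-- A surjective `g` factoring through `f` would yield a surjection from `Fin l` onto the larger set
`Fin k`. -/
theorem symProjection_symProd_of_lt {l : ℕ} (hl : l < k) {I : Type} [Finite I] (f : I → Fin l)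
    (m : ∀ b, (lieSelf K).obj (Fib f b)) :
    symProjection K k I (symProd K (FreeAlgebra K I) l
      fun b => lieEval (Subtype.val : Fib f b → I) (m b)) = 0 := by
  rw [symProjection, LinearMap.sum_apply]
  refine Finset.sum_eq_zero fun g _ => symComponent_eq_zero ?_ m
  rintro ⟨τ, hτ⟩
  have hs : Function.Surjective τ := fun c => by
    obtain ⟨x, rfl⟩ := g.2 c
    exact ⟨f x, (hτ x).symm⟩
  have := Fintype.card_le_of_surjective τ hs
  simp only [Fintype.card_fin] at this
  omega

/-- An empty piece carries an element of `Lie(∅) = 0`. This is why only surjective decompositions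
matter. -/
theorem sprod_eq_zero_of_not_surjective {I : Type} [Finite I] {f : I → Fin k}
    (hf : ¬Function.Surjective f) (m : ∀ b, (lieSelf K).obj (Fib f b)) :
    sprod (lieSelf K).toSModule f m = 0 := by
  simp only [Function.Surjective, not_forall, not_exists] at hf
  obtain ⟨b, hb⟩ := hf
  have : IsEmpty (Fib f b) := ⟨fun x => hb x.1 x.2⟩
  exact MultilinearMap.map_coord_zero _ b (Subtype.ext (lieMultilinear_of_isEmpty (m b).2))

/-- The surjective `g` with a nonzero contribution are the `τ ∘ f` with `τ` surjective, hence a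
permutation. There are `k!` of them, and each contributes `k!` times the product by
`symComponent_of_perm`. -/
theorem symProjection_symProd {I : Type} [Finite I] (f : I → Fin k) (hf : Function.Surjective f)
    (m : ∀ b, (lieSelf K).obj (Fib f b)) :
    symProjection K k I (symProd K (FreeAlgebra K I) k
      fun b => lieEval (Subtype.val : Fib f b → I) (m b)) =
      (k.factorial : K) • (k.factorial : K) • sprod (lieSelf K).toSModule f m := by
  classical
  rw [symProjection, LinearMap.sum_apply]
  rw [← Finset.sum_of_injOn (s := (Finset.univ : Finset (Equiv.Perm (Fin k))))
    (f := fun _ => (k.factorial : K) • sprod (lieSelf K).toSModule f m)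
    (fun τ => ⟨fun x => τ (f x), τ.surjective.comp hf⟩)]
  · rw [Finset.sum_const, Finset.card_univ, Fintype.card_perm, Fintype.card_fin,
      Nat.cast_smul_eq_nsmul, Nat.cast_smul_eq_nsmul]
  -- Different permutations give different `τ ∘ f`, since `f` reaches every index.
  · intro τ _ τ' _ h
    ext b
    obtain ⟨x, rfl⟩ := hf b
    exact congrArg Fin.val (congrFun (congrArg Subtype.val h) x)
  · intro τ _
    simp
  · intro g _ hg'
    refine symComponent_eq_zero ?_ m
    rintro ⟨τ, hτ⟩
    have hs : Function.Surjective τ := fun c => by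
      obtain ⟨x, rfl⟩ := g.2 c
      exact ⟨f x, (hτ x).symm⟩
    exact hg' ⟨Equiv.ofBijective τ (Finite.surjective_iff_bijective.1 hs), by simp,
      Subtype.ext (funext fun x => (hτ x).symm)⟩
  · intro τ _
    exact (symComponent_of_perm τ (fun _ => rfl) m).symm

theorem symProjection_symmetrization_of_lt {l : ℕ} (hl : l < k) {I : Type} [Finite I]
    (a : SymPow (lieSelf K).toSModule l I) :
    symProjection K k I (symmetrization l I a) = 0 := by
  refine symPow_eq ((symProjection K k I).comp (symmetrization l I)) 0 (fun f m => ?_) a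
  rw [LinearMap.comp_apply, symmetrization_sprod, map_smul, symProjection_symProd_of_lt hl,
    smul_zero, LinearMap.zero_apply]

/-- One of the two factors `k!` cancels against the normalization of symmetrization. Decompositions
with an empty piece contribute zero on both sides. -/
theorem symProjection_symmetrization [CharZero K] {I : Type} [Finite I]
    (a : SymPow (lieSelf K).toSModule k I) :
    symProjection K k I (symmetrization k I a) = (k.factorial : K) • a := by
  refine symPow_eq ((symProjection K k I).comp (symmetrization k I))
    ((k.factorial : K) • LinearMap.id) (fun f m => ?_) a
  rw [LinearMap.comp_apply, LinearMap.smul_apply, LinearMap.id_apply]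
  by_cases hf : Function.Surjective f
  · rw [symmetrization_sprod, map_smul, symProjection_symProd f hf, smul_smul,
      inv_mul_cancel₀ (Nat.cast_ne_zero.2 k.factorial_ne_zero), one_smul]
  · rw [sprod_eq_zero_of_not_surjective hf, map_zero, map_zero, smul_zero]

theorem eq_zero_of_symProjection_symmetrization [CharZero K] {I : Type} [Finite I]
    {a : SymPow (lieSelf K).toSModule k I}
    (h : symProjection K k I (symmetrization k I a) = 0) : a = 0 := by
  have hf : (k.factorial : K) ≠ 0 := Nat.cast_ne_zero.2 k.factorial_ne_zero
  rw [← inv_smul_smul₀ hf a, ← symProjection_symmetrization, h, smul_zero]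

end

end PBWOperad

/-! ### Surjectivity: straightening products of brackets -/

namespace PBWOperad

variable {K : Type u} [Field K]

section

variable {k : ℕ}

variable (K) in
/-- The product of the associative polynomials of a list of iterated brackets. -/
def bracketProd {I : Type} (L : List (FreeMagma I)) : FreeAlgebra K I :=
  (L.map fun w => lieToFree K I (lieWord K w)).prod

theorem bracketProd_append {I : Type} (L L' : List (FreeMagma I)) :
    bracketProd K (L ++ L') = bracketProd K L * bracketProd K L' := by
  simp [bracketProd]

theorem bracketProd_cons {I : Type} (w : FreeMagma I) (L : List (FreeMagma I)) :
    bracketProd K (w :: L) = lieToFree K I (lieWord K w) * bracketProd K L := by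
  simp [bracketProd]

/-- Only the realization of a bracket as a renamed operation is wanted from `lie_induction_aux`, so
the predicate there is trivial. Describing the letters by a predicate `q` makes the input set
literally a fibre `Fib f b` when `q x` is `f x = b`. -/
theorem exists_operation_of_word {I : Type} (w : FreeMagma I) (hw : (letters w).Nodup)
    (q : I → Prop) [Finite {x // q x}] (hq : ∀ x, x ∈ letters w ↔ q x) :
    ∃ p : (lieSelf K).obj {x // q x},
      lieEval (Subtype.val : {x // q x} → I) p = lieToFree K I (lieWord K w) := by
  obtain ⟨A, _, φ, a, hφ, hA, -, ea⟩ := lie_induction_aux (K := K) (fun _ _ _ => True) trivial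
    (fun _ _ _ _ => trivial) w hw
  let e : A ≃ {x // q x} := Equiv.ofBijective (fun y => ⟨φ y, (hq _).1 ((hA _).2 ⟨y, rfl⟩)⟩)
    ⟨fun y z h => hφ (congrArg Subtype.val h), fun x => by
      obtain ⟨y, hy⟩ := (hA x.1).1 ((hq _).2 x.2)
      exact ⟨y, Subtype.ext hy⟩⟩
  refine ⟨(lieSelf K).map e a, ?_⟩
  rw [← ea]
  exact (lieEval_map e Subtype.val _).trans (lieEval_apply _ _)

/-- Multilinearity puts every element of `I` into exactly one of the brackets, and `f` records which
one. This passes from lists of brackets to decompositions with operations on the pieces. -/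
theorem exists_decomposition {I : Type} [Finite I] (v : Fin k → FreeMagma I)
    (hv : IsMultilinear (∑ b, letters (v b))) :
    ∃ (f : I → Fin k) (m : ∀ b, (lieSelf K).obj (Fib f b)),
      ∀ b, lieEval (Subtype.val : Fib f b → I) (m b) = lieToFree K I (lieWord K (v b)) := by
  classical
  have h1 : ∀ x, ∃ b, x ∈ letters (v b) := fun x => by
    simpa [Multiset.mem_sum] using hv.2 x
  choose f hf using h1
  have h2 : ∀ x b, x ∈ letters (v b) ↔ f x = b := by
    intro x b
    refine ⟨fun h => ?_, fun h => h ▸ hf x⟩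
    -- A letter occurring in two different brackets would have multiplicity at least two in the sum.
    by_contra hne
    have h3 := Multiset.nodup_iff_count_le_one.1 hv.1 x
    rw [Multiset.count_sum'] at h3
    have h4 : ∑ c ∈ {f x, b}, (letters (v c)).count x ≤ ∑ c, (letters (v c)).count x :=
      Finset.sum_le_sum_of_subset (Finset.subset_univ _)
    rw [Finset.sum_pair hne] at h4
    have h5 := Multiset.count_pos.2 (hf x)
    have h6 := Multiset.count_pos.2 h
    omega
  have h7 : ∀ b, (letters (v b)).Nodup := fun b => Multiset.nodup_of_le
    (Finset.single_le_sum (f := fun b => letters (v b)) (fun _ _ => Multiset.zero_le _)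
      (Finset.mem_univ b)) hv.1
  choose m hm using fun b => exists_operation_of_word (K := K) (v b) (h7 b) (fun x => f x = b)
    fun x => h2 x b
  exact ⟨f, m, hm⟩

variable (K) in
/-- The span of the images of the symmetric powers of `Lie`. -/
def symRange (I : Type) [Finite I] : Submodule K (FreeAlgebra K I) :=
  ⨆ k, LinearMap.range (symmetrization (K := K) k I)

theorem symProd_mem_symRange [CharZero K] {I : Type} [Finite I] (v : Fin k → FreeMagma I)
    (hv : IsMultilinear (∑ b, letters (v b))) :
    symProd K (FreeAlgebra K I) k (fun b => lieToFree K I (lieWord K (v b))) ∈ symRange K I := by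
  obtain ⟨f, m, hm⟩ := exists_decomposition (K := K) v hv
  refine le_iSup (fun k => LinearMap.range (symmetrization (K := K) k I)) k
    ⟨(k.factorial : K) • sprod (lieSelf K).toSModule f m, ?_⟩
  rw [map_smul, symmetrization_sprod, smul_smul,
    mul_inv_cancel₀ (Nat.cast_ne_zero.2 k.factorial_ne_zero), one_smul]
  simp only [hm]

/-- A permutation is a chain of adjacent interchanges, and interchanging adjacent factors `y`, `x`
changes the product by one in which `y`, `x` are replaced by the single factor `[y, x]`. That
shorter product is covered by `ih`. The prefix `pre` is carried along because `List.Perm` adds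
common leading entries one at a time. -/
theorem bracketProd_sub_mem {I : Type} [Finite I] {n : ℕ}
    (ih : ∀ L : List (FreeMagma I), L.length < n → IsMultilinear (L.map letters).sum →
      bracketProd K L ∈ symRange K I) {L L' : List (FreeMagma I)} (h : L.Perm L') :
    ∀ pre : List (FreeMagma I), (pre ++ L).length = n →
      IsMultilinear ((pre ++ L).map letters).sum →
      bracketProd K (pre ++ L) - bracketProd K (pre ++ L') ∈ symRange K I := by
  induction h with
  | nil => intro pre _ _; simp
  | cons x _ ih' =>
    intro pre hn hm
    simpa using ih' (pre ++ [x]) (by simpa using hn) (by simpa using hm)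
  | swap x y l =>
    intro pre hn hm
    -- The two brackets are merged into one: the letters are unchanged and the number of factors
    -- drops by one.
    have h := ih (pre ++ FreeMagma.mul y x :: l) (by simp at hn ⊢; omega) (by
      have e : letters (y * x) = letters y + letters x := rfl
      simpa [e, add_assoc] using hm)
    have e : lieWord K (FreeMagma.mul y x) = ⁅lieWord K y, lieWord K x⁆ := rfl
    rw [bracketProd_append, bracketProd_cons, e, lieToFree_lie] at h
    simp only [bracketProd_append, bracketProd_cons]
    convert h using 1
    noncomm_ring
  | trans h1 h2 ih1 ih2 =>
    intro pre hn hm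
    have hp := (h1.append_left pre)
    have := add_mem (ih1 pre hn hm) (ih2 pre (hp.length_eq ▸ hn)
      ((hp.map letters).sum_eq ▸ hm))
    simpa using this

/-- Induction on the number of factors. Every reordering of `L` agrees with `L` modulo `symRange`,
so `n!` times the product agrees with the symmetrized product, which is itself in `symRange`; then
one divides by `n!`. -/
theorem bracketProd_mem [CharZero K] {I : Type} [Finite I] (n : ℕ) :
    ∀ L : List (FreeMagma I), L.length = n → IsMultilinear (L.map letters).sum →
      bracketProd K L ∈ symRange K I := by
  induction n using Nat.strong_induction_on with
  | _ n ih =>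
  rintro L rfl hm
  have h1 : ∑ b, letters (L.get b) = (L.map letters).sum := by
    rw [← List.sum_ofFn]
    change (List.ofFn (letters ∘ L.get)).sum = _
    rw [← List.map_ofFn, List.ofFn_get]
  have h2 := symProd_mem_symRange (K := K) L.get (h1 ▸ hm)
  have h3 : ∀ σ : Equiv.Perm (Fin L.length),
      (List.ofFn fun j => lieToFree K I (lieWord K (L.get (σ j)))).prod =
        bracketProd K (List.ofFn fun j => L.get (σ j)) := fun σ => by
    rw [bracketProd, List.map_ofFn]
    rfl
  have h4 : ∀ σ : Equiv.Perm (Fin L.length),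
      bracketProd K L - bracketProd K (List.ofFn fun j => L.get (σ j)) ∈ symRange K I := by
    intro σ
    have hp : L.Perm (List.ofFn fun j => L.get (σ j)) := by
      have := Equiv.Perm.ofFn_comp_perm σ L.get
      rw [List.ofFn_get] at this
      exact this.symm
    exact bracketProd_sub_mem (fun L' hL' => ih _ hL' L' rfl) hp [] rfl hm
  -- The differences `h4`, summed over all permutations, are added to the symmetrized product `h2`;
  -- the permuted words cancel and `n!` copies of the product of `L` remain.
  have h5 : (L.length.factorial : K) • bracketProd K L ∈ symRange K I := by
    have := add_mem (sum_mem fun σ (_ : σ ∈ Finset.univ) => h4 σ) h2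
    rw [symProd_apply] at this
    simp only [h3] at this
    rw [← Finset.sum_add_distrib] at this
    simp only [sub_add_cancel] at this
    rwa [Finset.sum_const, Finset.card_univ, Fintype.card_perm, Fintype.card_fin,
      ← Nat.cast_smul_eq_nsmul K] at this
  have h6 := Submodule.smul_mem _ (L.length.factorial : K)⁻¹ h5
  rwa [smul_smul, inv_mul_cancel₀ (Nat.cast_ne_zero.2 L.length.factorial_ne_zero),
    one_smul] at h6

theorem sum_letters_of {I : Type} (w : List I) :
    ((w.map FreeMagma.of).map letters).sum = (w : Multiset I) := by
  induction w with
  | nil => rfl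
  | cons x w ih =>
    rw [List.map_cons, List.map_cons, List.sum_cons, ih]
    exact Multiset.singleton_add x _

/-- A word is the product of its letters, each regarded as a bracket of length one. -/
theorem assMultilinear_le_symRange [CharZero K] (I : Type) [Finite I] :
    assMultilinear K I ≤ symRange K I := by
  refine Submodule.span_le.2 ?_
  rintro _ ⟨w, hw, rfl⟩
  have h := bracketProd_mem (K := K) _ (w.map FreeMagma.of) rfl (by
    rwa [sum_letters_of])
  have e : bracketProd K (w.map FreeMagma.of) = assWord K w := by
    rw [bracketProd, List.map_map, assWord]
    congr 1
    refine List.map_congr_left fun x _ => ?_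
    exact lieToFree_of x
  rwa [e] at h

end

/-! ### Morphisms out of direct sums, and bijective morphisms -/

section DirectSum

open scoped DirectSum

namespace InfBimodule

variable {P : Operad K}

open Classical in
/-- The morphism from a direct sum given by morphisms on the summands. -/
def directSumHom {ι : Type} {M : ι → InfBimodule P} {N : InfBimodule P}
    (F : ∀ k, Hom (M k) N) : Hom (directSum M) N where
  app I _ := DirectSum.toModule K ι (N.obj I) fun k => (F k).app I
  app_map {I J} _ _ σ m := by
    refine LinearMap.congr_fun
      (f := (DirectSum.toModule K ι (N.obj J) fun k => (F k).app J).comp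
        (DirectSum.lmap fun k => (M k).map σ))
      (g := (N.map σ).comp (DirectSum.toModule K ι (N.obj I) fun k => (F k).app I))
      (DirectSum.linearMap_ext K fun k => LinearMap.ext fun a => ?_) m
    simp [DirectSum.lmap_lof, (F k).app_map]
  app_lcomp {I J} _ _ i p m := by
    refine LinearMap.congr_fun
      (f := (DirectSum.toModule K ι (N.obj _) fun k => (F k).app _).comp
        (DirectSum.lmap fun k => (M k).lcomp i p))
      (g := (N.lcomp i p).comp (DirectSum.toModule K ι (N.obj J) fun k => (F k).app J))
      (DirectSum.linearMap_ext K fun k => LinearMap.ext fun a => ?_) m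
    simp [DirectSum.lmap_lof, (F k).app_lcomp]
  app_rcomp {I J} _ _ i m p := by
    refine LinearMap.congr_fun
      (f := (DirectSum.toModule K ι (N.obj _) fun k => (F k).app _).comp
        (DirectSum.lmap fun k => ((M k).rcomp i).flip p))
      (g := ((N.rcomp i).flip p).comp (DirectSum.toModule K ι (N.obj I) fun k => (F k).app I))
      (DirectSum.linearMap_ext K fun k => LinearMap.ext fun a => ?_) m
    simp [DirectSum.lmap_lof, (F k).app_rcomp]

/-- A bijective morphism is an isomorphism, from the target to the source. -/
def isoOfBijective {M N : InfBimodule P} (F : Hom M N)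
    (h : ∀ (I : Type) [Finite I], Function.Bijective (F.app I)) : Iso N M where
  inv := F
  hom :=
    { app := fun I _ => (LinearEquiv.ofBijective (F.app I) (h I)).symm.toLinearMap
      app_map := fun {I J} _ _ σ n => by
        -- Every element of the target has the form `F m`, so the compatibilities of the inverse are
        -- those of `F` read backwards.
        obtain ⟨m, rfl⟩ := (h I).2 n
        rw [← F.app_map]
        exact ((LinearEquiv.ofBijective (F.app J) (h J)).symm_apply_apply _).trans
          (congrArg _ ((LinearEquiv.ofBijective (F.app I) (h I)).symm_apply_apply m).symm)
      app_lcomp := fun {I J} _ _ i p n => by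
        obtain ⟨m, rfl⟩ := (h J).2 n
        rw [← F.app_lcomp]
        exact ((LinearEquiv.ofBijective (F.app _) (h _)).symm_apply_apply _).trans
          (congrArg _ ((LinearEquiv.ofBijective (F.app J) (h J)).symm_apply_apply m).symm)
      app_rcomp := fun {I J} _ _ i n p => by
        obtain ⟨m, rfl⟩ := (h I).2 n
        rw [← F.app_rcomp]
        exact ((LinearEquiv.ofBijective (F.app _) (h _)).symm_apply_apply _).trans
          (congrArg (M.rcomp i · p)
            ((LinearEquiv.ofBijective (F.app I) (h I)).symm_apply_apply m).symm) }
  hom_inv I _ n := (LinearEquiv.ofBijective (F.app I) (h I)).apply_symm_apply n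
  inv_hom I _ m := (LinearEquiv.ofBijective (F.app I) (h I)).symm_apply_apply m

end InfBimodule

end DirectSum

end PBWOperad

namespace PBWOperad

variable {K : Type u} [Field K]

/-! ### Composing, projecting and lifting morphisms -/

namespace InfBimodule

open scoped DirectSum

variable {P Q : Operad K} {M N L : InfBimodule P}

/-- The composite of two morphisms. -/
def Hom.comp (G : Hom N L) (F : Hom M N) : Hom M L where
  app I _ := (G.app I).comp (F.app I)
  app_map σ m := by simp [F.app_map, G.app_map]
  app_lcomp i p m := by simp [F.app_lcomp, G.app_lcomp]
  app_rcomp i m p := by simp [F.app_rcomp, G.app_rcomp]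

/-- The projection of a direct sum onto a summand. -/
def directSumProj {ι : Type} (M : ι → InfBimodule P) (k : ι) : Hom (directSum M) (M k) where
  app I _ := DirectSum.component K ι (fun k => (M k).obj I) k
  app_map σ m := DirectSum.lmap_apply (fun k => (M k).map σ) m k
  app_lcomp i p m := DirectSum.lmap_apply (fun k => (M k).lcomp i p) m k
  app_rcomp i m p := DirectSum.lmap_apply (fun k => ((M k).rcomp i).flip p) m k

open Classical in
theorem directSumHom_lof {ι : Type} {M : ι → InfBimodule P} {N : InfBimodule P}
    (F : ∀ k, Hom (M k) N) {I : Type} [Finite I] (k : ι) (a : (M k).obj I) :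
    (directSumHom F).app I (DirectSum.lof K ι (fun k => (M k).obj I) k a) = (F k).app I a :=
  DirectSum.toModule_lof K (M := fun k => (M k).obj I) (φ := fun k => (F k).app I) k a

/-- A morphism into `Q` with image in that of an injective `f : P → Q`, as a morphism into `P`. -/
def Hom.lift {f : P.Hom Q} (hf : ∀ (I : Type) [Finite I], Function.Injective (f.app I))
    (F : Hom M (ofHom f))
    (hF : ∀ (I : Type) [Finite I] (m : M.obj I), F.app I m ∈ LinearMap.range (f.app I)) :
    Hom M (self P) :=
  have key : ∀ (I : Type) [Finite I] (m : M.obj I), f.app I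
      ((LinearEquiv.ofInjective (f.app I) (hf I)).symm ⟨F.app I m, hF I m⟩) = F.app I m :=
    fun I _ m => congrArg Subtype.val
      ((LinearEquiv.ofInjective (f.app I) (hf I)).apply_symm_apply ⟨F.app I m, hF I m⟩)
  { app := fun I _ => (LinearEquiv.ofInjective (f.app I) (hf I)).symm.toLinearMap.comp
      ((F.app I).codRestrict _ (hF I))
    -- Since `f` is injective, each compatibility may be tested after applying `f`, where it is that
    -- of `F`.
    app_map := fun {I J} _ _ σ m => hf J ((key J _).trans ((F.app_map σ m).trans
      ((congrArg (Q.map σ) (key I m)).symm.trans (f.app_map σ _).symm)))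
    app_lcomp := fun {I J} _ _ i p m => hf _ ((key _ _).trans ((F.app_lcomp i p m).trans
      ((congrArg (Q.comp i (f.app I p)) (key J m)).symm.trans (f.app_comp i _ _).symm)))
    app_rcomp := fun {I J} _ _ i m p => hf _ ((key _ _).trans ((F.app_rcomp i m p).trans
      ((congrArg (Q.comp i · (f.app J p)) (key I m)).symm.trans (f.app_comp i _ _).symm))) }

theorem Hom.app_lift {f : P.Hom Q} (hf : ∀ (I : Type) [Finite I], Function.Injective (f.app I))
    (F : Hom M (ofHom f))
    (hF : ∀ (I : Type) [Finite I] (m : M.obj I), F.app I m ∈ LinearMap.range (f.app I))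
    {I : Type} [Finite I] (m : M.obj I) : f.app I ((F.lift hf hF).app I m) = F.app I m :=
  congrArg Subtype.val
    ((LinearEquiv.ofInjective (f.app I) (hf I)).apply_symm_apply ⟨F.app I m, hF I m⟩)

/-- A morphism into `Ass⁺` that vanishes on the empty set is a morphism into `Ass`. -/
def Hom.toAss {M : InfBimodule (lie K)} (F : Hom M (ofHom (lieToAssPlus K)))
    (h : ∀ (I : Type) [Finite I] (m : M.obj I), IsEmpty I → F.app I m = 0) :
    Hom M (ofHom (lieToAss K)) where
  app I _ := (F.app I).codRestrict _ (h I)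
  app_map σ m := Subtype.ext (F.app_map σ m)
  app_lcomp i p m := Subtype.ext (F.app_lcomp i p m)
  app_rcomp i m p := Subtype.ext (F.app_rcomp i m p)

end InfBimodule

/-! ### The Poincaré–Birkhoff–Witt isomorphisms -/

section

open scoped DirectSum

variable {ι : Type} {c : ι → ℕ}

variable (K) in
/-- The value of the `k`-th symmetric power of `Lie` on `I`. -/
abbrev LieSym (k : ℕ) (I : Type) [Finite I] : Type u :=
  ((InfBimodule.self (lie K)).symPow k).obj I

variable (K) in
/-- Symmetrization as a map on `Sym^k(Lie)(I)`. -/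
def symmetrizationOn (k : ℕ) (I : Type) [Finite I] : LieSym K k I →ₗ[K] FreeAlgebra K I :=
  (assMultilinear K I).subtype.comp ((symmetrizationHom K k).app I)

open Classical in
/-- Symmetrization on a direct sum of symmetric powers of `Lie`. -/
def symmetrizationSum (c : ι → ℕ) (I : Type) [Finite I] :
    (⨁ i, LieSym K (c i) I) →ₗ[K] FreeAlgebra K I :=
  DirectSum.toModule K ι _ fun i => symmetrizationOn K (c i) I

open Classical in
theorem symmetrizationSum_lof {I : Type} [Finite I] (i : ι)
    (a : LieSym K (c i) I) : symmetrizationSum c I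
      (DirectSum.lof K ι (fun i => LieSym K (c i) I) i a) = symmetrizationOn K (c i) I a :=
  DirectSum.toModule_lof K (M := fun i => LieSym K (c i) I)
    (φ := fun i => symmetrizationOn K (c i) I) i a

/-- Let `i` be an index in the support of `x` with `c i` maximal. Applying `symProjection` in degree
`c i` kills all other summands, which have strictly smaller degree as `c` is injective, and
multiplies `x i` by a nonzero factorial. So `x i = 0`, contradicting the choice of `i`. -/
theorem symmetrizationSum_eq_zero [CharZero K] (hc : Function.Injective c) {I : Type}
    [Finite I] {x : ⨁ i, LieSym K (c i) I}
    (hx : symmetrizationSum (K := K) c I x = 0) : x = 0 := by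
  classical
  by_contra hne
  have hs : (DFinsupp.support x).Nonempty := by
    rw [Finset.nonempty_iff_ne_empty]
    exact fun h => hne (DFinsupp.support_eq_empty.1 h)
  obtain ⟨i, hi, hmax⟩ := Finset.exists_max_image (DFinsupp.support x) c hs
  have h1 : symmetrizationSum (K := K) c I x =
      ∑ j ∈ DFinsupp.support x, symmetrizationOn K (c j) I (x j) := by
    conv_lhs => rw [← DirectSum.sum_support_of x]
    rw [map_sum]
    exact Finset.sum_congr rfl fun j _ => symmetrizationSum_lof j (x j)
  have h2 : symProjection K (c i) I (symmetrizationSum c I x) =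
      symProjection K (c i) I (symmetrizationOn K (c i) I (x i)) := by
    rw [h1, map_sum, Finset.sum_eq_single i]
    · intro j hj hji
      exact symProjection_symmetrization_of_lt
        (lt_of_le_of_ne (hmax j hj) fun e => hji (hc e)) _
    · exact fun h => (h hi).elim
  rw [hx, map_zero] at h2
  exact DFinsupp.mem_support_iff.1 hi (eq_zero_of_symProjection_symmetrization h2.symm)

/-- The element `x` is `a` placed in the summand `i`. Its value is used for surjectivity, its
component for evaluating the retraction. -/
theorem exists_symmetrizationSum_eq (i : ι) {I : Type} [Finite I] (a : LieSym K (c i) I) :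
    ∃ x, symmetrizationSum c I x = symmetrizationOn K (c i) I a ∧
      DirectSum.component K ι (fun i => LieSym K (c i) I) i x = a := by
  classical
  exact ⟨_, symmetrizationSum_lof i a,
    DirectSum.component.lof_self K (M := fun i => LieSym K (c i) I) i a⟩

/-- A nonempty set has no map to `Fin 0`, so it has no decomposition into zero pieces. -/
theorem symPow_zero_eq_zero {I : Type} [Finite I] [Nonempty I]
    (a : SymPow (lieSelf K).toSModule 0 I) : a = 0 :=
  symPow_eq LinearMap.id 0 (fun f _ => (f (Classical.arbitrary I)).elim0) a

theorem symPow_eq_zero_of_isEmpty {k : ℕ} (hk : 1 ≤ k) {I : Type} [Finite I] [IsEmpty I]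
    (a : SymPow (lieSelf K).toSModule k I) : a = 0 :=
  symPow_eq LinearMap.id 0 (fun _ m => sprod_eq_zero_of_not_surjective
    (fun h => isEmptyElim (h ⟨0, hk⟩).choose) m) a

variable (K)

/-- Symmetrization in positive degree, as a morphism to `Ass`. -/
def symmetrizationAss (k : ℕ) (hk : 1 ≤ k) : InfBimodule.Hom
    ((InfBimodule.self (lie K)).symPow k) (InfBimodule.ofHom (lieToAss K)) :=
  (symmetrizationHom K k).toAss fun _ _ m _ =>
    (congrArg _ (symPow_eq_zero_of_isEmpty hk m)).trans (map_zero _)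

/-- The Poincaré–Birkhoff–Witt morphism to `Ass⁺`. -/
def pbwPlus (c : ι → ℕ) : InfBimodule.Hom
    (InfBimodule.directSum fun i => (InfBimodule.self (lie K)).symPow (c i))
    (InfBimodule.ofHom (lieToAssPlus K)) :=
  InfBimodule.directSumHom fun i => symmetrizationHom K (c i)

/-- The Poincaré–Birkhoff–Witt morphism to `Ass`. -/
def pbw (c : ι → ℕ) (hc : ∀ i, 1 ≤ c i) : InfBimodule.Hom
    (InfBimodule.directSum fun i => (InfBimodule.self (lie K)).symPow (c i))
    (InfBimodule.ofHom (lieToAss K)) :=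
  InfBimodule.directSumHom fun i => symmetrizationAss K (c i) (hc i)

variable {K}

/-- Together with `pbw_coe`, this reduces both bijectivity statements to properties of the single
linear map `symmetrizationSum` into the free algebra. -/
theorem pbwPlus_coe {I : Type} [Finite I]
    (x : (InfBimodule.directSum fun i => (InfBimodule.self (lie K)).symPow (c i)).obj I) :
    ((pbwPlus K c).app I x).1 = symmetrizationSum c I x := by
  classical
  refine LinearMap.congr_fun (f := (assMultilinear K I).subtype.comp ((pbwPlus K c).app I))
    (g := symmetrizationSum c I)
    (DirectSum.linearMap_ext K fun k => LinearMap.ext fun a => ?_) x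
  exact (congrArg Subtype.val (InfBimodule.directSumHom_lof
    (M := fun i => (InfBimodule.self (lie K)).symPow (c i))
    (fun i => symmetrizationHom K (c i)) k a)).trans
    (symmetrizationSum_lof k a).symm

theorem pbw_coe (hc : ∀ i, 1 ≤ c i) {I : Type} [Finite I]
    (x : (InfBimodule.directSum fun i => (InfBimodule.self (lie K)).symPow (c i)).obj I) :
    ((pbw K c hc).app I x).1.1 = symmetrizationSum c I x := by
  classical
  refine LinearMap.congr_fun (f := (assMultilinear K I).subtype.comp
    ((Submodule.subtype _).comp ((pbw K c hc).app I))) (g := symmetrizationSum c I)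
    (DirectSum.linearMap_ext K fun k => LinearMap.ext fun a => ?_) x
  exact (congrArg (fun y : (ass K).obj I => y.1.1) (InfBimodule.directSumHom_lof
    (M := fun i => (InfBimodule.self (lie K)).symPow (c i))
    (fun i => symmetrizationAss K (c i) (hc i)) k a)).trans
    (symmetrizationSum_lof k a).symm

/-- The alternative in `h` allows degrees to be left out of the index set when the corresponding
symmetric power vanishes on `I`. It serves the sum over `k ≥ 1`, where degree `0` is absent, on
nonempty `I`. -/
theorem exists_symmetrizationSum [CharZero K] {I : Type} [Finite I]
    (h : ∀ k, (∃ i, c i = k) ∨ ∀ a : LieSym K k I, a = 0) {a : FreeAlgebra K I}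
    (ha : a ∈ assMultilinear K I) : ∃ x, symmetrizationSum c I x = a := by
  have h' : symRange K I ≤ LinearMap.range (symmetrizationSum (K := K) c I) := by
    refine iSup_le fun k => ?_
    rintro _ ⟨y, rfl⟩
    rcases h k with ⟨i, rfl⟩ | h0
    · obtain ⟨x, hx, -⟩ := exists_symmetrizationSum_eq (K := K) (c := c) i y
      exact ⟨x, hx⟩
    · rw [show y = 0 from h0 y, map_zero]
      exact zero_mem _
  exact h' (assMultilinear_le_symRange I ha)

theorem pbwPlus_bijective [CharZero K] (I : Type) [Finite I] :
    Function.Bijective ((pbwPlus K fun k : ℕ => k).app I) := by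
  constructor
  · rw [← LinearMap.ker_eq_bot, LinearMap.ker_eq_bot']
    intro x hx
    exact symmetrizationSum_eq_zero Function.injective_id
      ((pbwPlus_coe x).symm.trans (congrArg Subtype.val hx))
  · intro a
    obtain ⟨x, hx⟩ := exists_symmetrizationSum (c := fun k : ℕ => k)
      (fun k => Or.inl ⟨k, rfl⟩) a.2
    exact ⟨x, Subtype.ext ((pbwPlus_coe x).trans hx)⟩

theorem pbw_bijective [CharZero K] (I : Type) [Finite I] :
    Function.Bijective ((pbw K (fun k : {k : ℕ // 1 ≤ k} => k.1) fun k => k.2).app I) := by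
  constructor
  · rw [← LinearMap.ker_eq_bot, LinearMap.ker_eq_bot']
    intro x hx
    exact symmetrizationSum_eq_zero Subtype.val_injective
      ((pbw_coe _ x).symm.trans (congrArg (fun z : (ass K).obj I => z.1.1) hx))
  · intro a
    -- On the empty set `Ass` is zero; on nonempty sets the missing degree `0` contributes nothing.
    cases isEmpty_or_nonempty I with
    | inl hI => exact ⟨0, (map_zero _).trans (Subtype.ext (a.2 hI)).symm⟩
    | inr hI =>
      obtain ⟨x, hx⟩ := exists_symmetrizationSum (c := fun k : {k : ℕ // 1 ≤ k} => k.1)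
        (fun k => by
          rcases Nat.eq_zero_or_pos k with rfl | hk
          · exact Or.inr symPow_zero_eq_zero
          · exact Or.inl ⟨⟨k, hk⟩, rfl⟩) a.1.2
      exact ⟨x, Subtype.ext (Subtype.ext ((pbw_coe _ x).trans hx))⟩

/-! ### The retraction of `Ass` onto `Lie` -/

theorem lieToAss_injective (I : Type) [Finite I] : Function.Injective ((lieToAss K).app I) := by
  rw [← LinearMap.ker_eq_bot, LinearMap.ker_eq_bot']
  exact fun p hp => lieToFree_injOn p (congrArg (fun z => z.1.1) hp)

theorem lieEval_id {I : Type} [Finite I] (p : (lieSelf K).obj I) :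
    lieEval id p = ((lieToAss K).app I p).1.1 := by
  have : assRename K id = AlgHom.id K (FreeAlgebra K I) := by
    ext x; simp [assRename]
  change assRename K id _ = _
  rw [this]
  rfl

theorem symmetrization_one_sprod {I : Type} [Finite I] (f : I → Fin 1)
    (m : ∀ b, (lieSelf K).obj (Fib f b)) :
    symmetrization 1 I (sprod (lieSelf K).toSModule f m) =
      lieEval (Subtype.val : Fib f 0 → I) (m 0) := by
  rw [symmetrization_sprod, symProd_apply]
  simp
  rfl

/-- With a single piece the fibre is all of `I` and the average has one term, so symmetrization is
just the associative polynomial of a Lie operation on `I`. -/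
theorem symmetrization_one_mem_range {I : Type} [Finite I]
    (a : SymPow (lieSelf K).toSModule 1 I) :
    symmetrization 1 I a ∈
      LinearMap.range (lieEval id : (lieSelf K).obj I →ₗ[K] FreeAlgebra K I) := by
  rw [← Submodule.Quotient.mk_eq_zero]
  refine symPow_eq ((LinearMap.range
    (lieEval id : (lieSelf K).obj I →ₗ[K] FreeAlgebra K I)).mkQ.comp (symmetrization 1 I)) 0
    (fun f m => ?_) a
  rw [LinearMap.comp_apply, LinearMap.zero_apply, Submodule.mkQ_apply,
    Submodule.Quotient.mk_eq_zero]
  let e : Fib f 0 ≃ I := Equiv.subtypeUnivEquiv fun x => Subsingleton.elim _ _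
  exact ⟨(lieSelf K).map e (m 0),
    (lieEval_map e id (m 0)).trans (symmetrization_one_sprod f m).symm⟩

theorem symmetrizationAss_one_mem_range {I : Type} [Finite I]
    (a : SymPow (lieSelf K).toSModule 1 I) :
    (symmetrizationAss K 1 le_rfl).app I a ∈ LinearMap.range ((lieToAss K).app I) := by
  obtain ⟨p, hp⟩ := symmetrization_one_mem_range a
  exact ⟨p, Subtype.ext (Subtype.ext ((lieEval_id p).symm.trans hp))⟩

/-- The witness is `p` as a product with one factor, transported to the unique piece, the fibre of
the constant decomposition. -/
theorem exists_symmetrizationAss_one {I : Type} [Finite I] (p : (lie K).obj I) :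
    ∃ a : SymPow (lieSelf K).toSModule 1 I,
      (symmetrizationAss K 1 le_rfl).app I a = (lieToAss K).app I p := by
  let e : ∀ b, Fib (fun _ : I => (0 : Fin 1)) b ≃ I := fun b =>
    Equiv.subtypeUnivEquiv fun x => Subsingleton.elim _ _
  refine ⟨sprod (lieSelf K).toSModule (fun _ => 0) fun b => (lieSelf K).map (e b).symm p,
    Subtype.ext (Subtype.ext ?_)⟩
  refine (symmetrization_one_sprod _ _).trans ?_
  refine (lieEval_map (e 0).symm Subtype.val p).trans (Eq.trans ?_ (lieEval_id p))
  congr 1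

variable (K) in
/-- The isomorphism `Ass ≅ ⨁_{k ≥ 1} Sym^k(Lie)`. -/
def pbwIso [CharZero K] : InfBimodule.Iso (InfBimodule.ofHom (lieToAss K))
    (InfBimodule.directSum fun k : {k : ℕ // 1 ≤ k} => (InfBimodule.self (lie K)).symPow k) :=
  InfBimodule.isoOfBijective (pbw K _ fun k => k.2) pbw_bijective

variable (K) in
/-- The identification of `Sym¹(Lie)` with `Lie`. -/
def symPowOneHom :
    InfBimodule.Hom ((InfBimodule.self (lie K)).symPow 1) (InfBimodule.self (lie K)) :=
  (symmetrizationAss K 1 le_rfl).lift lieToAss_injective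
    fun _ _ a => symmetrizationAss_one_mem_range a

theorem lieToAss_symPowOneHom {I : Type} [Finite I]
    (a : ((InfBimodule.self (lie K)).symPow 1).obj I) :
    (lieToAss K).app I ((symPowOneHom K).app I a) = (symmetrizationAss K 1 le_rfl).app I a :=
  InfBimodule.Hom.app_lift lieToAss_injective (symmetrizationAss K 1 le_rfl)
    (fun _ _ a => symmetrizationAss_one_mem_range a) a

variable (K) in
/-- The retraction `Ass → Lie`. -/
def lieRetraction [CharZero K] :
    InfBimodule.Hom (InfBimodule.ofHom (lieToAss K)) (InfBimodule.self (lie K)) :=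
  (symPowOneHom K).comp ((InfBimodule.directSumProj _ ⟨1, le_rfl⟩).comp (pbwIso K).hom)

/-- The image of `p` in `Ass` is the symmetrization of a degree-one element `a`. The isomorphism
therefore sends it to `a` in the summand `k = 1`, the projection returns `a`, and the Lie operation
belonging to `a` has the same image in `Ass` as `p`. Injectivity of `Lie → Ass` concludes. -/
theorem lieRetraction_lieToAss [CharZero K] {I : Type} [Finite I] (p : (lie K).obj I) :
    (lieRetraction K).app I ((lieToAss K).app I p) = p := by
  obtain ⟨a, ha⟩ := exists_symmetrizationAss_one p
  obtain ⟨x, hx, hx'⟩ := exists_symmetrizationSum_eq (K := K)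
    (c := fun k : {k : ℕ // 1 ≤ k} => k.1) ⟨1, le_rfl⟩ a
  have h1 : (pbw K _ fun k => k.2).app I x = (lieToAss K).app I p :=
    Subtype.ext (Subtype.ext ((pbw_coe _ x).trans
      (hx.trans (congrArg (fun z : (ass K).obj I => z.1.1) ha))))
  -- The inverse direction of `pbwIso` is `pbw` itself, so the isomorphism undoes the equality `h1`.
  have h2 : (pbwIso K).hom.app I ((lieToAss K).app I p) = x :=
    (congrArg ((pbwIso K).hom.app I) h1.symm).trans ((pbwIso K).inv_hom I x)
  have h3 : (InfBimodule.directSumProj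
      (fun k : {k : ℕ // 1 ≤ k} => (InfBimodule.self (lie K)).symPow k) ⟨1, le_rfl⟩).app I
      ((pbwIso K).hom.app I ((lieToAss K).app I p)) = a :=
    (congrArg _ h2).trans hx'
  have h4 : (lieRetraction K).app I ((lieToAss K).app I p) = (symPowOneHom K).app I a :=
    Eq.trans rfl (congrArg ((symPowOneHom K).app I) h3)
  rw [h4]
  exact lieToAss_injective I ((lieToAss_symPowOneHom a).trans ha)

end

end PBWOperad
end

theorem mainTheorem10 (K : Type u) [Field K] [CharZero K] :
    Nonempty (PBWOperad.InfBimodule.Iso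
      (PBWOperad.InfBimodule.ofHom (PBWOperad.lieToAssPlus K))
      (PBWOperad.InfBimodule.directSum fun k : ℕ =>
        (PBWOperad.InfBimodule.self (PBWOperad.lie K)).symPow k)) ∧
    Nonempty (PBWOperad.InfBimodule.Iso
      (PBWOperad.InfBimodule.ofHom (PBWOperad.lieToAss K))
      (PBWOperad.InfBimodule.directSum fun k : {k : ℕ // 1 ≤ k} =>
        (PBWOperad.InfBimodule.self (PBWOperad.lie K)).symPow k)) ∧
    ∃ s : PBWOperad.InfBimodule.Hom (PBWOperad.InfBimodule.ofHom (PBWOperad.lieToAss K))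
        (PBWOperad.InfBimodule.self (PBWOperad.lie K)),
      ∀ (I : Type) [Finite I] (x : (PBWOperad.lie K).obj I),
        s.app I ((PBWOperad.lieToAss K).app I x) = x :=
  ⟨⟨PBWOperad.InfBimodule.isoOfBijective (PBWOperad.pbwPlus K _) PBWOperad.pbwPlus_bijective⟩,
    ⟨PBWOperad.pbwIso K⟩, PBWOperad.lieRetraction K,
    fun _ _ x => PBWOperad.lieRetraction_lieToAss x⟩
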